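/- For $r>1$ let $A(r)=\{z\in\mathbb C:1<|z|<r\}$ and $\overline{A}(r)=\{z\in\mathbb C:1\le|z|\le r\}$. For $K\ge 1$, a homeomorphism $\psi$ between open subsets of $\mathbb C$ is $K$-quasiconformal ($K$-q.c.) if it has distributional first partial derivatives in $L^2_{loc}$ and $|\psi_{\bar z}|\le\frac{K-1}{K+1}|\psi_z|$ almost everywhere. If $\gamma:[a,b]\to\mathbb C\setminus\{0\}$ is a curve written in polar coordinates as $\gamma(t)=\rho(t)e^{i\theta(t)}$ with $\rho>0$ and $\theta$ continuous, its wrapping number is $\theta(b)-\theta(a)$. Let $K\ge 1$ and $r>1$. Then there is a constant $N$, depending only on $K$ and $r$, such that for every $r'>1$ and every $K$-q.c. homeomorphism $\psi$ of $A(r)$ onto $A(r')$ the following holds: $\psi$ extends continuously to $\overline{A}(r)$, and the curve $t\mapsto\psi(t)$, $t\in[1,r]$ (with $\psi(1)$ and $\psi(r)$ given by this extension), has wrapping number in $[-N,N]$. -/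

import Mathlib

open MeasureTheory Set
open scoped ContDiff

/-- The open round annulus `{1 < |z| < r}`. -/
def roundAnnulus (r : ℝ) : Set ℂ := {z | 1 < ‖z‖ ∧ ‖z‖ < r}

/-- The closed round annulus `{1 ≤ |z| ≤ r}`. -/
def closedRoundAnnulus (r : ℝ) : Set ℂ := {z | 1 ≤ ‖z‖ ∧ ‖z‖ ≤ r}

/-- On the open set `U`, the function `g` is the weak (distributional) derivative of `f`
in the direction `v`: `∫ (∂φ/∂v) f = - ∫ φ g` for all test functions `φ ∈ C_c^∞(U)`. -/
def IsWeakDerivOn (U : Set ℂ) (f g : ℂ → ℂ) (v : ℂ) : Prop :=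
  ∀ φ : ℂ → ℝ, ContDiff ℝ ∞ φ → HasCompactSupport φ → tsupport φ ⊆ U →
    ∫ z, (fderiv ℝ φ z v) • f z = - ∫ z, φ z • g z

/-- `g` is in `L²_loc(U)`, with respect to the Lebesgue measure. -/
def IsL2Loc (U : Set ℂ) (g : ℂ → ℂ) : Prop :=
  ∀ C : Set ℂ, IsCompact C → C ⊆ U → MemLp g 2 (volume.restrict C)

/-- The homeomorphism `ψ` from the open set `ψ.source` onto the open set `ψ.target` is `K`-q.c.
(analytic definition): it has weak partial derivatives `fx`, `fy` in `L²_loc`, and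
`|ψ_{z̄}| ≤ ((K - 1) / (K + 1)) |ψ_z|` almost everywhere, where `ψ_z = (fx - i fy) / 2` and
`ψ_{z̄} = (fx + i fy) / 2`.  The last inequality makes the Jacobian `|ψ_z|² - |ψ_{z̄}|²`
nonnegative, so that such a `ψ` preserves the orientation. -/
def IsQuasiconformal (K : ℝ) (ψ : OpenPartialHomeomorph ℂ ℂ) : Prop :=
  1 ≤ K ∧ ∃ fx fy : ℂ → ℂ,
    IsL2Loc ψ.source fx ∧ IsL2Loc ψ.source fy ∧
    IsWeakDerivOn ψ.source ψ fx 1 ∧ IsWeakDerivOn ψ.source ψ fy Complex.I ∧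
    ∀ᵐ z ∂(volume.restrict ψ.source),
      ‖(fx z + Complex.I * fy z) / 2‖ ≤ (K - 1) / (K + 1) * ‖(fx z - Complex.I * fy z) / 2‖

/-- The curve `γ : [a, b] → ℂ \ {0}` has wrapping number `w`: in polar coordinates
`γ t = ρ t * exp (i θ t)` with `ρ > 0` and `θ` continuous, and `w = θ b - θ a`. -/
def HasWrappingNumber (γ : ℝ → ℂ) (a b w : ℝ) : Prop :=
  ∃ ρ θ : ℝ → ℝ, ContinuousOn ρ (Icc a b) ∧ ContinuousOn θ (Icc a b) ∧
    (∀ t ∈ Icc a b, 0 < ρ t ∧ γ t = (ρ t : ℂ) * Complex.exp ((θ t : ℂ) * Complex.I)) ∧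
    w = θ b - θ a

/-!
Lifting through the exponential function turns `ψ` into a homeomorphism `F` of the strip `0 < re z <
R`, `R = log r`, onto the strip `0 < re z < R'` with `F (z + 2πi) = F z ± 2πi`. Quasiconformality
bounds `‖DF‖²` by `K` times the Jacobian, so the energy of `F` over one period is at most `K` times
the area `2πR'` of one period of the image. The horizontal segments are stretched to length at least
`R'`, so the length-area inequality gives `R' ≤ K R`, and the energy is at most `2πK²R`, a bound
independent of `R'`. By the Courant-Lebesgue lemma every boundary point is then cut off by crosscuts
with images of diameter bounded in terms of this energy and tending to zero. As `F` maps the ends of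
the strip to the ends of its image, it maps the region cut off by such a crosscut into a slab which
is no higher than the image of the crosscut. This yields the continuous extension to the boundary,
and bounds the variation of `im F` along the real segment, which is the wrapping number.
-/

open Filter Topology
open scoped ComplexConjugate Convolution ENNReal Real
open Complex (I)
open ContinuousLinearMap (lsmul)

theorem sq_lintegral_mul_le {α : Type*} [MeasurableSpace α] (μ : Measure α) {f g : α → ℝ≥0∞}
    (hf : AEMeasurable f μ) (hg : AEMeasurable g μ) :
    (∫⁻ x, f x * g x ∂μ) ^ 2 ≤ (∫⁻ x, f x ^ 2 ∂μ) * ∫⁻ x, g x ^ 2 ∂μ := by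
  have holder := ENNReal.lintegral_mul_le_Lp_mul_Lq μ Real.HolderConjugate.two_two hf hg
  have sq_sqrt (x : ℝ≥0∞) : (x ^ (1 / 2 : ℝ)) ^ 2 = x := by
    rw [← ENNReal.rpow_natCast, ← ENNReal.rpow_mul]; norm_num
  simp only [Pi.mul_apply, ENNReal.rpow_two] at holder
  calc (∫⁻ x, f x * g x ∂μ) ^ 2
      ≤ ((∫⁻ x, f x ^ 2 ∂μ) ^ (1 / 2 : ℝ) * (∫⁻ x, g x ^ 2 ∂μ) ^ (1 / 2 : ℝ)) ^ 2 := by gcongr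
    _ = (∫⁻ x, f x ^ 2 ∂μ) * ∫⁻ x, g x ^ 2 ∂μ := by rw [mul_pow, sq_sqrt, sq_sqrt]

theorem sq_lintegral_le {α : Type*} [MeasurableSpace α] (μ : Measure α) {f : α → ℝ≥0∞}
    (hf : AEMeasurable f μ) : (∫⁻ x, f x ∂μ) ^ 2 ≤ μ univ * ∫⁻ x, f x ^ 2 ∂μ := by
  simpa using sq_lintegral_mul_le μ (f := 1) aemeasurable_const hf

theorem lintegral_enorm_le_rpow_lintegral_rpow {α F : Type*} [MeasurableSpace α]
    [NormedAddCommGroup F] (μ : Measure α) [IsProbabilityMeasure μ] {p : ℝ} (hp : 1 ≤ p)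
    {f : α → F} (hf : AEStronglyMeasurable f μ) :
    (∫⁻ x, ‖f x‖ₑ ∂μ) ^ p ≤ ∫⁻ x, ‖f x‖ₑ ^ p ∂μ := by
  have h := eLpNorm'_le_eLpNorm'_of_exponent_le one_pos hp μ hf
  rw [← ENNReal.le_rpow_inv_iff (by positivity)]
  simpa [eLpNorm'_eq_lintegral_enorm, one_div] using h

section Mollification

variable {E F : Type*} [NormedAddCommGroup E] [NormedSpace ℝ E] [FiniteDimensional ℝ E]
  [MeasurableSpace E] [BorelSpace E] {μ : Measure E} [μ.IsAddHaarMeasure]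
  [NormedAddCommGroup F] [NormedSpace ℝ F]

theorem isProbabilityMeasure_withDensity_normed (φ : ContDiffBump (0 : E)) :
    IsProbabilityMeasure (μ.withDensity fun t => ‖φ.normed μ t‖ₑ) := by
  refine ⟨?_⟩
  rw [withDensity_apply _ MeasurableSet.univ, Measure.restrict_univ,
    lintegral_congr fun t => Real.enorm_eq_ofReal (φ.nonneg_normed t),
    ← ofReal_integral_eq_lintegral_ofReal φ.integrable_normed
      (Eventually.of_forall φ.nonneg_normed), φ.integral_normed, ENNReal.ofReal_one]

theorem enorm_normed_convolution_rpow_le (φ : ContDiffBump (0 : E)) {h : E → F}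
    (hh : AEStronglyMeasurable h μ) {p : ℝ} (hp : 1 ≤ p) (z : E) :
    ‖(φ.normed μ ⋆[lsmul ℝ ℝ, μ] h) z‖ₑ ^ p ≤
      ∫⁻ t, ‖φ.normed μ t‖ₑ * ‖h (z - t)‖ₑ ^ p ∂μ := by
  have hρ : Measurable fun t => ‖φ.normed μ t‖ₑ := φ.continuous_normed.enorm.measurable
  have hz : AEStronglyMeasurable (fun t => h (z - t)) μ :=
    hh.comp_quasiMeasurePreserving (quasiMeasurePreserving_sub_left μ z)
  have := isProbabilityMeasure_withDensity_normed (μ := μ) φ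
  set ν := μ.withDensity fun t => ‖φ.normed μ t‖ₑ with hν
  calc ‖(φ.normed μ ⋆[lsmul ℝ ℝ, μ] h) z‖ₑ ^ p
      ≤ (∫⁻ t, ‖φ.normed μ t‖ₑ * ‖h (z - t)‖ₑ ∂μ) ^ p := by
        gcongr
        simpa only [convolution_def, ContinuousLinearMap.lsmul_apply, enorm_smul] using
          enorm_integral_le_lintegral_enorm (μ := μ) fun t => φ.normed μ t • h (z - t)
    _ = (∫⁻ t, ‖h (z - t)‖ₑ ∂ν) ^ p := by
        rw [hν, lintegral_withDensity_eq_lintegral_mul₀ hρ.aemeasurable hz.enorm]; rfl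
    _ ≤ ∫⁻ t, ‖h (z - t)‖ₑ ^ p ∂ν :=
        lintegral_enorm_le_rpow_lintegral_rpow ν hp
          (hz.mono_ac (withDensity_absolutelyContinuous _ _))
    _ = ∫⁻ t, ‖φ.normed μ t‖ₑ * ‖h (z - t)‖ₑ ^ p ∂μ := by
        rw [hν, lintegral_withDensity_eq_lintegral_mul₀ hρ.aemeasurable (hz.enorm.pow_const p)]; rfl

theorem lintegral_enorm_normed_convolution_rpow_le (φ : ContDiffBump (0 : E)) {h : E → F}
    (hh : AEStronglyMeasurable h μ) {p : ℝ} (hp : 1 ≤ p) :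
    ∫⁻ z, ‖(φ.normed μ ⋆[lsmul ℝ ℝ, μ] h) z‖ₑ ^ p ∂μ ≤ ∫⁻ z, ‖h z‖ₑ ^ p ∂μ := by
  have hρ : Measurable fun t => ‖φ.normed μ t‖ₑ := φ.continuous_normed.enorm.measurable
  calc ∫⁻ z, ‖(φ.normed μ ⋆[lsmul ℝ ℝ, μ] h) z‖ₑ ^ p ∂μ
      ≤ ∫⁻ z, ∫⁻ t, ‖φ.normed μ t‖ₑ * ‖h (z - t)‖ₑ ^ p ∂μ ∂μ :=
        lintegral_mono (enorm_normed_convolution_rpow_le φ hh hp)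
    _ = ∫⁻ t, ∫⁻ z, ‖φ.normed μ t‖ₑ * ‖h (z - t)‖ₑ ^ p ∂μ ∂μ := by
        refine lintegral_lintegral_swap ((hρ.comp measurable_snd).aemeasurable.mul ?_)
        have : AEStronglyMeasurable (fun q : E × E => h (q.1 - q.2)) (μ.prod μ) :=
          hh.comp_quasiMeasurePreserving (quasiMeasurePreserving_sub μ μ)
        exact this.enorm.pow_const p
    _ = ∫⁻ t, ‖φ.normed μ t‖ₑ * ∫⁻ z, ‖h z‖ₑ ^ p ∂μ ∂μ := by
        refine lintegral_congr fun t => ?_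
        rw [lintegral_const_mul' _ _ enorm_ne_top,
          lintegral_sub_right_eq_self (fun z => ‖h z‖ₑ ^ p) t]
    _ = ∫⁻ z, ‖h z‖ₑ ^ p ∂μ := by
        have hmass := (isProbabilityMeasure_withDensity_normed (μ := μ) φ).measure_univ
        rw [withDensity_apply _ MeasurableSet.univ, Measure.restrict_univ] at hmass
        rw [lintegral_mul_const _ hρ, hmass, one_mul]

theorem eLpNorm_normed_convolution_le (φ : ContDiffBump (0 : E)) {h : E → F}
    (hh : AEStronglyMeasurable h μ) {p : ℝ≥0∞} (hp : 1 ≤ p) (hp_top : p ≠ ⊤) :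
    eLpNorm (φ.normed μ ⋆[lsmul ℝ ℝ, μ] h) p μ ≤ eLpNorm h p μ := by
  have hp0 : p ≠ 0 := (zero_lt_one.trans_le hp).ne'
  rw [eLpNorm_eq_lintegral_rpow_enorm_toReal hp0 hp_top,
    eLpNorm_eq_lintegral_rpow_enorm_toReal hp0 hp_top]
  exact ENNReal.rpow_le_rpow (lintegral_enorm_normed_convolution_rpow_le φ hh
    (by simpa using ENNReal.toReal_mono hp_top hp)) (by positivity)

variable {ι : Type*} {l : Filter ι} {φ : ι → ContDiffBump (0 : E)}

section Complete

variable [CompleteSpace F]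

theorem tendstoUniformlyOn_normed_convolution (hφ : Tendsto (fun i => (φ i).rOut) l (𝓝 0))
    {g : E → F} {C V : Set E} (hC : IsCompact C) (hV : IsOpen V) (hCV : C ⊆ V)
    (hgm : AEStronglyMeasurable g μ) (hg : ContinuousOn g V) :
    TendstoUniformlyOn (fun i => (φ i).normed μ ⋆[lsmul ℝ ℝ, μ] g) g l C := by
  rw [Metric.tendstoUniformlyOn_iff]
  intro ε hε
  obtain ⟨δ₁, hδ₁, hsub⟩ := hC.exists_cthickening_subset_open hV hCV
  have huc : UniformContinuousOn g (Metric.cthickening δ₁ C) :=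
    hC.cthickening.uniformContinuousOn_of_continuous (hg.mono hsub)
  obtain ⟨δ₂, hδ₂, hosc⟩ := Metric.uniformContinuousOn_iff.1 huc (ε / 2) (by positivity)
  filter_upwards [hφ.eventually_lt_const (lt_min hδ₁ hδ₂)] with i hi z hz
  have hball : ∀ x ∈ Metric.ball z (φ i).rOut, dist (g x) (g z) ≤ ε / 2 := fun x hx => by
    have hxz := (Metric.mem_ball.1 hx).trans hi
    exact (hosc x (Metric.mem_cthickening_of_dist_le x z δ₁ C hz (hxz.le.trans (min_le_left _ _))) z
      (Metric.self_subset_cthickening _ hz) (hxz.trans_le (min_le_right _ _))).le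
  rw [dist_comm]
  exact (ContDiffBump.dist_normed_convolution_le hgm hball).trans_lt (half_lt_self hε)

theorem tendsto_eLpNorm_normed_convolution_sub_of_hasCompactSupport
    (hφ : Tendsto (fun i => (φ i).rOut) l (𝓝 0)) {k : E → F} (hk : Continuous k)
    (hks : HasCompactSupport k) {p : ℝ≥0∞} (hp_top : p ≠ ⊤) :
    Tendsto (fun i => eLpNorm ((φ i).normed μ ⋆[lsmul ℝ ℝ, μ] k - k) p μ) l (𝓝 0) := by
  set B := Metric.cthickening 1 (tsupport k)
  have hB : IsCompact B := hks.isCompact.cthickening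
  have hkB : Function.support k ⊆ B :=
    (subset_tsupport k).trans (Metric.self_subset_cthickening _)
  rw [ENNReal.tendsto_nhds_zero]
  intro ε hε
  obtain ⟨c, hcε, hc⟩ : ∃ c : ℝ, ENNReal.ofReal c * μ B ^ (1 / p.toReal) ≤ ε ∧ 0 < c := by
    have hlim : Tendsto (fun c : ℝ => ENNReal.ofReal c * μ B ^ (1 / p.toReal)) (𝓝[>] 0) (𝓝 0) := by
      have hcont : Continuous fun c : ℝ => ENNReal.ofReal c * μ B ^ (1 / p.toReal) :=
        (ENNReal.continuous_mul_const (by finiteness [(hB.measure_lt_top (μ := μ)).ne])).comp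
          ENNReal.continuous_ofReal
      simpa using (hcont.tendsto 0).mono_left nhdsWithin_le_nhds
    exact ((ENNReal.tendsto_nhds_zero.1 hlim ε hε).and self_mem_nhdsWithin).exists
  have huc := hks.uniformContinuous_of_continuous hk
  obtain ⟨δ, hδ, hosc⟩ := Metric.uniformContinuous_iff.1 huc c hc
  filter_upwards [hφ.eventually_lt_const (lt_min hδ one_pos)] with i hi
  refine (eLpNorm_sub_le_of_dist_bdd μ hp_top hB.measurableSet hc.le (fun z => ?_) ?_ hkB).trans hcε
  · refine ContDiffBump.dist_normed_convolution_le hk.aestronglyMeasurable fun x hx => ?_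
    exact (hosc ((Metric.mem_ball.1 hx).trans (hi.trans_le (min_le_left _ _)))).le
  · refine (support_convolution_subset _).trans ?_
    rintro _ ⟨t, ht, x, hx, rfl⟩
    rw [(φ i).support_normed_eq, mem_ball_zero_iff] at ht
    refine Metric.mem_cthickening_of_dist_le _ x 1 _ (subset_tsupport k hx) ?_
    simpa using (ht.trans (hi.trans_le (min_le_right _ _))).le

theorem tendsto_eLpNorm_normed_convolution_sub (hφ : Tendsto (fun i => (φ i).rOut) l (𝓝 0))
    {p : ℝ≥0∞} (hp : 1 ≤ p) (hp_top : p ≠ ⊤) {h : E → F} (hh : MemLp h p μ) :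
    Tendsto (fun i => eLpNorm ((φ i).normed μ ⋆[lsmul ℝ ℝ, μ] h - h) p μ) l (𝓝 0) := by
  rw [ENNReal.tendsto_nhds_zero]
  intro ε hε
  obtain ⟨k, hks, hhk, hk, hkp⟩ := hh.exists_hasCompactSupport_eLpNorm_sub_le hp_top
    (ENNReal.div_pos hε.ne' (by norm_num : (3 : ℝ≥0∞) ≠ ⊤)).ne'
  have hsub := hh.sub hkp
  have hk_approx := ENNReal.tendsto_nhds_zero.1
    (tendsto_eLpNorm_normed_convolution_sub_of_hasCompactSupport (μ := μ) hφ hk hks hp_top)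
    (ε / 3) (ENNReal.div_pos hε.ne' (by norm_num))
  filter_upwards [hk_approx] with i hi
  have split : (φ i).normed μ ⋆[lsmul ℝ ℝ, μ] h - h =
      ((φ i).normed μ ⋆[lsmul ℝ ℝ, μ] (h - k) - (h - k)) +
        ((φ i).normed μ ⋆[lsmul ℝ ℝ, μ] k - k) := by
    have hex {g : E → F} (hg : MemLp g p μ) :
        ConvolutionExists ((φ i).normed μ) g (lsmul ℝ ℝ) μ :=
      (φ i).hasCompactSupport_normed.convolutionExists_left _ (φ i).continuous_normed
        (hg.locallyIntegrable hp)
    have hadd := (hex hsub).distrib_add (hex hkp)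
    rw [sub_add_cancel] at hadd
    rw [hadd]
    abel
  have hmeas {g : E → F} (hg : MemLp g p μ) :
      AEStronglyMeasurable ((φ i).normed μ ⋆[lsmul ℝ ℝ, μ] g) μ :=
    ((φ i).hasCompactSupport_normed.continuous_convolution_left _ (φ i).continuous_normed
      (hg.locallyIntegrable hp)).aestronglyMeasurable
  calc eLpNorm ((φ i).normed μ ⋆[lsmul ℝ ℝ, μ] h - h) p μ
      ≤ eLpNorm ((φ i).normed μ ⋆[lsmul ℝ ℝ, μ] (h - k)) p μ + eLpNorm (h - k) p μ
        + eLpNorm ((φ i).normed μ ⋆[lsmul ℝ ℝ, μ] k - k) p μ := by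
        rw [split]
        exact (eLpNorm_add_le ((hmeas hsub).sub hsub.1) ((hmeas hkp).sub hkp.1) hp).trans
          (by gcongr; exact eLpNorm_sub_le (hmeas hsub) hsub.1 hp)
    _ ≤ ε / 3 + ε / 3 + ε / 3 := by
        gcongr
        exact (eLpNorm_normed_convolution_le _ hsub.1 hp hp_top).trans hhk
    _ = ε := ENNReal.add_thirds ε

end Complete

end Mollification

theorem eLpNorm_two_sq {α G : Type*} [MeasurableSpace α] [NormedAddCommGroup G] (μ : Measure α)
    (f : α → G) : eLpNorm f 2 μ ^ 2 = ∫⁻ x, ‖f x‖ₑ ^ 2 ∂μ := by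
  simpa using eLpNorm_nnreal_pow_eq_lintegral (μ := μ) (f := f) (p := 2) two_ne_zero

theorem ennreal_add_sq_le (a b : ℝ≥0∞) : (a + b) ^ 2 ≤ 2 * (a ^ 2 + b ^ 2) := by
  have := ENNReal.rpow_add_le_mul_rpow_add_rpow a b (p := 2) (by norm_num)
  norm_num at this
  exact_mod_cast this

/-- The real-linear endomorphism of `ℂ` sending `1` to `p` and `I` to `q`, that is, the derivative
of a planar map with partial derivatives `p` and `q`. -/
noncomputable def clmOfPartials (p q : ℂ) : ℂ →L[ℝ] ℂ :=
  Complex.reCLM.smulRight p + Complex.imCLM.smulRight q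

theorem clmOfPartials_apply (p q v : ℂ) : clmOfPartials p q v = v.re * p + v.im * q := by
  simp [clmOfPartials]

theorem clmOfPartials_apply_one_I (L : ℂ →L[ℝ] ℂ) : clmOfPartials (L 1) (L I) = L := by
  ext v
  have hv : v = v.re • (1 : ℂ) + v.im • I := by simp
  conv_rhs => rw [hv, map_add, map_smul, map_smul]
  simp [clmOfPartials_apply]

theorem enorm_le_enorm_apply_one_add_enorm_apply_I (L : ℂ →L[ℝ] ℂ) :
    ‖L‖ₑ ≤ ‖L 1‖ₑ + ‖L I‖ₑ := by
  simp only [← ofReal_norm, ← ENNReal.ofReal_add (norm_nonneg _) (norm_nonneg _)]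
  gcongr
  refine L.opNorm_le_bound (by positivity) fun v => ?_
  calc ‖L v‖ = ‖(v.re : ℂ) * L 1 + v.im * L I‖ := by
        rw [← clmOfPartials_apply, clmOfPartials_apply_one_I]
    _ ≤ |v.re| * ‖L 1‖ + |v.im| * ‖L I‖ := by
        simpa only [norm_mul, Complex.norm_real, Real.norm_eq_abs] using
          norm_add_le ((v.re : ℂ) * L 1) (v.im * L I)
    _ ≤ ‖v‖ * ‖L 1‖ + ‖v‖ * ‖L I‖ := by
        gcongr
        exacts [Complex.abs_re_le_norm v, Complex.abs_im_le_norm v]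
    _ = (‖L 1‖ + ‖L I‖) * ‖v‖ := by ring

theorem fderiv_convolution_lsmul_apply {ρ : ℂ → ℝ} (hρ : ContDiff ℝ 1 ρ) (hρs : HasCompactSupport ρ)
    {f : ℂ → ℂ} (hf : LocallyIntegrable f) (z v : ℂ) :
    fderiv ℝ (ρ ⋆[lsmul ℝ ℝ, volume] f) z v = ∫ t, fderiv ℝ ρ (z - t) v • f t := by
  rw [(hρs.hasFDerivAt_convolution_left (lsmul ℝ ℝ) hρ hf z).fderiv, convolution_eq_swap,
    ContinuousLinearMap.integral_apply]
  · simp only [ContinuousLinearMap.precompL_apply, ContinuousLinearMap.lsmul_apply]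
  · exact ((hρs.fderiv (𝕜 := ℝ)).convolutionExists_left ((lsmul ℝ ℝ (E := ℂ)).precompL ℂ)
      (μ := volume) (hρ.continuous_fderiv one_ne_zero) hf z).integrable_swap

theorem fderiv_comp_const_sub {ρ : ℂ → ℝ} (hρ : Differentiable ℝ ρ) (z t v : ℂ) :
    fderiv ℝ (fun t => ρ (z - t)) t v = -fderiv ℝ ρ (z - t) v := by
  have h := (hρ (z - t)).hasFDerivAt.comp t ((hasFDerivAt_id t).const_sub z)
  rw [HasFDerivAt.fderiv (f := fun t => ρ (z - t)) h]
  simp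

theorem IsWeakDerivOn.fderiv_convolution_indicator {U C : Set ℂ} {f g : ℂ → ℂ} {v : ℂ}
    (hfg : IsWeakDerivOn U f g v) (hCU : C ⊆ U) (hfi : LocallyIntegrable (C.indicator f))
    {ρ : ℂ → ℝ} (hρ : ContDiff ℝ ∞ ρ) (hρs : HasCompactSupport ρ) {z : ℂ}
    (hz : tsupport (fun t => ρ (z - t)) ⊆ C) :
    fderiv ℝ (ρ ⋆[lsmul ℝ ℝ, volume] C.indicator f) z v =
      (ρ ⋆[lsmul ℝ ℝ, volume] C.indicator g) z := by
  have hρd := fderiv_comp_const_sub (hρ.differentiable (by simp)) z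
  have smul_indicator {θ : ℂ → ℝ} (hθ : ∀ t ∉ C, θ t = 0) (h : ℂ → ℂ) (t : ℂ) :
      θ t • C.indicator h t = θ t • h t := by
    by_cases ht : t ∈ C <;> simp [ht, hθ]
  have hρ_zero : ∀ t ∉ C, ρ (z - t) = 0 := fun t ht =>
    image_eq_zero_of_notMem_tsupport (f := fun t => ρ (z - t)) fun h => ht (hz h)
  have hρd_zero : ∀ t ∉ C, fderiv ℝ ρ (z - t) v = 0 := fun t ht => by
    rw [← neg_eq_zero, ← hρd, fderiv_of_notMem_tsupport (𝕜 := ℝ) (f := fun t => ρ (z - t))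
      fun h => ht (hz h)]
    rfl
  calc fderiv ℝ (ρ ⋆[lsmul ℝ ℝ, volume] C.indicator f) z v
      = ∫ t, fderiv ℝ ρ (z - t) v • f t := by
        simp only [fderiv_convolution_lsmul_apply (hρ.of_le (by simp)) hρs hfi,
          smul_indicator hρd_zero]
    _ = -∫ t, fderiv ℝ (fun t => ρ (z - t)) t v • f t := by
        simp only [hρd, neg_smul, integral_neg, neg_neg]
    _ = ∫ t, ρ (z - t) • g t := by
        rw [hfg (fun t => ρ (z - t)) (hρ.comp (contDiff_const.sub contDiff_id))
          (hρs.comp_homeomorph (Homeomorph.subLeft z)) (hz.trans hCU), neg_neg]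
    _ = (ρ ⋆[lsmul ℝ ℝ, volume] C.indicator g) z := by
        simp only [convolution_lsmul_swap, smul_indicator hρ_zero]

theorem IsWeakDerivOn.tendsto_lintegral_fderiv_convolution {U C C' : Set ℂ} (hC : IsCompact C)
    (hC' : IsCompact C') (hCC' : C ⊆ interior C') (hC'U : C' ⊆ U) {φ : ℕ → ContDiffBump (0 : ℂ)}
    (hφ : Tendsto (fun n => (φ n).rOut) atTop (𝓝 0)) {f g : ℂ → ℂ} {v : ℂ}
    (hf : LocallyIntegrable (C'.indicator f)) (hg : IsL2Loc U g) (hfg : IsWeakDerivOn U f g v) :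
    Tendsto (fun n => ∫⁻ z in C,
      ‖fderiv ℝ ((φ n).normed volume ⋆[lsmul ℝ ℝ, volume] C'.indicator f) z v - g z‖ₑ ^ 2)
      atTop (𝓝 0) := by
  have hg' : MemLp (C'.indicator g) 2 := (memLp_indicator_iff_restrict hC'.measurableSet).2
    (hg C' hC' hC'U)
  have hlim := tendsto_eLpNorm_normed_convolution_sub hφ (by norm_num) (by norm_num) hg'
  have hlim_sq := ((ENNReal.continuous_pow 2).tendsto _).comp hlim
  simp only [Function.comp_def, eLpNorm_two_sq, zero_pow two_ne_zero] at hlim_sq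
  obtain ⟨δ, hδ, hsub⟩ := hC.exists_cthickening_subset_open isOpen_interior hCC'
  refine tendsto_of_tendsto_of_tendsto_of_le_of_le' tendsto_const_nhds hlim_sq
    (Eventually.of_forall fun _ => zero_le) ?_
  filter_upwards [hφ.eventually_lt_const hδ] with n hn
  refine le_trans (le_of_eq (setLIntegral_congr_fun hC.measurableSet fun z hz => ?_))
    (setLIntegral_le_lintegral C _)
  have hsupp : tsupport (fun t => (φ n).normed volume (z - t)) ⊆ C' := by
    refine (closure_minimal (fun t ht => ?_) Metric.isClosed_closedBall).trans
      ((Metric.closedBall_subset_cthickening hz δ).trans (hsub.trans interior_subset))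
    have hmem : z - t ∈ Function.support ((φ n).normed volume) := ht
    rw [(φ n).support_normed_eq, mem_ball_zero_iff] at hmem
    rw [Metric.mem_closedBall, dist_comm, dist_eq_norm]
    exact (hmem.trans hn).le
  simp only [hfg.fderiv_convolution_indicator hC'U hf (φ n).contDiff_normed
    (φ n).hasCompactSupport_normed hsupp, Pi.sub_apply,
    indicator_of_mem (interior_subset (hCC' hz))]

theorem tendsto_lintegral_sq_enorm_of_apply {α : Type*} [MeasurableSpace α] {μ : Measure α}
    {A : ℕ → α → ℂ →L[ℝ] ℂ} (hA : ∀ n, AEMeasurable (fun x => ‖A n x 1‖ₑ) μ)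
    (h1 : Tendsto (fun n => ∫⁻ x, ‖A n x 1‖ₑ ^ 2 ∂μ) atTop (𝓝 0))
    (hI : Tendsto (fun n => ∫⁻ x, ‖A n x I‖ₑ ^ 2 ∂μ) atTop (𝓝 0)) :
    Tendsto (fun n => ∫⁻ x, ‖A n x‖ₑ ^ 2 ∂μ) atTop (𝓝 0) := by
  have hsum := ENNReal.Tendsto.const_mul (a := 2) (h1.add hI) (Or.inr (by norm_num))
  rw [add_zero, mul_zero] at hsum
  refine tendsto_of_tendsto_of_tendsto_of_le_of_le tendsto_const_nhds hsum (fun _ => zero_le)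
    fun n => ?_
  calc ∫⁻ x, ‖A n x‖ₑ ^ 2 ∂μ
      ≤ ∫⁻ x, 2 * (‖A n x 1‖ₑ ^ 2 + ‖A n x I‖ₑ ^ 2) ∂μ := lintegral_mono fun x =>
        (pow_le_pow_left' (enorm_le_enorm_apply_one_add_enorm_apply_I _) 2).trans
          (ennreal_add_sq_le _ _)
    _ = 2 * (∫⁻ x, ‖A n x 1‖ₑ ^ 2 ∂μ + ∫⁻ x, ‖A n x I‖ₑ ^ 2 ∂μ) := by
        rw [lintegral_const_mul' _ _ (by norm_num), lintegral_add_left' ((hA n).pow_const 2)]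

theorem exists_bump_tendsto_rOut_zero (E : Type*) [NormedAddCommGroup E] :
    ∃ φ : ℕ → ContDiffBump (0 : E), Tendsto (fun n => (φ n).rOut) atTop (𝓝 0) :=
  ⟨fun n =>
    { rIn := 1 / ((n : ℝ) + 2)
      rOut := 1 / ((n : ℝ) + 1)
      rIn_pos := by positivity
      rIn_lt_rOut := by gcongr; norm_num },
    tendsto_one_div_add_atTop_nhds_zero_nat⟩

theorem exists_smooth_approx_of_isWeakDerivOn {U C : Set ℂ} (hU : IsOpen U) (hC : IsCompact C)
    (hCU : C ⊆ U) {f fx fy : ℂ → ℂ} (hf : ContinuousOn f U) (hfx : IsL2Loc U fx)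
    (hfy : IsL2Loc U fy) (wx : IsWeakDerivOn U f fx 1) (wy : IsWeakDerivOn U f fy I) :
    ∃ g : ℕ → ℂ → ℂ, (∀ n, ContDiff ℝ ∞ (g n)) ∧ TendstoUniformlyOn g f atTop C ∧
      Tendsto (fun n => ∫⁻ z in C, ‖fderiv ℝ (g n) z - clmOfPartials (fx z) (fy z)‖ₑ ^ 2)
        atTop (𝓝 0) := by
  obtain ⟨C', hC', hCC', hC'U⟩ := exists_compact_between hC hU hCU
  obtain ⟨φ, hφ⟩ := exists_bump_tendsto_rOut_zero ℂ
  have hfi : Integrable (C'.indicator f) :=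
    (integrable_indicator_iff hC'.measurableSet).2 ((hf.mono hC'U).integrableOn_compact hC')
  have hcont : ContinuousOn (C'.indicator f) (interior C') :=
    (hf.mono (interior_subset.trans hC'U)).congr fun x hx => indicator_of_mem (interior_subset hx) _
  have hsmooth (n : ℕ) :
      ContDiff ℝ ∞ ((φ n).normed volume ⋆[lsmul ℝ ℝ, volume] C'.indicator f) :=
    (φ n).hasCompactSupport_normed.contDiff_convolution_left _ (φ n).contDiff_normed
      hfi.locallyIntegrable
  refine ⟨_, hsmooth, ?_, tendsto_lintegral_sq_enorm_of_apply (fun n => ?_) ?_ ?_⟩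
  · exact (tendstoUniformlyOn_normed_convolution hφ hC isOpen_interior hCC'
      hfi.aestronglyMeasurable hcont).congr_right
        fun z hz => indicator_of_mem (interior_subset (hCC' hz)) _
  · have hfx' := (hfx C hC hCU).aestronglyMeasurable.aemeasurable
    have hder := measurable_fderiv_apply_const ℝ
      ((φ n).normed volume ⋆[lsmul ℝ ℝ, volume] C'.indicator f) 1
    simpa [clmOfPartials_apply] using (hder.aemeasurable.sub hfx').enorm
  · simpa [clmOfPartials_apply] using wx.tendsto_lintegral_fderiv_convolution hC hC' hCC' hC'U hφ
      hfi.locallyIntegrable hfx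
  · simpa [clmOfPartials_apply] using wy.tendsto_lintegral_fderiv_convolution hC hC' hCC' hC'U hφ
      hfi.locallyIntegrable hfy

/-- The open vertical strip `{a < re z < b}`. -/
def vertStrip (a b : ℝ) : Set ℂ := Complex.re ⁻¹' Ioo a b

theorem isOpen_vertStrip (a b : ℝ) : IsOpen (vertStrip a b) :=
  isOpen_Ioo.preimage Complex.continuous_re

theorem convex_vertStrip (a b : ℝ) : Convex ℝ (vertStrip a b) :=
  (convex_Ioo a b).linear_preimage Complex.reLm

theorem isPreconnected_vertStrip (a b : ℝ) : IsPreconnected (vertStrip a b) :=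
  (convex_vertStrip a b).isPreconnected

theorem vertStrip_nonempty {a b : ℝ} (h : a < b) : (vertStrip a b).Nonempty :=
  (nonempty_Ioo.2 h).preimage Complex.re_surjective

theorem add_int_mul_mem_vertStrip {a b : ℝ} {z : ℂ} (k : ℤ) :
    z + k * (2 * π * I) ∈ vertStrip a b ↔ z ∈ vertStrip a b := by
  simp [vertStrip]

theorem add_two_pi_I_mem_vertStrip {a b : ℝ} {z : ℂ} :
    z + 2 * π * I ∈ vertStrip a b ↔ z ∈ vertStrip a b := by
  simp [vertStrip]

theorem sub_mem_vertStrip {R : ℝ} {z : ℂ} : (R : ℂ) - z ∈ vertStrip 0 R ↔ z ∈ vertStrip 0 R := by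
  simp [vertStrip, and_comm]

theorem isOpen_roundAnnulus (r : ℝ) : IsOpen (roundAnnulus r) :=
  (isOpen_lt continuous_const continuous_norm).inter (isOpen_lt continuous_norm continuous_const)

theorem exp_mem_roundAnnulus {r : ℝ} (hr : 0 < r) {z : ℂ} :
    Complex.exp z ∈ roundAnnulus r ↔ z ∈ vertStrip 0 (Real.log r) := by
  simp [roundAnnulus, vertStrip, Complex.norm_exp, Real.lt_log_iff_exp_lt hr]

/-- On the set `S`, which is meant to be invariant under the translation by `2πi`, the map `F` lifts
through `exp` a map of degree `m`. -/
def HasDegreeOn (F : ℂ → ℂ) (m : ℤ) (S : Set ℂ) : Prop :=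
  ∀ z ∈ S, F (z + 2 * π * I) = F z + m * (2 * π * I)

namespace HasDegreeOn

variable {F : ℂ → ℂ} {m : ℤ} {a b : ℝ}

theorem map_add_int_mul (hF : HasDegreeOn F m (vertStrip a b)) (k : ℤ) {z : ℂ}
    (hz : z ∈ vertStrip a b) : F (z + k * (2 * π * I)) = F z + k * (m * (2 * π * I)) := by
  have hper : Function.Periodic ((vertStrip a b).indicator fun z => F z - m * z) (2 * π * I) := by
    intro z
    by_cases hz : z ∈ vertStrip a b
    · simp only [indicator_of_mem hz, indicator_of_mem (add_two_pi_I_mem_vertStrip.2 hz), hF z hz]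
      ring
    · simp only [indicator_of_notMem hz,
        indicator_of_notMem (mt add_two_pi_I_mem_vertStrip.1 hz)]
  have h := hper.int_mul k z
  rw [indicator_of_mem hz, indicator_of_mem ((add_int_mul_mem_vertStrip k).2 hz)] at h
  linear_combination h

theorem const_sub (hF : HasDegreeOn F m (vertStrip a b)) (c : ℂ) :
    HasDegreeOn (fun z => c - F z) (-m) (vertStrip a b) := fun z hz => by
  simp only [hF z hz, Int.cast_neg]
  ring

theorem comp_const_sub {R : ℝ} (hF : HasDegreeOn F m (vertStrip 0 R)) :
    HasDegreeOn (fun z => F (R - z)) (-m) (vertStrip 0 R) := fun z hz => by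
  have h := hF.map_add_int_mul (-1) (sub_mem_vertStrip.2 hz)
  simp only [Int.cast_neg, Int.cast_one] at h ⊢
  rw [show (R : ℂ) - (z + 2 * π * I) = R - z + -1 * (2 * π * I) by ring, h]
  ring

end HasDegreeOn

theorem exists_continuousOn_log_vertStrip {a b : ℝ} (hab : a < b) {f : ℂ → ℂ}
    (hf : ContinuousOn f (vertStrip a b)) (h0 : ∀ z ∈ vertStrip a b, f z ≠ 0) :
    ∃ F : ℂ → ℂ, ContinuousOn F (vertStrip a b) ∧
      ∀ z ∈ vertStrip a b, Complex.exp (F z) = f z := by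
  have hsc : IsSimplyConnected (vertStrip a b) := by
    have := (convex_vertStrip a b).contractibleSpace (vertStrip_nonempty hab)
    exact (inferInstance : SimplyConnectedSpace (vertStrip a b))
  exact Complex.exists_continuousOn_eqOn_exp_comp hsc (isOpen_vertStrip a b) hf
    (by rintro ⟨z, hz, h⟩; exact h0 z hz h)

theorem exists_int_eqOn_of_exp_eqOn {X : Type*} [TopologicalSpace X] {S : Set X}
    (hS : IsPreconnected S) {F₁ F₂ : X → ℂ} (h₁ : ContinuousOn F₁ S) (h₂ : ContinuousOn F₂ S)
    (h : ∀ x ∈ S, Complex.exp (F₁ x) = Complex.exp (F₂ x)) :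
    ∃ k : ℤ, ∀ x ∈ S, F₁ x = F₂ x + k * (2 * π * I) := by
  rcases S.eq_empty_or_nonempty with rfl | ⟨x₀, hx₀⟩
  · exact ⟨0, by simp⟩
  obtain ⟨k, hk⟩ := Complex.exp_eq_exp_iff_exists_int.1 (h x₀ hx₀)
  refine ⟨k, Complex.isCoveringMap_exp.eqOn_of_comp_eqOn hS h₁ (h₂.add continuousOn_const)
    (fun x hx => Subtype.ext ?_) hx₀ hk⟩
  simp only [Function.comp_apply, h x hx]
  exact (Complex.exp_periodic.int_mul k _).symm

theorem exists_strip_lift_of_mapsTo {r r' : ℝ} (hr : 1 < r) (hr' : 1 < r') {f : ℂ → ℂ}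
    (hf : ContinuousOn f (roundAnnulus r))
    (hmaps : MapsTo f (roundAnnulus r) (roundAnnulus r')) :
    ∃ (F : ℂ → ℂ) (m : ℤ), ContinuousOn F (vertStrip 0 (Real.log r)) ∧
      MapsTo F (vertStrip 0 (Real.log r)) (vertStrip 0 (Real.log r')) ∧
      (∀ z ∈ vertStrip 0 (Real.log r), Complex.exp (F z) = f (Complex.exp z)) ∧
      HasDegreeOn F m (vertStrip 0 (Real.log r)) := by
  have hexp := fun z => (exp_mem_roundAnnulus (zero_lt_one.trans hr) (z := z)).2
  obtain ⟨F, hF, hFe⟩ := exists_continuousOn_log_vertStrip (Real.log_pos hr)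
    (f := fun z => f (Complex.exp z)) (hf.comp Complex.continuous_exp.continuousOn hexp)
    fun z hz => norm_pos_iff.1 (zero_lt_one.trans (hmaps (hexp z hz)).1)
  obtain ⟨m, hm⟩ := exists_int_eqOn_of_exp_eqOn (isPreconnected_vertStrip 0 (Real.log r))
    (F₁ := fun z => F (z + 2 * π * I)) (F₂ := F)
    (hF.comp (by fun_prop) fun z hz => add_two_pi_I_mem_vertStrip.2 hz) hF
    (fun z hz => by rw [hFe z hz, hFe _ (add_two_pi_I_mem_vertStrip.2 hz), Complex.exp_periodic])
  refine ⟨F, m, hF, fun z hz => ?_, hFe, hm⟩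
  rw [← exp_mem_roundAnnulus (zero_lt_one.trans hr'), hFe z hz]
  exact hmaps (hexp z hz)

/-- `Φ` is a homeomorphism of the strip `{0 < re z < R}` onto the strip `{0 < re z < R'}` which
lifts, through `exp`, a homeomorphism of round annuli of degree `m`. -/
structure IsStripHomeo (R R' : ℝ) (Φ : OpenPartialHomeomorph ℂ ℂ) (m : ℤ) : Prop where
  source_eq : Φ.source = vertStrip 0 R
  target_eq : Φ.target = vertStrip 0 R'
  hasDegreeOn : HasDegreeOn Φ m (vertStrip 0 R)
  degree_eq : m = 1 ∨ m = -1

theorem degree_mul_degree_eq_one {R R' : ℝ} (hR : 0 < R) {F G : ℂ → ℂ} {m n : ℤ}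
    (hF : HasDegreeOn F m (vertStrip 0 R)) (hG : HasDegreeOn G n (vertStrip 0 R'))
    (hmaps : MapsTo F (vertStrip 0 R) (vertStrip 0 R'))
    (hGF : LeftInvOn G F (vertStrip 0 R)) : m * n = 1 := by
  obtain ⟨z, hz⟩ := vertStrip_nonempty hR
  have h := hGF (add_two_pi_I_mem_vertStrip.2 hz)
  rw [hF z hz, hG.map_add_int_mul m (hmaps hz), hGF hz, ← mul_assoc] at h
  have hmn := mul_right_cancel₀ Complex.two_pi_I_ne_zero
    ((add_left_cancel h).trans (one_mul _).symm)
  exact_mod_cast hmn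

theorem rightInvOn_of_leftInvOn_of_exp_eqOn {R R' : ℝ} {F G : ℂ → ℂ} {n : ℤ} (hn : n ≠ 0)
    (hF : ContinuousOn F (vertStrip 0 R)) (hG : ContinuousOn G (vertStrip 0 R'))
    (hGdeg : HasDegreeOn G n (vertStrip 0 R'))
    (hGmaps : MapsTo G (vertStrip 0 R') (vertStrip 0 R))
    (hGF : LeftInvOn G F (vertStrip 0 R))
    (hexp : ∀ w ∈ vertStrip 0 R', Complex.exp (F (G w)) = Complex.exp w) :
    LeftInvOn F G (vertStrip 0 R') := by
  obtain ⟨j, hj⟩ := exists_int_eqOn_of_exp_eqOn (isPreconnected_vertStrip 0 R')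
    (hF.comp hG hGmaps) continuousOn_id hexp
  intro w hw
  have hjw : F (G w) = w + j * (2 * π * I) := hj w hw
  have h := hGF (hGmaps hw)
  rw [hjw, hGdeg.map_add_int_mul j hw, add_eq_left] at h
  have hj0 : (j : ℂ) = 0 :=
    (mul_eq_zero.1 h).resolve_right
      (mul_ne_zero (Int.cast_ne_zero.2 hn) Complex.two_pi_I_ne_zero)
  rw [hjw, hj0, zero_mul, add_zero]

theorem exists_isStripHomeo_lift {r r' : ℝ} (hr : 1 < r) (hr' : 1 < r')
    (ψ : OpenPartialHomeomorph ℂ ℂ) (hs : ψ.source = roundAnnulus r)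
    (ht : ψ.target = roundAnnulus r') :
    ∃ (Φ : OpenPartialHomeomorph ℂ ℂ) (m : ℤ), IsStripHomeo (Real.log r) (Real.log r') Φ m ∧
      ∀ z ∈ vertStrip 0 (Real.log r), Complex.exp (Φ z) = ψ (Complex.exp z) := by
  obtain ⟨F, m, hF, hFmaps, hFexp, hFdeg⟩ := exists_strip_lift_of_mapsTo hr hr'
    (hs ▸ ψ.continuousOn) (hs ▸ ht ▸ ψ.mapsTo)
  obtain ⟨G₀, n, hG₀, hG₀maps, hG₀exp, hG₀deg⟩ := exists_strip_lift_of_mapsTo hr' hr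
    (ht ▸ ψ.continuousOn_symm) (hs ▸ ht ▸ ψ.mapsTo_symm)
  have hψ (z) (hz : z ∈ vertStrip 0 (Real.log r)) :
      ψ.symm (ψ (Complex.exp z)) = Complex.exp z :=
    ψ.left_inv (hs ▸ (exp_mem_roundAnnulus (zero_lt_one.trans hr)).2 hz)
  obtain ⟨k, hk⟩ := exists_int_eqOn_of_exp_eqOn (isPreconnected_vertStrip 0 (Real.log r))
    (hG₀.comp hF hFmaps) continuousOn_id fun z hz => by
      rw [Function.comp_apply, hG₀exp _ (hFmaps hz), hFexp z hz, hψ z hz, id]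
  set G : ℂ → ℂ := fun w => G₀ w - k * (2 * π * I) with hG
  have hGF : LeftInvOn G F (vertStrip 0 (Real.log r)) := fun z hz => by
    simpa [hG, sub_eq_iff_eq_add] using hk z hz
  have hGmaps : MapsTo G (vertStrip 0 (Real.log r')) (vertStrip 0 (Real.log r)) := fun w hw => by
    simpa [hG, sub_eq_add_neg] using (add_int_mul_mem_vertStrip (-k)).2 (hG₀maps hw)
  have hGcont : ContinuousOn G (vertStrip 0 (Real.log r')) := hG₀.sub continuousOn_const
  have hGdeg : HasDegreeOn G n (vertStrip 0 (Real.log r')) := fun w hw => by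
    simp only [hG, hG₀deg w hw]
    ring
  have hmn := degree_mul_degree_eq_one (Real.log_pos hr) hFdeg hGdeg hFmaps hGF
  have hFG := rightInvOn_of_leftInvOn_of_exp_eqOn (right_ne_zero_of_mul_eq_one hmn) hF hGcont hGdeg
    hGmaps hGF fun w hw => by
      rw [hFexp _ (hGmaps hw), hG, Complex.exp_periodic.sub_int_mul_eq, hG₀exp w hw,
        ψ.right_inv (ht ▸ (exp_mem_roundAnnulus (zero_lt_one.trans hr')).2 hw)]
  exact ⟨{
      toFun := F
      invFun := G
      source := vertStrip 0 (Real.log r)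
      target := vertStrip 0 (Real.log r')
      map_source' := hFmaps
      map_target' := hGmaps
      left_inv' := hGF
      right_inv' := hFG
      open_source := isOpen_vertStrip _ _
      open_target := isOpen_vertStrip _ _
      continuousOn_toFun := hF
      continuousOn_invFun := hGcont }, m,
    ⟨rfl, rfl, hFdeg, Int.eq_one_or_neg_one_of_mul_eq_one hmn⟩, hFexp⟩

namespace IsStripHomeo

variable {R R' : ℝ} {Φ : OpenPartialHomeomorph ℂ ℂ} {m : ℤ}

theorem mapsTo (h : IsStripHomeo R R' Φ m) : MapsTo Φ (vertStrip 0 R) (vertStrip 0 R') :=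
  h.source_eq ▸ h.target_eq ▸ Φ.mapsTo

theorem leftInvOn (h : IsStripHomeo R R' Φ m) : LeftInvOn Φ.symm Φ (vertStrip 0 R) :=
  h.source_eq ▸ Φ.leftInvOn

theorem rightInvOn (h : IsStripHomeo R R' Φ m) : RightInvOn Φ.symm Φ (vertStrip 0 R') :=
  h.target_eq ▸ Φ.rightInvOn

theorem continuousOn (h : IsStripHomeo R R' Φ m) : ContinuousOn Φ (vertStrip 0 R) :=
  h.source_eq ▸ Φ.continuousOn

theorem symm (h : IsStripHomeo R R' Φ m) : IsStripHomeo R' R Φ.symm m where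
  source_eq := h.target_eq
  target_eq := h.source_eq
  hasDegreeOn w hw := by
    have hz : Φ.symm w ∈ vertStrip 0 R := h.source_eq ▸ Φ.map_target (h.target_eq ▸ hw)
    have hm : (m : ℂ) * m = 1 := by rcases h.degree_eq with h | h <;> simp [h]
    have hΦ := h.hasDegreeOn.map_add_int_mul m hz
    rw [h.rightInvOn hw, ← mul_assoc (m : ℂ) (m : ℂ), hm, one_mul] at hΦ
    rw [← hΦ, h.leftInvOn ((add_int_mul_mem_vertStrip m).2 hz)]
  degree_eq := h.degree_eq

theorem const_sub (h : IsStripHomeo R R' Φ m) :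
    IsStripHomeo R R' (Φ.transHomeomorph (Homeomorph.subLeft (R' : ℂ))) (-m) where
  source_eq := h.source_eq
  target_eq := by
    ext w
    simp [h.target_eq, vertStrip, neg_add_eq_sub, and_comm]
  hasDegreeOn := h.hasDegreeOn.const_sub R'
  degree_eq := by rcases h.degree_eq with h | h <;> simp [h]

theorem comp_const_sub (h : IsStripHomeo R R' Φ m) :
    IsStripHomeo R R' ((Homeomorph.subLeft (R : ℂ)).transOpenPartialHomeomorph Φ) (-m) where
  source_eq := by
    ext w
    simp [h.source_eq, vertStrip, and_comm]
  target_eq := h.target_eq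
  hasDegreeOn := h.hasDegreeOn.comp_const_sub
  degree_eq := by rcases h.degree_eq with h | h <;> simp [h]

theorem exists_re_map_mem_Icc (h : IsStripHomeo R R' Φ m) {a b : ℝ} (ha : 0 < a) (hb : b < R) :
    ∃ α β : ℝ, 0 < α ∧ β < R' ∧ ∀ z : ℂ, z.re ∈ Icc a b → (Φ z).re ∈ Icc α β := by
  rcases lt_or_ge b a with hab | hab
  · exact ⟨1, R' - 1, one_pos, by linarith, fun z hz => by simp [Icc_eq_empty_of_lt hab] at hz⟩
  have hsub : Icc a b ×ℂ Icc 0 (2 * π) ⊆ vertStrip 0 R := fun z hz =>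
    ⟨ha.trans_le hz.1.1, hz.1.2.trans_lt hb⟩
  have hcpt : IsCompact (Icc a b ×ℂ Icc 0 (2 * π)) := isCompact_Icc.reProdIm isCompact_Icc
  have hcont : ContinuousOn (fun z => (Φ z).re) (Icc a b ×ℂ Icc 0 (2 * π)) :=
    Complex.continuous_re.comp_continuousOn (h.continuousOn.mono hsub)
  have hne : (Icc a b ×ℂ Icc 0 (2 * π)).Nonempty :=
    ⟨a, ⟨by simpa using hab, by simpa using Real.two_pi_pos.le⟩⟩
  obtain ⟨z₁, hz₁, hmin⟩ := hcpt.exists_isMinOn hne hcont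
  obtain ⟨z₂, hz₂, hmax⟩ := hcpt.exists_isMaxOn hne hcont
  refine ⟨_, _, (h.mapsTo (hsub hz₁)).1, (h.mapsTo (hsub hz₂)).2, fun z hz => ?_⟩
  obtain ⟨k, hk, -⟩ := existsUnique_add_zsmul_mem_Ico Real.two_pi_pos z.im 0
  have hmem : z + k * (2 * π * I) ∈ Icc a b ×ℂ Icc 0 (2 * π) :=
    ⟨by simpa using hz, by simpa using Ico_subset_Icc_self hk⟩
  have hΦ : (Φ (z + k * (2 * π * I))).re = (Φ z).re := by
    rw [h.hasDegreeOn.map_add_int_mul k ⟨ha.trans_le hz.1, hz.2.trans_lt hb⟩]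
    simp
  exact hΦ ▸ ⟨hmin hmem, hmax hmem⟩

end IsStripHomeo

theorem tendsto_nhdsGT_or_tendsto_nhdsLT {X ι : Type*} [TopologicalSpace X] {l : Filter X}
    {p : ι → Prop} {s : ι → Set X} (hl : l.HasBasis p s) (hs : ∀ i, p i → IsPreconnected (s i))
    {u : X → ℝ} {S : Set X} (hS : S ∈ l) (hu : ContinuousOn u S) {a b : ℝ} (hab : a < b)
    (hmaps : MapsTo u S (Ioo a b))
    (hesc : ∀ α β, a < α → β < b → ∀ᶠ x in l, u x ∉ Icc α β) :
    Tendsto u l (𝓝[>] a) ∨ Tendsto u l (𝓝[<] b) := by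
  obtain ⟨c, hac, hcb⟩ := exists_between hab
  obtain ⟨i, hi, hsub⟩ := hl.eventually_iff.1 (Filter.Eventually.and hS (hesc c c hac hcb))
  have hmem : s i ∈ l := hl.mem_of_mem hi
  have hside : (∀ x ∈ s i, u x < c) ∨ ∀ x ∈ s i, c < u x := by
    by_contra! ⟨⟨x, hx, hxc⟩, y, hy, hyc⟩
    obtain ⟨z, hz, hzc⟩ := (hs i hi).intermediate_value hy hx
      (hu.mono fun w hw => (hsub hw).1) ⟨hyc, hxc⟩
    exact (hsub hz).2 ⟨hzc.ge, hzc.le⟩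
  refine hside.imp (fun h => (nhdsGT_basis a).tendsto_right_iff.2 fun α hα => ?_)
    fun h => (nhdsLT_basis b).tendsto_right_iff.2 fun β hβ => ?_
  · filter_upwards [hmem, hesc α c hα hcb] with x hx hxα
    exact ⟨(hmaps (hsub hx).1).1, lt_of_not_ge fun hle => hxα ⟨hle, (h x hx).le⟩⟩
  · filter_upwards [hmem, hesc c β hac hβ] with x hx hxβ
    exact ⟨lt_of_not_ge fun hle => hxβ ⟨(h x hx).le, hle⟩, (hmaps (hsub hx).1).2⟩

/-- The neighbourhoods of the left end of a strip `{0 < re z < R}`. -/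
def leftEnd : Filter ℂ := comap Complex.re (𝓝[>] 0)

/-- The neighbourhoods of the right end of a strip `{0 < re z < R}`. -/
def rightEnd (R : ℝ) : Filter ℂ := comap Complex.re (𝓝[<] R)

theorem hasBasis_leftEnd : leftEnd.HasBasis (fun d : ℝ => 0 < d) (vertStrip 0) :=
  (nhdsGT_basis 0).comap _

theorem hasBasis_rightEnd (R : ℝ) : (rightEnd R).HasBasis (· < R) fun d => vertStrip d R :=
  (nhdsLT_basis R).comap _

instance : leftEnd.NeBot :=
  hasBasis_leftEnd.neBot_iff.2 fun hd => vertStrip_nonempty hd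

instance (R : ℝ) : (rightEnd R).NeBot :=
  (hasBasis_rightEnd R).neBot_iff.2 fun hd => vertStrip_nonempty hd

/-- `F` maps the left end of the strip `{0 < re z < R}` to the left end of `{0 < re z < R'}`, and
the right end to the right end. -/
structure PreservesEnds (R R' : ℝ) (F : ℂ → ℂ) : Prop where
  left : Tendsto F leftEnd leftEnd
  right : Tendsto F (rightEnd R) (rightEnd R')

theorem tendsto_const_sub_leftEnd (R : ℝ) : Tendsto (fun z => (R : ℂ) - z) leftEnd (rightEnd R) :=
  (hasBasis_leftEnd.tendsto_iff (hasBasis_rightEnd R)).2 fun d hd =>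
    ⟨R - d, sub_pos.2 hd, fun z hz => by
      simpa [vertStrip, and_comm, lt_sub_comm] using hz⟩

theorem tendsto_const_sub_rightEnd (R : ℝ) :
    Tendsto (fun z => (R : ℂ) - z) (rightEnd R) leftEnd :=
  ((hasBasis_rightEnd R).tendsto_iff hasBasis_leftEnd).2 fun d hd =>
    ⟨R - d, sub_lt_self R hd, fun z hz => by
      simpa [vertStrip, and_comm, sub_lt_comm] using hz⟩

theorem PreservesEnds.const_sub_comp_const_sub {R R' : ℝ} {F : ℂ → ℂ} (h : PreservesEnds R R' F) :
    PreservesEnds R R' fun z => R' - F (R - z) :=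
  ⟨(tendsto_const_sub_rightEnd R').comp (h.right.comp (tendsto_const_sub_leftEnd R)),
    (tendsto_const_sub_leftEnd R').comp (h.left.comp (tendsto_const_sub_rightEnd R))⟩

theorem not_leftEnd_le_rightEnd {R : ℝ} (hR : 0 < R) : ¬leftEnd ≤ rightEnd R := fun h =>
  have hre : Tendsto Complex.re leftEnd (𝓝[>] 0) := tendsto_comap
  hre.not_tendsto ((disjoint_nhds_nhds.2 hR.ne).mono nhdsWithin_le_nhds nhdsWithin_le_nhds)
    (tendsto_comap.mono_left h)

theorem not_rightEnd_le_leftEnd {R : ℝ} (hR : 0 < R) : ¬rightEnd R ≤ leftEnd := fun h =>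
  have hre : Tendsto Complex.re (rightEnd R) (𝓝[<] R) := tendsto_comap
  hre.not_tendsto ((disjoint_nhds_nhds.2 hR.ne').mono nhdsWithin_le_nhds nhdsWithin_le_nhds)
    (tendsto_comap.mono_left h)

namespace IsStripHomeo

variable {R R' : ℝ} {Φ : OpenPartialHomeomorph ℂ ℂ} {m : ℤ}

theorem eventually_re_map_notMem_Icc (h : IsStripHomeo R R' Φ m) {l : Filter ℂ}
    (hl : ∀ a b, 0 < a → b < R → ∀ᶠ z in l, z ∈ vertStrip 0 R ∧ z.re ∉ Icc a b) {α β : ℝ}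
    (hα : 0 < α) (hβ : β < R') : ∀ᶠ z in l, (Φ z).re ∉ Icc α β := by
  obtain ⟨a, b, ha, hb, hab⟩ := h.symm.exists_re_map_mem_Icc hα hβ
  filter_upwards [hl a b ha hb] with z ⟨hz, hnot⟩ hmem
  exact hnot (by simpa only [h.leftInvOn hz] using hab _ hmem)

theorem tendsto_leftEnd (h : IsStripHomeo R R' Φ m) (hR : 0 < R) (hR' : 0 < R') :
    Tendsto Φ leftEnd leftEnd ∨ Tendsto Φ leftEnd (rightEnd R') := by
  simp only [leftEnd, rightEnd, tendsto_comap_iff (g := Complex.re)]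
  refine tendsto_nhdsGT_or_tendsto_nhdsLT hasBasis_leftEnd
    (fun _ _ => isPreconnected_vertStrip _ _) (hasBasis_leftEnd.mem_of_mem hR)
    (Complex.continuous_re.comp_continuousOn h.continuousOn) hR' h.mapsTo
    fun α β hα hβ => h.eventually_re_map_notMem_Icc (fun a b ha _ => ?_) hα hβ
  filter_upwards [hasBasis_leftEnd.mem_of_mem hR, hasBasis_leftEnd.mem_of_mem ha] with z hz hza
  exact ⟨hz, fun hmem => hmem.1.not_gt hza.2⟩

theorem tendsto_rightEnd (h : IsStripHomeo R R' Φ m) (hR : 0 < R) (hR' : 0 < R') :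
    Tendsto Φ (rightEnd R) leftEnd ∨ Tendsto Φ (rightEnd R) (rightEnd R') := by
  simp only [leftEnd, rightEnd, tendsto_comap_iff (g := Complex.re)]
  refine tendsto_nhdsGT_or_tendsto_nhdsLT (hasBasis_rightEnd R)
    (fun _ _ => isPreconnected_vertStrip _ _) ((hasBasis_rightEnd R).mem_of_mem hR)
    (Complex.continuous_re.comp_continuousOn h.continuousOn) hR' h.mapsTo
    fun α β hα hβ => h.eventually_re_map_notMem_Icc (fun a b _ hb => ?_) hα hβ
  filter_upwards [(hasBasis_rightEnd R).mem_of_mem hR, (hasBasis_rightEnd R).mem_of_mem hb]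
    with z hz hzb
  exact ⟨hz, fun hmem => hmem.2.not_gt hzb.1⟩

theorem le_of_tendsto_of_tendsto_symm (h : IsStripHomeo R R' Φ m) {l₁ l₂ l₃ : Filter ℂ}
    (hl : vertStrip 0 R' ∈ l₁) (hsymm : Tendsto Φ.symm l₁ l₂) (hΦ : Tendsto Φ l₂ l₃) : l₁ ≤ l₃ :=
  tendsto_id'.1 <| (hΦ.comp hsymm).congr' <| by
    filter_upwards [hl] with w hw using h.rightInvOn hw

theorem preservesEnds_symm (h : IsStripHomeo R R' Φ m) (hR : 0 < R) (hR' : 0 < R')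
    (hΦ : PreservesEnds R R' Φ) : PreservesEnds R' R Φ.symm where
  left := (h.symm.tendsto_leftEnd hR' hR).resolve_right fun hbad =>
    not_leftEnd_le_rightEnd hR' <|
      h.le_of_tendsto_of_tendsto_symm (hasBasis_leftEnd.mem_of_mem hR') hbad hΦ.right
  right := (h.symm.tendsto_rightEnd hR' hR).resolve_left fun hbad =>
    not_rightEnd_le_leftEnd hR' <|
      h.le_of_tendsto_of_tendsto_symm ((hasBasis_rightEnd R').mem_of_mem hR') hbad hΦ.left

theorem preservesEnds_or (h : IsStripHomeo R R' Φ m) (hR : 0 < R) (hR' : 0 < R') :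
    PreservesEnds R R' Φ ∨ PreservesEnds R R' fun z => R' - Φ z := by
  have hSl := hasBasis_leftEnd.mem_of_mem hR'
  have hSr := (hasBasis_rightEnd R').mem_of_mem hR'
  rcases h.tendsto_leftEnd hR hR' with hl | hl <;> rcases h.tendsto_rightEnd hR hR' with hr | hr
  · have hle : rightEnd R' ≤ leftEnd := (h.symm.tendsto_rightEnd hR' hR).elim
      (h.le_of_tendsto_of_tendsto_symm hSr · hl) (h.le_of_tendsto_of_tendsto_symm hSr · hr)
    exact (not_rightEnd_le_leftEnd hR' hle).elim
  · exact .inl ⟨hl, hr⟩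
  · exact .inr ⟨(tendsto_const_sub_rightEnd R').comp hl, (tendsto_const_sub_leftEnd R').comp hr⟩
  · have hle : leftEnd ≤ rightEnd R' := (h.symm.tendsto_leftEnd hR' hR).elim
      (h.le_of_tendsto_of_tendsto_symm hSl · hl) (h.le_of_tendsto_of_tendsto_symm hSl · hr)
    exact (not_leftEnd_le_rightEnd hR' hle).elim

end IsStripHomeo

theorem det_eq_re_mul_im_sub (L : ℂ →L[ℝ] ℂ) :
    L.det = (L 1).re * (L I).im - (L I).re * (L 1).im := by
  rw [ContinuousLinearMap.det, ← LinearMap.det_toMatrix Complex.basisOneI, Matrix.det_fin_two]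
  simp [LinearMap.toMatrix_apply]

theorem det_smul_comp_mul (c d : ℂ) (L : ℂ →L[ℝ] ℂ) :
    (c • (L ∘L ContinuousLinearMap.mul ℝ ℂ d)).det =
      Complex.normSq c * Complex.normSq d * L.det := by
  have hL (v : ℂ) : L v = v.re * L 1 + v.im * L I := by
    rw [← clmOfPartials_apply, clmOfPartials_apply_one_I]
  simp only [det_eq_re_mul_im_sub, Complex.normSq_apply, smul_apply,
    ContinuousLinearMap.comp_apply, ContinuousLinearMap.mul_apply', smul_eq_mul, hL (d * 1),
    hL (d * I)]
  simp only [Complex.mul_re, Complex.mul_im, Complex.add_re, Complex.add_im, Complex.ofReal_re,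
    Complex.ofReal_im, Complex.I_re, Complex.I_im, Complex.one_re, Complex.one_im]
  ring

theorem norm_smul_comp_mul_le (c d : ℂ) (L : ℂ →L[ℝ] ℂ) :
    ‖c • (L ∘L ContinuousLinearMap.mul ℝ ℂ d)‖ ≤ ‖c‖ * ‖L‖ * ‖d‖ := by
  rw [norm_smul, mul_assoc]
  gcongr
  simpa only [ContinuousLinearMap.opNorm_mul_apply] using
    L.opNorm_comp_le (ContinuousLinearMap.mul ℝ ℂ d)

theorem norm_sq_le_mul_det_smul_comp_mul {K : ℝ} {L : ℂ →L[ℝ] ℂ} (hL : ‖L‖ ^ 2 ≤ K * L.det)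
    (c d : ℂ) : ‖c • (L ∘L ContinuousLinearMap.mul ℝ ℂ d)‖ ^ 2 ≤
      K * (c • (L ∘L ContinuousLinearMap.mul ℝ ℂ d)).det := by
  calc ‖c • (L ∘L ContinuousLinearMap.mul ℝ ℂ d)‖ ^ 2
      ≤ (‖c‖ * ‖L‖ * ‖d‖) ^ 2 := by gcongr; exact norm_smul_comp_mul_le c d L
    _ = Complex.normSq c * Complex.normSq d * ‖L‖ ^ 2 := by
        rw [Complex.normSq_eq_norm_sq, Complex.normSq_eq_norm_sq]; ring
    _ ≤ Complex.normSq c * Complex.normSq d * (K * L.det) :=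
        mul_le_mul_of_nonneg_left hL
          (mul_nonneg (Complex.normSq_nonneg _) (Complex.normSq_nonneg _))
    _ = K * (c • (L ∘L ContinuousLinearMap.mul ℝ ℂ d)).det := by
        rw [det_smul_comp_mul]; ring

theorem norm_clmOfPartials_le (p q : ℂ) :
    ‖clmOfPartials p q‖ ≤ ‖(p - I * q) / 2‖ + ‖(p + I * q) / 2‖ := by
  refine ContinuousLinearMap.opNorm_le_bound _ (by positivity) fun v => ?_
  have hv : clmOfPartials p q v = (p - I * q) / 2 * v + (p + I * q) / 2 * conj v := by
    conv_rhs => rw [← Complex.re_add_im v]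
    rw [clmOfPartials_apply, map_add, map_mul, Complex.conj_ofReal, Complex.conj_ofReal,
      Complex.conj_I]
    linear_combination ((v.im : ℂ) * q) * Complex.I_mul_I
  rw [hv, add_mul]
  refine (norm_add_le _ _).trans_eq ?_
  rw [norm_mul, norm_mul, Complex.norm_conj]

theorem det_clmOfPartials (p q : ℂ) :
    (clmOfPartials p q).det = ‖(p - I * q) / 2‖ ^ 2 - ‖(p + I * q) / 2‖ ^ 2 := by
  rw [det_eq_re_mul_im_sub, ← Complex.normSq_eq_norm_sq, ← Complex.normSq_eq_norm_sq, map_div₀,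
    map_div₀, Complex.normSq_ofNat]
  simp only [clmOfPartials_apply, Complex.one_re, Complex.one_im, Complex.ofReal_zero,
    Complex.ofReal_one, zero_add, add_zero, Complex.normSq_apply, Complex.sub_re,
    Complex.sub_im, Complex.add_re, Complex.add_im, Complex.mul_re, Complex.mul_im, Complex.I_re,
    Complex.I_im, zero_mul, one_mul]
  ring

theorem norm_sq_clmOfPartials_le_of_beltrami {K : ℝ} (hK : 1 ≤ K) {p q : ℂ}
    (h : ‖(p + I * q) / 2‖ ≤ (K - 1) / (K + 1) * ‖(p - I * q) / 2‖) :
    ‖clmOfPartials p q‖ ^ 2 ≤ K * (clmOfPartials p q).det := by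
  have hKpos : 0 < K + 1 := by linarith
  rw [div_mul_eq_mul_div, le_div_iff₀ hKpos] at h
  rw [det_clmOfPartials]
  set A := ‖(p - I * q) / 2‖
  set B := ‖(p + I * q) / 2‖
  calc ‖clmOfPartials p q‖ ^ 2 ≤ (A + B) * (A + B) := by
        rw [← sq]; gcongr; exact norm_clmOfPartials_le p q
    _ ≤ (A + B) * (K * (A - B)) :=
        mul_le_mul_of_nonneg_left (by linarith) (add_nonneg (norm_nonneg _) (norm_nonneg _))
    _ = K * (A ^ 2 - B ^ 2) := by ring

/-- One period `{a < re z < b, c < im z < c + 2π}` of the strip `{a < re z < b}`. -/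
def periodRect (a b c : ℝ) : Set ℂ := Ioo a b ×ℂ Ioo c (c + 2 * π)

theorem isOpen_periodRect (a b c : ℝ) : IsOpen (periodRect a b c) :=
  isOpen_Ioo.reProdIm isOpen_Ioo

theorem periodRect_subset_vertStrip (a b c : ℝ) : periodRect a b c ⊆ vertStrip a b :=
  fun _ hz => hz.1

theorem vertStrip_subset_iUnion_periodRect (a b : ℝ) :
    vertStrip a b ⊆ ⋃ q : ℚ, periodRect a b q := by
  intro z hz
  obtain ⟨q, hq, hqz⟩ := exists_rat_btwn (sub_lt_self z.im Real.two_pi_pos)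
  exact mem_iUnion.2 ⟨q, hz, hqz, sub_lt_iff_lt_add.1 hq⟩

theorem injOn_exp_periodRect (a b c : ℝ) : InjOn Complex.exp (periodRect a b c) := by
  intro z hz w hw h
  obtain ⟨n, hn⟩ := Complex.exp_eq_exp_iff_exists_int.1 h
  have him : z.im - w.im = n * (2 * π) := by simp [hn]
  have hlt : |(n : ℝ)| * (2 * π) < 1 * (2 * π) := by
    rw [← abs_of_pos Real.two_pi_pos, ← abs_mul, ← him, abs_of_pos Real.two_pi_pos, abs_sub_lt_iff]
    constructor <;> linarith [hz.2.1, hz.2.2, hw.2.1, hw.2.2]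
  have hn0 : n = 0 := Int.abs_lt_one_iff.1 (by
    exact_mod_cast lt_of_mul_lt_mul_right hlt Real.two_pi_pos.le)
  simpa [hn0] using hn

theorem hasFDerivAt_exp_mul (z : ℂ) :
    HasFDerivAt Complex.exp (ContinuousLinearMap.mul ℝ ℂ (Complex.exp z)) z := by
  refine ((Complex.hasDerivAt_exp z).hasFDerivAt.restrictScalars ℝ).congr_fderiv ?_
  ext v
  simp [mul_comm]

theorem lintegral_comp_exp_le {a b : ℝ} (ha : 0 ≤ a) (c : ℝ) {C : Set ℂ}
    (hC : MapsTo Complex.exp (vertStrip a b) C) (k : ℂ → ℝ≥0∞) :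
    ∫⁻ z in periodRect a b c, k (Complex.exp z) ≤ ∫⁻ w in C, k w := by
  have hQ := (isOpen_periodRect a b c).measurableSet
  have hdet : ∀ z ∈ periodRect a b c,
      1 ≤ ENNReal.ofReal |(ContinuousLinearMap.mul ℝ ℂ (Complex.exp z)).det| := by
    intro z hz
    have h := det_smul_comp_mul 1 (Complex.exp z) (.id ℝ ℂ)
    rw [one_smul, ContinuousLinearMap.id_comp, det_eq_re_mul_im_sub (.id ℝ ℂ)] at h
    rw [h, ENNReal.one_le_ofReal]
    simpa [Complex.normSq_eq_norm_sq, Complex.norm_exp] using ha.trans hz.1.1.le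
  calc ∫⁻ z in periodRect a b c, k (Complex.exp z)
      ≤ ∫⁻ z in periodRect a b c,
          ENNReal.ofReal |(ContinuousLinearMap.mul ℝ ℂ (Complex.exp z)).det| * k (Complex.exp z) :=
        setLIntegral_mono' hQ fun z hz => le_mul_of_one_le_left' (hdet z hz)
    _ = ∫⁻ w in Complex.exp '' periodRect a b c, k w :=
        (lintegral_image_eq_lintegral_abs_det_fderiv_mul volume hQ
          (fun z _ => (hasFDerivAt_exp_mul z).hasFDerivWithinAt)
          (injOn_exp_periodRect a b c) k).symm
    _ ≤ ∫⁻ w in C, k w :=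
        lintegral_mono_set (hC.mono_left (periodRect_subset_vertStrip a b c)).image_subset

theorem quasiMeasurePreserving_exp {R : ℝ} {C : Set ℂ} (hC : MapsTo Complex.exp (vertStrip 0 R) C) :
    Measure.QuasiMeasurePreserving Complex.exp (volume.restrict (vertStrip 0 R))
      (volume.restrict C) := by
  refine ⟨Complex.measurable_exp, .mk fun T hT hT0 => ?_⟩
  rw [Measure.map_apply Complex.measurable_exp hT, measure_eq_zero_iff_ae_notMem]
  refine ae_restrict_of_ae_restrict_of_subset (vertStrip_subset_iUnion_periodRect 0 R) ?_
  refine (ae_restrict_iUnion_iff _ _).2 fun q => ?_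
  have hzero := lintegral_comp_exp_le le_rfl q hC (T.indicator 1)
  rw [lintegral_indicator_one hT, hT0, nonpos_iff_eq_zero,
    lintegral_eq_zero_iff (f := fun z => T.indicator 1 (Complex.exp z))
    ((measurable_one.indicator hT).comp Complex.measurable_exp)] at hzero
  filter_upwards [hzero] with z hz hzT
  simp [mem_preimage.1 hzT] at hz

/-- The derivative of a branch of `log (ψ (exp z))` when `D` is the derivative of `ψ`. -/
noncomputable def logDerivExp (ψ : ℂ → ℂ) (D : ℂ → ℂ →L[ℝ] ℂ) (z : ℂ) : ℂ →L[ℝ] ℂ :=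
  (ψ (Complex.exp z))⁻¹ • (D (Complex.exp z) ∘L ContinuousLinearMap.mul ℝ ℂ (Complex.exp z))

theorem contDiffOn_of_exp_eq {S : Set ℂ} (hS : IsOpen S) {f h : ℂ → ℂ} (hf : ContinuousOn f S)
    (hh : ContDiffOn ℝ ∞ h S) (he : ∀ z ∈ S, Complex.exp (f z) = h z) : ContDiffOn ℝ ∞ f S := by
  intro z₀ hz₀
  have hfc : ContinuousAt f z₀ := hf.continuousAt (hS.mem_nhds hz₀)
  have him : ∀ᶠ z in 𝓝 z₀, |(f z - f z₀).im| < π := by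
    have hcont : ContinuousAt (fun z => |(f z - f z₀).im|) z₀ := by fun_prop
    exact hcont.eventually_lt_const (by simp [Real.pi_pos])
  have hloc : ∀ᶠ z in 𝓝 z₀, f z = f z₀ + Complex.log (h z / h z₀) := by
    filter_upwards [him, hS.mem_nhds hz₀] with z hz hzS
    rw [← he z hzS, ← he z₀ hz₀, ← Complex.exp_sub,
      Complex.log_exp (abs_lt.1 hz).1 (abs_lt.1 hz).2.le, add_sub_cancel]
  have h0 : h z₀ ≠ 0 := he z₀ hz₀ ▸ Complex.exp_ne_zero _
  have hlog : ContDiffAt ℝ ∞ Complex.log (h z₀ / h z₀) :=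
    (Complex.contDiffAt_log
      (by rw [div_self h0]; exact Complex.one_mem_slitPlane)).restrict_scalars ℝ
  have hh₀ := (hh.contDiffAt (hS.mem_nhds hz₀)).div_const (h z₀)
  refine (ContDiffAt.congr_of_eventuallyEq ?_ hloc).contDiffWithinAt
  refine contDiffAt_const.add ?_
  exact hlog.comp z₀ hh₀

theorem fderiv_eq_logDerivExp {f g : ℂ → ℂ} {z : ℂ} (hf : DifferentiableAt ℝ f z)
    (hg : DifferentiableAt ℝ g (Complex.exp z))
    (he : ∀ᶠ w in 𝓝 z, Complex.exp (f w) = g (Complex.exp w)) :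
    fderiv ℝ f z = logDerivExp g (fderiv ℝ g) z := by
  have hleft := (hasFDerivAt_exp_mul (f z)).comp z hf.hasFDerivAt
  have hright := hg.hasFDerivAt.comp z (hasFDerivAt_exp_mul z)
  have heq := hleft.unique (hright.congr_of_eventuallyEq he)
  have hne : g (Complex.exp z) ≠ 0 := he.self_of_nhds ▸ Complex.exp_ne_zero _
  rw [logDerivExp, ← heq, he.self_of_nhds]
  ext v
  simp [hne]

theorem enorm_logDerivExp_sub_sq_le {ψ g : ℂ → ℂ} {D E : ℂ → ℂ →L[ℝ] ℂ} {z : ℂ} {M : ℝ≥0∞}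
    (hM : ‖Complex.exp z‖ₑ ≤ M) (hψ : 1 ≤ ‖ψ (Complex.exp z)‖)
    (hg : 1 / 2 ≤ ‖g (Complex.exp z)‖) :
    ‖logDerivExp g E z - logDerivExp ψ D z‖ₑ ^ 2 ≤
      8 * M ^ 2 * (‖E (Complex.exp z) - D (Complex.exp z)‖ₑ ^ 2 +
        ‖g (Complex.exp z) - ψ (Complex.exp z)‖ₑ ^ 2 * ‖D (Complex.exp z)‖ₑ ^ 2) := by
  unfold logDerivExp
  set w := Complex.exp z
  have hψ0 : ψ w ≠ 0 := norm_pos_iff.1 (by linarith)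
  have hg0 : g w ≠ 0 := norm_pos_iff.1 (by linarith)
  have hinvψ : ‖(ψ w)⁻¹‖ ≤ 1 := by rw [norm_inv]; exact inv_le_one_of_one_le₀ hψ
  have hinvg : ‖(g w)⁻¹‖ ≤ 2 := by
    rw [norm_inv, inv_le_comm₀ (by linarith) two_pos]; linarith
  have hid : (g w)⁻¹ • (E w ∘L ContinuousLinearMap.mul ℝ ℂ w) -
      (ψ w)⁻¹ • (D w ∘L ContinuousLinearMap.mul ℝ ℂ w) =
      (g w)⁻¹ • ((E w - D w - ((ψ w)⁻¹ * (g w - ψ w)) • D w) ∘L ContinuousLinearMap.mul ℝ ℂ w) := by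
    ext v
    simp only [sub_apply, smul_apply, ContinuousLinearMap.comp_apply,
      ContinuousLinearMap.mul_apply', smul_eq_mul, ContinuousLinearMap.sub_comp,
      ContinuousLinearMap.smul_comp]
    field_simp
    ring
  have hnorm : ‖E w - D w - ((ψ w)⁻¹ * (g w - ψ w)) • D w‖ ≤
      ‖E w - D w‖ + ‖g w - ψ w‖ * ‖D w‖ := by
    refine (norm_sub_le _ _).trans ?_
    rw [norm_smul, norm_mul]
    gcongr
    exact mul_le_of_le_one_left (norm_nonneg _) hinvψ
  have hreal : ‖(g w)⁻¹ • (E w ∘L ContinuousLinearMap.mul ℝ ℂ w) -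
      (ψ w)⁻¹ • (D w ∘L ContinuousLinearMap.mul ℝ ℂ w)‖ ≤
      2 * (‖E w - D w‖ + ‖g w - ψ w‖ * ‖D w‖) * ‖w‖ := by
    rw [hid]
    refine (norm_smul_comp_mul_le _ _ _).trans ?_
    gcongr
  have hbound : ‖(g w)⁻¹ • (E w ∘L ContinuousLinearMap.mul ℝ ℂ w) -
      (ψ w)⁻¹ • (D w ∘L ContinuousLinearMap.mul ℝ ℂ w)‖ₑ ≤
      2 * (‖E w - D w‖ₑ + ‖g w - ψ w‖ₑ * ‖D w‖ₑ) * ‖w‖ₑ := by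
    simp only [enorm_eq_nnnorm]
    exact_mod_cast hreal
  calc _ ≤ (2 * (‖E w - D w‖ₑ + ‖g w - ψ w‖ₑ * ‖D w‖ₑ) * M) ^ 2 :=
        pow_le_pow_left' (hbound.trans (mul_le_mul_right hM _)) 2
    _ = 4 * M ^ 2 * (‖E w - D w‖ₑ + ‖g w - ψ w‖ₑ * ‖D w‖ₑ) ^ 2 := by ring
    _ ≤ 4 * M ^ 2 * (2 * (‖E w - D w‖ₑ ^ 2 + (‖g w - ψ w‖ₑ * ‖D w‖ₑ) ^ 2)) := by
        gcongr; exact ennreal_add_sq_le _ _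
    _ = _ := by ring

theorem exists_lift_of_norm_sub_lt {S : Set ℂ} (hS : IsOpen S) {F ψ g : ℂ → ℂ} {m : ℤ}
    (hF : ContinuousOn F S) (hFe : ∀ z ∈ S, Complex.exp (F z) = ψ (Complex.exp z))
    (hdeg : HasDegreeOn F m S) (hg : ContDiff ℝ ∞ g) (hψ : ∀ z ∈ S, 1 ≤ ‖ψ (Complex.exp z)‖)
    (hclose : ∀ z ∈ S, ‖g (Complex.exp z) - ψ (Complex.exp z)‖ < 1 / 2) :
    ∃ f : ℂ → ℂ, ContDiffOn ℝ ∞ f S ∧ HasDegreeOn f m S ∧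
      (∀ z ∈ S, Complex.exp (f z) = g (Complex.exp z)) ∧
      ∀ z ∈ S, ‖f z - F z‖ ≤ 3 / 2 * ‖g (Complex.exp z) - ψ (Complex.exp z)‖ := by
  set q : ℂ → ℂ := fun z => g (Complex.exp z) / ψ (Complex.exp z) with hq
  have hψ0 : ∀ z ∈ S, ψ (Complex.exp z) ≠ 0 := fun z hz => hFe z hz ▸ Complex.exp_ne_zero _
  have hq1 : ∀ z ∈ S, ‖q z - 1‖ ≤ ‖g (Complex.exp z) - ψ (Complex.exp z)‖ := fun z hz => by
    rw [hq, div_sub_one (hψ0 z hz), norm_div]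
    exact div_le_self (norm_nonneg _) (hψ z hz)
  have hslit : ∀ z ∈ S, q z ∈ Complex.slitPlane := fun z hz => by
    simpa using Complex.mem_slitPlane_of_norm_lt_one
      (((hq1 z hz).trans_lt (hclose z hz)).trans one_half_lt_one)
  have hgexp : ContDiff ℝ ∞ fun z => g (Complex.exp z) := hg.comp Complex.contDiff_exp
  have hqc : ContinuousOn q S :=
    hgexp.continuous.continuousOn.div
      ((Complex.continuous_exp.comp_continuousOn hF).congr fun z hz => (hFe z hz).symm) hψ0
  have hexp : ∀ z ∈ S, Complex.exp (F z + Complex.log (q z)) = g (Complex.exp z) := fun z hz => by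
    rw [Complex.exp_add, hFe z hz, Complex.exp_log (Complex.slitPlane_ne_zero (hslit z hz)),
      mul_div_cancel₀ _ (hψ0 z hz)]
  refine ⟨fun z => F z + Complex.log (q z), ?_, fun z hz => ?_, hexp, fun z hz => ?_⟩
  · exact contDiffOn_of_exp_eq hS (hF.add (hqc.clog hslit)) hgexp.contDiffOn hexp
  · simp only [hq, hdeg z hz, Complex.exp_periodic z]
    ring
  · have hlog := Complex.norm_log_one_add_half_le_self ((hq1 z hz).trans (hclose z hz).le)
    rw [add_sub_cancel] at hlog
    rw [add_sub_cancel_left]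
    exact hlog.trans (mul_le_mul_of_nonneg_left (hq1 z hz) (by norm_num))

/-- `F` is continuous on the strip `{0 < re z < R}`, of degree `m`, with weak derivative `D`
locally in `L²`. The derivative is encoded by approximation: on each smaller strip `F` is a uniform
limit of smooth maps of the same degree whose derivatives converge to `D` in `L²` of a period. -/
def IsStripSobolev (R : ℝ) (F : ℂ → ℂ) (D : ℂ → ℂ →L[ℝ] ℂ) (m : ℤ) : Prop :=
  ∀ a b : ℝ, 0 < a → b < R → ∃ f : ℕ → ℂ → ℂ,
    (∀ n, ContDiffOn ℝ ∞ (f n) (vertStrip a b)) ∧ (∀ n, HasDegreeOn (f n) m (vertStrip a b)) ∧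
    TendstoUniformlyOn f F atTop (vertStrip a b) ∧
    ∀ c, Tendsto (fun n => ∫⁻ z in periodRect a b c, ‖fderiv ℝ (f n) z - D z‖ₑ ^ 2) atTop (𝓝 0)

theorem tendsto_setLIntegral_enorm_sub_pow_mul {α E : Type*} [MeasurableSpace α]
    [NormedAddCommGroup E] {μ : Measure α} {C : Set α} (hC : MeasurableSet C) {g : ℕ → α → E}
    {ψ : α → E} (hg : TendstoUniformlyOn g ψ atTop C) {p : ℕ} (hp : p ≠ 0) {h : α → ℝ≥0∞}
    (hh : ∫⁻ x in C, h x ∂μ ≠ ⊤) :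
    Tendsto (fun n => ∫⁻ x in C, ‖g n x - ψ x‖ₑ ^ p * h x ∂μ) atTop (𝓝 0) := by
  have hlim : Tendsto (fun δ : ℝ≥0∞ => δ ^ p * ∫⁻ x in C, h x ∂μ) (𝓝 0) (𝓝 0) := by
    simpa [hp] using ENNReal.Tendsto.mul_const ((ENNReal.continuous_pow p).tendsto 0) (Or.inr hh)
  refine ENNReal.tendsto_nhds_zero.2 fun ε hε => ?_
  obtain ⟨δ, ⟨hδ, hδtop⟩, hδ0⟩ := ((((ENNReal.tendsto_nhds_zero.1 hlim ε hε).and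
    (gt_mem_nhds ENNReal.zero_lt_top)).filter_mono nhdsWithin_le_nhds).and
      self_mem_nhdsWithin).exists (f := 𝓝[>] (0 : ℝ≥0∞))
  filter_upwards [EMetric.tendstoUniformlyOn_iff.1 hg δ hδ0] with n hn
  calc ∫⁻ x in C, ‖g n x - ψ x‖ₑ ^ p * h x ∂μ ≤ ∫⁻ x in C, δ ^ p * h x ∂μ :=
        setLIntegral_mono' hC fun x hx => by
          gcongr
          rw [← edist_eq_enorm_sub, edist_comm]
          exact (hn x hx).le
    _ = δ ^ p * ∫⁻ x in C, h x ∂μ := lintegral_const_mul' _ _ (ENNReal.pow_ne_top hδtop.ne)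
    _ ≤ ε := hδ

theorem memLp_clmOfPartials {α : Type*} [MeasurableSpace α] {μ : Measure α} {p : ℝ≥0∞}
    {u v : α → ℂ} (hu : MemLp u p μ) (hv : MemLp v p μ) :
    MemLp (fun x => clmOfPartials (u x) (v x)) p μ :=
  ((ContinuousLinearMap.smulRightL ℝ ℂ ℂ Complex.reCLM).comp_memLp' hu).add
    ((ContinuousLinearMap.smulRightL ℝ ℂ ℂ Complex.imCLM).comp_memLp' hv)

theorem aestronglyMeasurable_clmOfPartials {α : Type*} [MeasurableSpace α] {μ : Measure α}
    {u v : α → ℂ} (hu : AEStronglyMeasurable u μ) (hv : AEStronglyMeasurable v μ) :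
    AEStronglyMeasurable (fun x => clmOfPartials (u x) (v x)) μ :=
  memLp_zero_iff_aestronglyMeasurable.1
    (memLp_clmOfPartials (memLp_zero_iff_aestronglyMeasurable.2 hu)
      (memLp_zero_iff_aestronglyMeasurable.2 hv))

theorem tendsto_lintegral_enorm_fderiv_sub_logDerivExp {a b M : ℝ} (ha : 0 ≤ a) {C : Set ℂ}
    (hC : MeasurableSet C) (hSC : MapsTo Complex.exp (vertStrip a b) C)
    (hM : ∀ w ∈ C, ‖w‖ ≤ M) {f g : ℕ → ℂ → ℂ} {ψ : ℂ → ℂ} {D : ℂ → ℂ →L[ℝ] ℂ}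
    (hf : ∀ n, ContDiffOn ℝ ∞ (f n) (vertStrip a b)) (hg : ∀ n, ContDiff ℝ ∞ (g n))
    (hfg : ∀ n, ∀ z ∈ vertStrip a b, Complex.exp (f n z) = g n (Complex.exp z))
    (hψ1 : ∀ w ∈ C, 1 ≤ ‖ψ w‖) (hclose : ∀ n, ∀ w ∈ C, ‖g n w - ψ w‖ < 1 / 2)
    (hgψ : TendstoUniformlyOn g ψ atTop C) (hD : MemLp D 2 (volume.restrict C))
    (hgD : Tendsto (fun n => ∫⁻ w in C, ‖fderiv ℝ (g n) w - D w‖ₑ ^ 2) atTop (𝓝 0)) (c : ℝ) :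
    Tendsto (fun n => ∫⁻ z in periodRect a b c, ‖fderiv ℝ (f n) z - logDerivExp ψ D z‖ₑ ^ 2)
      atTop (𝓝 0) := by
  have hDfin : ∫⁻ w in C, ‖D w‖ₑ ^ 2 ≠ ⊤ := by
    rw [← eLpNorm_two_sq]
    exact ENNReal.pow_ne_top hD.eLpNorm_ne_top
  have hlim := ENNReal.Tendsto.const_mul (a := 8 * ENNReal.ofReal M ^ 2)
    (hgD.add (tendsto_setLIntegral_enorm_sub_pow_mul hC hgψ two_ne_zero hDfin))
    (Or.inr (ENNReal.mul_ne_top (by simp) (by simp)))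
  rw [add_zero, mul_zero] at hlim
  refine tendsto_of_tendsto_of_tendsto_of_le_of_le tendsto_const_nhds hlim (fun _ => zero_le)
    fun n => ?_
  have hmeas : AEMeasurable (fun w => ‖fderiv ℝ (g n) w - D w‖ₑ ^ 2) (volume.restrict C) :=
    ((((hg n).continuous_fderiv (by simp)).aestronglyMeasurable.sub
      hD.aestronglyMeasurable).enorm).pow_const 2
  simp only
  rw [← lintegral_add_left' hmeas, ← lintegral_const_mul' _ _ (by simp [ENNReal.mul_eq_top])]
  refine le_trans (setLIntegral_mono' (isOpen_periodRect a b c).measurableSet fun z hz => ?_)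
    (lintegral_comp_exp_le ha c hSC _)
  have hzS := periodRect_subset_vertStrip a b c hz
  have hw := hSC hzS
  have hS := (isOpen_vertStrip a b).mem_nhds hzS
  have hgn : 1 / 2 ≤ ‖g n (Complex.exp z)‖ := by
    linarith [hψ1 _ hw, hclose n _ hw, norm_sub_norm_le (ψ (Complex.exp z)) (g n (Complex.exp z)),
      norm_sub_rev (ψ (Complex.exp z)) (g n (Complex.exp z))]
  rw [fderiv_eq_logDerivExp (((hf n).contDiffAt hS).differentiableAt (by simp))
    ((hg n).differentiable (by simp) _) (eventually_of_mem hS (hfg n))]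
  refine enorm_logDerivExp_sub_sq_le ?_ (hψ1 _ hw) hgn
  rw [← ofReal_norm]
  exact ENNReal.ofReal_le_ofReal (hM _ hw)

theorem isStripSobolev_of_lift {r : ℝ} (hr : 0 < r) {ψ fx fy F : ℂ → ℂ} {m : ℤ}
    (hψ : ContinuousOn ψ (roundAnnulus r)) (hψ1 : ∀ w ∈ roundAnnulus r, 1 ≤ ‖ψ w‖)
    (hfx : IsL2Loc (roundAnnulus r) fx) (hfy : IsL2Loc (roundAnnulus r) fy)
    (wx : IsWeakDerivOn (roundAnnulus r) ψ fx 1) (wy : IsWeakDerivOn (roundAnnulus r) ψ fy I)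
    (hF : ContinuousOn F (vertStrip 0 (Real.log r)))
    (hFe : ∀ z ∈ vertStrip 0 (Real.log r), Complex.exp (F z) = ψ (Complex.exp z))
    (hdeg : HasDegreeOn F m (vertStrip 0 (Real.log r))) :
    IsStripSobolev (Real.log r) F (logDerivExp ψ fun w => clmOfPartials (fx w) (fy w)) m := by
  intro a b ha hb
  set C : Set ℂ := Metric.closedBall 0 (Real.exp b) \ Metric.ball 0 (Real.exp a)
  have hC : IsCompact C := (isCompact_closedBall _ _).diff Metric.isOpen_ball
  have hCU : C ⊆ roundAnnulus r := fun w hw =>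
    ⟨(Real.one_lt_exp_iff.2 ha).trans_le (by simpa using hw.2),
      (mem_closedBall_zero_iff.1 hw.1).trans_lt ((Real.lt_log_iff_exp_lt hr).1 hb)⟩
  have hSC : MapsTo Complex.exp (vertStrip a b) C := fun z hz => by
    simpa [C, Complex.norm_exp] using And.intro hz.2.le hz.1.le
  have hSS : vertStrip a b ⊆ vertStrip 0 (Real.log r) :=
    preimage_mono (Ioo_subset_Ioo ha.le hb.le)
  obtain ⟨g₀, hg₀, hu₀, hD₀⟩ := exists_smooth_approx_of_isWeakDerivOn
    (isOpen_roundAnnulus r) hC hCU hψ hfx hfy wx wy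
  obtain ⟨n₀, hn₀⟩ := eventually_atTop.1 (Metric.tendstoUniformlyOn_iff.1 hu₀ (1 / 2) one_half_pos)
  have hclose : ∀ n, ∀ w ∈ C, ‖g₀ (n + n₀) w - ψ w‖ < 1 / 2 := fun n w hw => by
    rw [← dist_eq_norm, dist_comm]
    exact hn₀ (n + n₀) (Nat.le_add_left _ _) w hw
  have hu : TendstoUniformlyOn (fun n => g₀ (n + n₀)) ψ atTop C := fun V hV =>
    (tendsto_add_atTop_nat n₀).eventually (hu₀ V hV)
  choose f hf hfdeg hfe hfF using fun n => exists_lift_of_norm_sub_lt (isOpen_vertStrip a b)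
    (hF.mono hSS) (fun z hz => hFe z (hSS hz)) (fun z hz => hdeg z (hSS hz)) (hg₀ (n + n₀))
    (fun z hz => hψ1 _ (hCU (hSC hz))) fun z hz => hclose n _ (hSC hz)
  refine ⟨f, hf, hfdeg, ?_, tendsto_lintegral_enorm_fderiv_sub_logDerivExp ha.le hC.measurableSet
    hSC (fun w hw => mem_closedBall_zero_iff.1 hw.1) hf (fun n => hg₀ _) hfe
    (fun w hw => hψ1 w (hCU hw)) hclose hu (memLp_clmOfPartials (hfx C hC hCU) (hfy C hC hCU))
    (hD₀.comp (tendsto_add_atTop_nat n₀))⟩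
  refine Metric.tendstoUniformlyOn_iff.2 fun ε hε => ?_
  filter_upwards [Metric.tendstoUniformlyOn_iff.1 hu (ε / 2) (half_pos hε)] with n hn z hz
  have h := hn _ (hSC hz)
  rw [dist_comm, dist_eq_norm] at h ⊢
  linarith [hfF n z hz]

theorem integral_divergence_reProdIm {a b c d : ℝ} (hab : a ≤ b) (hcd : c ≤ d) {P Q : ℂ → ℝ}
    {P' Q' : ℂ → ℂ →L[ℝ] ℝ} (hP : ∀ z ∈ Icc a b ×ℂ Icc c d, HasFDerivAt P (P' z) z)
    (hQ : ∀ z ∈ Icc a b ×ℂ Icc c d, HasFDerivAt Q (Q' z) z)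
    (hinteg : IntegrableOn (fun z => P' z 1 + Q' z I) (Icc a b ×ℂ Icc c d)) :
    ∫ z in Icc a b ×ℂ Icc c d, (P' z 1 + Q' z I) =
      (∫ x in a..b, Q (x + d * I)) - (∫ x in a..b, Q (x + c * I)) +
        (∫ y in c..d, P (b + y * I)) - ∫ y in c..d, P (a + y * I) := by
  set L := Complex.equivRealProdCLM.symm
  have hL : ∀ p : ℝ × ℝ, L p = p.1 + p.2 * I := Complex.equivRealProdCLM_symm_apply
  have hset : L ⁻¹' (Icc a b ×ℂ Icc c d) = Icc (a, c) (b, d) := by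
    ext p
    simp [hL, Complex.mem_reProdIm, Prod.le_def, and_and_and_comm]
  have hmem : ∀ p ∈ Icc (a, c) (b, d), L p ∈ Icc a b ×ℂ Icc c d := fun p hp => by
    rwa [← mem_preimage, hset]
  have hPL : ∀ p ∈ Icc (a, c) (b, d),
      HasFDerivAt (fun p => P (L p)) (P' (L p) ∘L (L : ℝ × ℝ →L[ℝ] ℂ)) p :=
    fun p hp => (hP _ (hmem p hp)).comp p L.hasFDerivAt
  have hQL : ∀ p ∈ Icc (a, c) (b, d),
      HasFDerivAt (fun p => Q (L p)) (Q' (L p) ∘L (L : ℝ × ℝ →L[ℝ] ℂ)) p :=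
    fun p hp => (hQ _ (hmem p hp)).comp p L.hasFDerivAt
  have hL1 : L (1, 0) = 1 := by simp [hL]
  have hLI : L (0, 1) = I := by simp [hL]
  have hvol := Complex.volume_preserving_equiv_real_prod.symm
  have hemb := Complex.measurableEquivRealProd.symm.measurableEmbedding
  have hset' : Complex.measurableEquivRealProd.symm ⁻¹' (Icc a b ×ℂ Icc c d) =
    Icc (a, c) (b, d) := hset
  have hIoo : Ioo a b ×ˢ Ioo c d ⊆ Icc (a, c) (b, d) := fun p hp =>
    ⟨⟨hp.1.1.le, hp.2.1.le⟩, hp.1.2.le, hp.2.2.le⟩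
  have hintL := (hvol.integrableOn_comp_preimage hemb).2 hinteg
  have hmain := integral_divergence_prod_Icc_of_hasFDerivAt_of_le (fun p => P (L p))
    (fun p => Q (L p)) _ _ (a, c) (b, d) ⟨hab, hcd⟩
    (fun p hp => (hPL p hp).continuousAt.continuousWithinAt)
    (fun p hp => (hQL p hp).continuousAt.continuousWithinAt)
    (fun p hp => hPL p (hIoo hp)) (fun p hp => hQL p (hIoo hp)) (by
      simp only [ContinuousLinearMap.comp_apply, ContinuousLinearEquiv.coe_coe, hL1, hLI]
      rwa [hset'] at hintL)
  simp only [ContinuousLinearMap.comp_apply, ContinuousLinearEquiv.coe_coe, hL1, hLI] at hmain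
  rw [← hvol.setIntegral_preimage_emb hemb, hset']
  simpa only [hL, Complex.measurableEquivRealProd_symm_apply, Complex.mk_eq_add_mul_I] using hmain

theorem hasFDerivAt_comp_re_mul_fderiv_im {O : Set ℂ} (hO : IsOpen O) {f : ℂ → ℂ}
    (hf : ContDiffOn ℝ ∞ f O) {Φ φ : ℝ → ℝ} (hΦ : ∀ t, HasDerivAt Φ (φ t) t) (v : ℂ) {z : ℂ}
    (hz : z ∈ O) :
    HasFDerivAt (fun z => Φ (f z).re * (fderiv ℝ f z v).im)
      (Φ (f z).re • (Complex.imCLM ∘L (fderiv ℝ (fderiv ℝ f) z).flip v) +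
        (fderiv ℝ f z v).im • (φ (f z).re • (Complex.reCLM ∘L fderiv ℝ f z))) z := by
  have hfz := hf.contDiffAt (hO.mem_nhds hz)
  have hf₁ := (hfz.differentiableAt (by simp)).hasFDerivAt
  have hf₂ := ((hfz.fderiv_right (m := 1) (by norm_cast)).differentiableAt
    one_ne_zero).hasFDerivAt
  have hv : HasFDerivAt (fun z => fderiv ℝ f z v) ((fderiv ℝ (fderiv ℝ f) z).flip v) z := by
    simpa using hf₂.clm_apply (hasFDerivAt_const v z)
  exact ((hΦ _).comp_hasFDerivAt z (Complex.reCLM.hasFDerivAt.comp z hf₁)).mul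
    (Complex.imCLM.hasFDerivAt.comp z hv)

theorem integral_comp_re_mul_det_fderiv {a b c d : ℝ} (hab : a ≤ b) (hcd : c ≤ d) {O : Set ℂ}
    (hO : IsOpen O) (hsub : Icc a b ×ℂ Icc c d ⊆ O) {f : ℂ → ℂ} (hf : ContDiffOn ℝ ∞ f O)
    {Φ φ : ℝ → ℝ} (hΦ : ∀ t, HasDerivAt Φ (φ t) t) (hφ : Continuous φ) :
    ∫ z in Icc a b ×ℂ Icc c d, φ (f z).re * (fderiv ℝ f z).det =
      (∫ x in a..b, Φ (f (x + c * I)).re * (fderiv ℝ f (x + c * I) 1).im) -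
        (∫ x in a..b, Φ (f (x + d * I)).re * (fderiv ℝ f (x + d * I) 1).im) +
        (∫ y in c..d, Φ (f (b + y * I)).re * (fderiv ℝ f (b + y * I) I).im) -
        ∫ y in c..d, Φ (f (a + y * I)).re * (fderiv ℝ f (a + y * I) I).im := by
  have hsymm : ∀ z ∈ O, IsSymmSndFDerivAt ℝ f z := fun z hz =>
    (hf.contDiffAt (hO.mem_nhds hz)).isSymmSndFDerivAt
      (by rw [minSmoothness_of_isRCLikeNormedField]; norm_cast)
  have hdiv : ∀ z ∈ O, φ (f z).re * (fderiv ℝ f z).det =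
      (Φ (f z).re • (Complex.imCLM ∘L (fderiv ℝ (fderiv ℝ f) z).flip I) +
        (fderiv ℝ f z I).im • (φ (f z).re • (Complex.reCLM ∘L fderiv ℝ f z))) 1 +
      (-(Φ (f z).re • (Complex.imCLM ∘L (fderiv ℝ (fderiv ℝ f) z).flip 1) +
        (fderiv ℝ f z 1).im • (φ (f z).re • (Complex.reCLM ∘L fderiv ℝ f z)))) I := by
    intro z hz
    rw [det_eq_re_mul_im_sub]
    simp only [add_apply, smul_apply, ContinuousLinearMap.comp_apply,
      ContinuousLinearMap.flip_apply, (hsymm z hz).eq 1 I, Complex.imCLM_apply, smul_eq_mul,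
      Complex.reCLM_apply, neg_add_rev, neg_apply]
    ring
  have hcont : ContinuousOn (fun z => φ (f z).re * (fderiv ℝ f z).det) O := by
    have hDf := hf.continuousOn_fderiv_of_isOpen hO (by simp)
    simp only [det_eq_re_mul_im_sub]
    have hfc := hf.continuousOn
    fun_prop
  have hrect : MeasurableSet (Icc a b ×ℂ Icc c d) :=
    (isClosed_Icc.reProdIm isClosed_Icc).measurableSet
  have hcongr : EqOn _ _ (Icc a b ×ℂ Icc c d) := fun z hz => hdiv z (hsub hz)
  have hinteg : IntegrableOn _ (Icc a b ×ℂ Icc c d) volume :=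
    (hcont.mono hsub).integrableOn_compact (isCompact_Icc.reProdIm isCompact_Icc)
  rw [setIntegral_congr_fun hrect hcongr, integral_divergence_reProdIm hab hcd
    (fun z hz => hasFDerivAt_comp_re_mul_fderiv_im hO hf hΦ I (hsub hz))
    (fun z hz => (hasFDerivAt_comp_re_mul_fderiv_im hO hf hΦ 1 (hsub hz)).neg)
    (hinteg.congr_fun hcongr hrect)]
  simp only [Pi.neg_apply, intervalIntegral.integral_neg]
  ring

theorem reProdIm_Ioo_ae_eq_Icc (a b c d : ℝ) :
    (Ioo a b ×ℂ Ioo c d : Set ℂ) =ᵐ[volume] Icc a b ×ℂ Icc c d :=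
  Complex.volume_preserving_equiv_real_prod.quasiMeasurePreserving.preimage_ae_eq
    (Measure.set_prod_ae_eq Ioo_ae_eq_Icc Ioo_ae_eq_Icc)

theorem HasDegreeOn.fderiv_add_two_pi_I {a b : ℝ} {f : ℂ → ℂ} {m : ℤ}
    (hf : HasDegreeOn f m (vertStrip a b)) {z : ℂ} (hz : z ∈ vertStrip a b) :
    fderiv ℝ f (z + 2 * π * I) = fderiv ℝ f z := by
  have heq : (fun w => f (w + 2 * π * I)) =ᶠ[𝓝 z] fun w => f w + m * (2 * π * I) :=
    eventually_of_mem ((isOpen_vertStrip a b).mem_nhds hz) hf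
  rw [← fderiv_comp_add_right, heq.fderiv_eq, fderiv_add_const]

theorem integral_im_fderiv_apply_I {a b t c : ℝ} (ht : t ∈ Ioo a b) {f : ℂ → ℂ} {m : ℤ}
    (hf : ContDiffOn ℝ ∞ f (vertStrip a b)) (hdeg : HasDegreeOn f m (vertStrip a b)) :
    ∫ y in c..c + 2 * π, (fderiv ℝ f (t + y * I) I).im = m * (2 * π) := by
  have hmem : ∀ y : ℝ, (t + y * I : ℂ) ∈ vertStrip a b := fun y => by simpa [vertStrip] using ht
  have hderiv : ∀ y : ℝ, HasDerivAt (fun y : ℝ => (f (t + y * I)).im)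
      (fderiv ℝ f (t + y * I) I).im y := fun y => by
    have hline : HasDerivAt (fun y : ℝ => (t + y * I : ℂ)) I y := by
      simpa using ((Complex.ofRealCLM.hasDerivAt (x := y)).mul_const I).const_add (t : ℂ)
    have hfy := ((hf.contDiffAt ((isOpen_vertStrip a b).mem_nhds (hmem y))).differentiableAt
      (by simp)).hasFDerivAt
    exact Complex.imCLM.hasFDerivAt.comp_hasDerivAt y (hfy.comp_hasDerivAt y hline)
  have hcont : Continuous fun y : ℝ => (fderiv ℝ f (t + y * I) I).im := by
    have hDf := (hf.continuousOn_fderiv_of_isOpen (isOpen_vertStrip a b) (by simp)).comp_continuous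
      (f := fun y : ℝ => (t + y * I : ℂ)) (by fun_prop) hmem
    fun_prop
  rw [intervalIntegral.integral_eq_sub_of_hasDerivAt (fun y _ => hderiv y)
    (hcont.intervalIntegrable _ _)]
  have hshift : (t + (c + 2 * π : ℝ) * I : ℂ) = t + c * I + 2 * π * I := by push_cast; ring
  rw [hshift, hdeg _ (hmem c)]
  simp

theorem integral_comp_re_mul_det_fderiv_of_hasDegreeOn {a b a' b' c α β : ℝ} {f : ℂ → ℂ} {m : ℤ}
    (haa' : a < a') (hab' : a' ≤ b') (hbb' : b' < b) (hf : ContDiffOn ℝ ∞ f (vertStrip a b))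
    (hdeg : HasDegreeOn f m (vertStrip a b)) {φ : ℝ → ℝ} (hφ : Continuous φ)
    (hφα : ∀ t ≤ α, φ t = 0) (hφβ : ∀ t, β ≤ t → φ t = 0)
    (hfa : ∀ z : ℂ, z.re = a' → (f z).re ≤ α) (hfb : ∀ z : ℂ, z.re = b' → β ≤ (f z).re) :
    ∫ z in periodRect a' b' c, φ (f z).re * (fderiv ℝ f z).det =
      (∫ t in α..β, φ t) * (m * (2 * π)) := by
  set Φ : ℝ → ℝ := fun t => ∫ s in α..t, φ s
  have hΦ : ∀ t, HasDerivAt Φ (φ t) t := fun t => hφ.integral_hasStrictDerivAt α t |>.hasDerivAt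
  have hΦα : ∀ t ≤ α, Φ t = 0 := fun t ht =>
    intervalIntegral.integral_zero_ae (ae_of_all _ fun s hs => hφα s (by
      rw [uIoc_of_ge ht] at hs; exact hs.2))
  have hΦβ : ∀ t, β ≤ t → Φ t = ∫ s in α..β, φ s := fun t ht => by
    have hzero : ∫ s in β..t, φ s = 0 :=
      intervalIntegral.integral_zero_ae (ae_of_all _ fun s hs => hφβ s (by
        rw [uIoc_of_le ht] at hs; exact hs.1.le))
    exact (intervalIntegral.integral_add_adjacent_intervals (hφ.intervalIntegrable α β)
      (hφ.intervalIntegrable β t)).symm.trans (by rw [hzero, add_zero])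
  have hsub : Icc a' b' ×ℂ Icc c (c + 2 * π) ⊆ vertStrip a b := fun z hz =>
    ⟨haa'.trans_le hz.1.1, hz.1.2.trans_lt hbb'⟩
  have hhor : ∫ x in a'..b', Φ (f (x + (c + 2 * π : ℝ) * I)).re *
      (fderiv ℝ f (x + (c + 2 * π : ℝ) * I) 1).im =
      ∫ x in a'..b', Φ (f (x + c * I)).re * (fderiv ℝ f (x + c * I) 1).im := by
    refine intervalIntegral.integral_congr fun x hx => ?_
    rw [uIcc_of_le hab'] at hx
    have hxc : (x + c * I : ℂ) ∈ vertStrip a b := by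
      simpa [vertStrip] using And.intro (haa'.trans_le hx.1) (hx.2.trans_lt hbb')
    have hshift : (x + (c + 2 * π : ℝ) * I : ℂ) = x + c * I + 2 * π * I := by push_cast; ring
    simp only [hshift, hdeg.fderiv_add_two_pi_I hxc, hdeg _ hxc]
    simp
  have hleft : ∀ y : ℝ, Φ (f (a' + y * I)).re = 0 := fun y => hΦα _ (hfa _ (by simp))
  have hright : ∀ y : ℝ, Φ (f (b' + y * I)).re = ∫ s in α..β, φ s :=
    fun y => hΦβ _ (hfb _ (by simp))
  rw [periodRect, setIntegral_congr_set (reProdIm_Ioo_ae_eq_Icc _ _ _ _),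
    integral_comp_re_mul_det_fderiv hab' (by linarith [Real.pi_pos]) (isOpen_vertStrip a b)
    hsub hf hΦ hφ, hhor]
  simp only [hleft, hright, zero_mul, intervalIntegral.integral_zero,
    intervalIntegral.integral_const_mul]
  rw [integral_im_fderiv_apply_I ⟨haa'.trans_le hab', hbb'⟩ hf hdeg]
  ring

theorem abs_re_mul_im_sub_re_mul_im_le (z w : ℂ) : |z.re * w.im - w.re * z.im| ≤ ‖z‖ * ‖w‖ := by
  have h := Complex.abs_im_le_norm (conj z * w)
  rw [norm_mul, Complex.norm_conj] at h
  convert h using 2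
  simp only [Complex.mul_im, Complex.conj_re, Complex.conj_im, neg_mul]
  ring

theorem enorm_det_sub_det_le (A B : ℂ →L[ℝ] ℂ) :
    ‖A.det - B.det‖ₑ ≤ ‖A - B‖ₑ ^ 2 + 2 * (‖B‖ₑ * ‖A - B‖ₑ) := by
  have hsplit : A.det - B.det = (A - B).det +
      (((A - B) 1).re * (B I).im - (B I).re * ((A - B) 1).im) +
      ((B 1).re * ((A - B) I).im - ((A - B) I).re * (B 1).im) := by
    simp only [det_eq_re_mul_im_sub, sub_apply, Complex.sub_re, Complex.sub_im]
    ring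
  have hle : ∀ S T : ℂ →L[ℝ] ℂ, |(S 1).re * (T I).im - (T I).re * (S 1).im| ≤ ‖S‖ * ‖T‖ :=
    fun S T => (abs_re_mul_im_sub_re_mul_im_le _ _).trans <| mul_le_mul
      (by simpa using S.le_opNorm 1) (by simpa using T.le_opNorm I) (norm_nonneg _) (norm_nonneg _)
  have hreal : ‖A.det - B.det‖ ≤ ‖A - B‖ ^ 2 + 2 * (‖B‖ * ‖A - B‖) := by
    rw [Real.norm_eq_abs, hsplit, det_eq_re_mul_im_sub (A - B)]
    refine (abs_add_three _ _ _).trans ?_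
    linarith [hle (A - B) (A - B), hle (A - B) B, hle B (A - B)]
  simp only [enorm_eq_nnnorm]
  exact_mod_cast hreal

theorem tendsto_zero_of_tendsto_sq {α : Type*} {l : Filter α} {u : α → ℝ≥0∞}
    (h : Tendsto (fun x => u x ^ 2) l (𝓝 0)) : Tendsto u l (𝓝 0) := by
  have hsqrt := ((ENNReal.continuous_rpow_const (y := ((2 : ℕ) : ℝ)⁻¹)).tendsto 0).comp h
  rw [ENNReal.zero_rpow_of_pos (by positivity)] at hsqrt
  exact hsqrt.congr fun x => ENNReal.pow_rpow_inv_natCast two_ne_zero _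

theorem tendsto_lintegral_enorm_det_sub {α : Type*} [MeasurableSpace α] {μ : Measure α}
    {A : ℕ → α → ℂ →L[ℝ] ℂ} {B : α → ℂ →L[ℝ] ℂ} (hA : ∀ n, AEStronglyMeasurable (A n) μ)
    (hB : MemLp B 2 μ) (hlim : Tendsto (fun n => ∫⁻ x, ‖A n x - B x‖ₑ ^ 2 ∂μ) atTop (𝓝 0)) :
    Tendsto (fun n => ∫⁻ x, ‖(A n x).det - (B x).det‖ₑ ∂μ) atTop (𝓝 0) := by
  have hmeas : ∀ n, AEMeasurable (fun x => ‖A n x - B x‖ₑ) μ := fun n =>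
    ((hA n).sub hB.aestronglyMeasurable).enorm
  have hBfin : ∫⁻ x, ‖B x‖ₑ ^ 2 ∂μ ≠ ⊤ := by
    rw [← eLpNorm_two_sq]
    exact ENNReal.pow_ne_top hB.eLpNorm_ne_top
  have hcross : Tendsto (fun n => ∫⁻ x, ‖B x‖ₑ * ‖A n x - B x‖ₑ ∂μ) atTop (𝓝 0) := by
    have hsq := ENNReal.Tendsto.const_mul hlim (Or.inr hBfin)
    rw [mul_zero] at hsq
    exact tendsto_zero_of_tendsto_sq <| tendsto_of_tendsto_of_tendsto_of_le_of_le
      tendsto_const_nhds hsq (fun _ => zero_le)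
      fun n => sq_lintegral_mul_le μ hB.aestronglyMeasurable.enorm (hmeas n)
  have htwo : (2 : ℝ≥0∞) ≠ ⊤ := ENNReal.ofNat_ne_top
  have hsum := hlim.add (ENNReal.Tendsto.const_mul hcross (Or.inr htwo))
  rw [mul_zero, add_zero] at hsum
  refine tendsto_of_tendsto_of_tendsto_of_le_of_le tendsto_const_nhds hsum (fun _ => zero_le)
    fun n => (lintegral_mono fun x => enorm_det_sub_det_le (A n x) (B x)).trans_eq ?_
  rw [lintegral_add_left' ((hmeas n).pow_const 2), lintegral_const_mul' _ _ htwo]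

theorem tendsto_setIntegral_mul {α : Type*} [MeasurableSpace α] {μ : Measure α} {C : Set α}
    (hC : MeasurableSet C) {u J : ℕ → α → ℝ} {v j : α → ℝ} (hu : TendstoUniformlyOn u v atTop C)
    (hu1 : ∀ n, ∀ x ∈ C, |u n x| ≤ 1) (hj : IntegrableOn j C μ)
    (hJm : ∀ n, AEStronglyMeasurable (J n) (μ.restrict C))
    (huJ : ∀ n, IntegrableOn (fun x => u n x * J n x) C μ)
    (hvj : IntegrableOn (fun x => v x * j x) C μ)
    (hJ : Tendsto (fun n => ∫⁻ x in C, ‖J n x - j x‖ₑ ∂μ) atTop (𝓝 0)) :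
    Tendsto (fun n => ∫ x in C, u n x * J n x ∂μ) atTop (𝓝 (∫ x in C, v x * j x ∂μ)) := by
  refine tendsto_integral_of_L1 _ hvj.aestronglyMeasurable (Eventually.of_forall huJ) ?_
  have hsum := hJ.add (tendsto_setLIntegral_enorm_sub_pow_mul hC hu one_ne_zero hj.2.ne)
  rw [add_zero] at hsum
  refine tendsto_of_tendsto_of_tendsto_of_le_of_le tendsto_const_nhds hsum (fun _ => zero_le)
    fun n => le_of_le_of_eq ?_
      (lintegral_add_left' ((hJm n).sub hj.aestronglyMeasurable).enorm _)
  refine setLIntegral_mono' hC fun x hx => ?_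
  have hsplit : u n x * J n x - v x * j x = u n x * (J n x - j x) + (u n x - v x) * j x := by ring
  have hux : ‖u n x‖ₑ ≤ 1 := by
    rw [← ofReal_norm, ENNReal.ofReal_le_one]
    exact hu1 n x hx
  rw [hsplit, pow_one]
  refine (enorm_add_le _ _).trans ?_
  rw [enorm_mul, enorm_mul]
  gcongr
  exact mul_le_of_le_one_left' hux

theorem periodRect_mono {a b a' b' : ℝ} (ha : a' ≤ a) (hb : b ≤ b') (c : ℝ) :
    periodRect a b c ⊆ periodRect a' b' c :=
  inter_subset_inter_left _ (preimage_mono (Ioo_subset_Ioo ha hb))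

theorem memLp_fderiv_periodRect {a b a' b' : ℝ} (haa' : a < a') (hbb' : b' < b) {f : ℂ → ℂ}
    (hf : ContDiffOn ℝ ∞ f (vertStrip a b)) (c : ℝ) (p : ℝ≥0∞) :
    MemLp (fderiv ℝ f) p (volume.restrict (periodRect a' b' c)) := by
  have hsub : periodRect a' b' c ⊆ Icc a' b' ×ℂ Icc c (c + 2 * π) :=
    inter_subset_inter (preimage_mono Ioo_subset_Icc_self) (preimage_mono Ioo_subset_Icc_self)
  have hcpt : IsCompact (Icc a' b' ×ℂ Icc c (c + 2 * π)) := isCompact_Icc.reProdIm isCompact_Icc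
  have hstrip : Icc a' b' ×ℂ Icc c (c + 2 * π) ⊆ vertStrip a b := fun z hz =>
    ⟨haa'.trans_le hz.1.1, hz.1.2.trans_lt hbb'⟩
  have hcont := (hf.continuousOn_fderiv_of_isOpen (isOpen_vertStrip _ _) (by simp)).mono hstrip
  obtain ⟨M, hM⟩ := hcpt.exists_bound_of_continuousOn hcont
  have hmeas := (isOpen_periodRect a' b' c).measurableSet
  have hfin : IsFiniteMeasure (volume.restrict (periodRect a' b' c)) :=
    isFiniteMeasure_restrict.2 ((measure_mono hsub).trans_lt hcpt.measure_lt_top).ne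
  exact .of_bound ((hcont.mono hsub).aestronglyMeasurable hmeas) M
    ((ae_restrict_mem hmeas).mono fun z hz => hM z (hsub hz))

theorem IsStripSobolev.memLp {R : ℝ} {F : ℂ → ℂ} {D : ℂ → ℂ →L[ℝ] ℂ} {m : ℤ}
    (h : IsStripSobolev R F D m) (hD : AEStronglyMeasurable D (volume.restrict (vertStrip 0 R)))
    {a b : ℝ} (ha : 0 < a) (hb : b < R) (c : ℝ) :
    MemLp D 2 (volume.restrict (periodRect a b c)) := by
  obtain ⟨f, hf, -, -, hlim⟩ := h (a / 2) ((b + R) / 2) (half_pos ha) (by linarith)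
  obtain ⟨n, hn⟩ := ((hlim c).eventually_lt_const zero_lt_one).exists
  have hf' := memLp_fderiv_periodRect (half_lt_self ha) (by linarith : b < (b + R) / 2) (hf n) c 2
  have hDm : AEStronglyMeasurable D (volume.restrict (periodRect a b c)) :=
    hD.mono_set ((periodRect_subset_vertStrip a b c).trans
      (preimage_mono (Ioo_subset_Ioo ha.le hb.le)))
  have hdiff : MemLp (fun z => fderiv ℝ (f n) z - D z) 2 (volume.restrict (periodRect a b c)) := by
    refine ⟨hf'.1.sub hDm, ?_⟩
    have hle := (lintegral_mono_set (periodRect_mono (half_le_self ha.le)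
      (by linarith : b ≤ (b + R) / 2) c)).trans_lt hn
    rw [← eLpNorm_two_sq] at hle
    exact (ENNReal.pow_lt_top_iff.1 (hle.trans ENNReal.one_lt_top)).resolve_right two_ne_zero
  exact (hf'.sub hdiff).ae_eq (Eventually.of_forall fun z => sub_sub_cancel _ _)

theorem integrable_det_of_memLp {α : Type*} [MeasurableSpace α] {μ : Measure α}
    {A : α → ℂ →L[ℝ] ℂ} (hA : MemLp A 2 μ) : Integrable (fun x => (A x).det) μ := by
  refine (hA.integrable_norm_pow two_ne_zero).mono'
    (ContinuousLinearMap.continuous_det.comp_aestronglyMeasurable hA.1)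
    (Eventually.of_forall fun x => ?_)
  rw [det_eq_re_mul_im_sub, Real.norm_eq_abs, sq]
  exact (abs_re_mul_im_sub_re_mul_im_le _ _).trans <| mul_le_mul
    (by simpa using (A x).le_opNorm 1) (by simpa using (A x).le_opNorm I) (norm_nonneg _)
    (norm_nonneg _)

theorem IsStripSobolev.integral_comp_re_mul_det {R : ℝ} {F : ℂ → ℂ} {D : ℂ → ℂ →L[ℝ] ℂ} {m : ℤ}
    (h : IsStripSobolev R F D m) (hF : ContinuousOn F (vertStrip 0 R))
    (hD : AEStronglyMeasurable D (volume.restrict (vertStrip 0 R))) {a b c α β ε : ℝ}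
    (ha : 0 < a) (hab : a ≤ b) (hb : b < R) {φ : ℝ → ℝ} (hφ : UniformContinuous φ)
    (hφ1 : ∀ t, |φ t| ≤ 1) (hφα : ∀ t ≤ α, φ t = 0) (hφβ : ∀ t, β ≤ t → φ t = 0) (hε : 0 < ε)
    (hFa : ∀ z : ℂ, z.re = a → (F z).re ≤ α - ε) (hFb : ∀ z : ℂ, z.re = b → β + ε ≤ (F z).re) :
    IntegrableOn (fun z => φ (F z).re * (D z).det) (periodRect a b c) ∧
      ∫ z in periodRect a b c, φ (F z).re * (D z).det = (∫ t in α..β, φ t) * (m * (2 * π)) := by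
  obtain ⟨f, hf, hdeg, hfF, hlim⟩ := h (a / 2) ((b + R) / 2) (half_pos ha) (by linarith)
  have haa : a / 2 < a := half_lt_self ha
  have hbb : b < (b + R) / 2 := by linarith
  have hmeas := (isOpen_periodRect a b c).measurableSet
  have hsub : periodRect a b c ⊆ vertStrip (a / 2) ((b + R) / 2) :=
    (periodRect_mono haa.le hbb.le c).trans (periodRect_subset_vertStrip _ _ c)
  have hinteg : ∀ {g : ℂ → ℂ} {A : ℂ → ℂ →L[ℝ] ℂ}, ContinuousOn g (periodRect a b c) →
      IntegrableOn (fun z => (A z).det) (periodRect a b c) →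
      IntegrableOn (fun z => φ (g z).re * (A z).det) (periodRect a b c) := fun hg hA =>
    hA.bdd_mul ((hφ.continuous.comp_continuousOn
      (Complex.continuous_re.comp_continuousOn hg)).aestronglyMeasurable hmeas)
      (Eventually.of_forall fun z => hφ1 _)
  have hDp := h.memLp hD ha hb c
  have hfp := fun n => memLp_fderiv_periodRect haa hbb (hf n) c 2
  have hFint := hinteg (hF.mono ((periodRect_subset_vertStrip a b c).trans
    (preimage_mono (Ioo_subset_Ioo ha.le hb.le)))) (integrable_det_of_memLp hDp)
  have hφf : TendstoUniformlyOn (fun n z => φ (f n z).re) (fun z => φ (F z).re) atTop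
      (periodRect a b c) :=
    (hφ.comp Complex.reCLM.uniformContinuous).comp_tendstoUniformlyOn (hfF.mono hsub)
  have hDlim := tendsto_lintegral_enorm_det_sub (fun n => (hfp n).1) hDp <|
    tendsto_of_tendsto_of_tendsto_of_le_of_le tendsto_const_nhds (hlim c) (fun _ => zero_le)
      fun n => lintegral_mono_set (periodRect_mono haa.le hbb.le c)
  have hmain := tendsto_setIntegral_mul hmeas hφf (fun n z _ => hφ1 _)
    (integrable_det_of_memLp hDp) (fun n => (integrable_det_of_memLp (hfp n)).1)
    (fun n => hinteg ((hf n).continuousOn.mono hsub) (integrable_det_of_memLp (hfp n))) hFint hDlim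
  refine ⟨hFint, tendsto_nhds_unique hmain (tendsto_const_nhds.congr' ?_)⟩
  filter_upwards [Metric.tendstoUniformlyOn_iff.1 hfF ε hε] with n hn
  have hre : ∀ z : ℂ, z.re ∈ Ioo (a / 2) ((b + R) / 2) → |(F z).re - (f n z).re| < ε :=
    fun z hz => (Complex.abs_re_le_norm _).trans_lt (dist_eq_norm (F z) (f n z) ▸ hn z hz)
  refine (integral_comp_re_mul_det_fderiv_of_hasDegreeOn haa hab hbb (hf n) (hdeg n) hφ.continuous
    hφα hφβ (fun z hz => ?_) fun z hz => ?_).symm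
  · linarith [(abs_lt.1 (hre z (by rw [hz]; exact ⟨haa, hab.trans_lt hbb⟩))).1, hFa z hz]
  · linarith [(abs_lt.1 (hre z (by rw [hz]; exact ⟨haa.trans_le hab, hbb⟩))).2, hFb z hz]

theorem exists_cutoff {α s t β : ℝ} (hα : α < s) (hβ : t < β) :
    ∃ φ : ℝ → ℝ, UniformContinuous φ ∧ (∀ x, 0 ≤ φ x) ∧ (∀ x, |φ x| ≤ 1) ∧
      (∀ x ∈ Icc s t, φ x = 1) ∧ (∀ x ≤ α, φ x = 0) ∧ ∀ x, β ≤ x → φ x = 0 := by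
  obtain ⟨f, hf1, hf0, hfc, hf⟩ := exists_continuous_one_zero_of_isCompact (isCompact_Icc (a := s)
    (b := t)) (isOpen_Ioo (a := α) (b := β)).isClosed_compl
    (disjoint_compl_right_iff_subset.2 (Icc_subset_Ioo hα hβ))
  exact ⟨f, hfc.uniformContinuous_of_continuous f.continuous, fun x => (hf x).1,
    fun x => abs_le.2 ⟨by linarith [(hf x).1], (hf x).2⟩, fun x hx => hf1 hx,
    fun x hx => hf0 fun h => h.1.not_ge hx, fun x hx => hf0 fun h => h.2.not_ge hx⟩

theorem PreservesEnds.exists_re_map_le {R R' : ℝ} {F : ℂ → ℂ} (h : PreservesEnds R R' F)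
    {a δ : ℝ} (ha : 0 < a) (hδ : 0 < δ) :
    ∃ a' ∈ Ioc 0 a, ∀ z : ℂ, z.re = a' → (F z).re ≤ δ := by
  obtain ⟨d, hd, hdF⟩ := (hasBasis_leftEnd.tendsto_iff hasBasis_leftEnd).1 h.left δ hδ
  refine ⟨min a (d / 2), ⟨lt_min ha (half_pos hd), min_le_left _ _⟩, fun z hz => ?_⟩
  refine (hdF z ⟨?_, ?_⟩).2.le <;> rw [hz]
  exacts [lt_min ha (half_pos hd), (min_le_right _ _).trans_lt (half_lt_self hd)]

theorem PreservesEnds.exists_le_re_map {R R' : ℝ} {F : ℂ → ℂ} (h : PreservesEnds R R' F)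
    {b δ : ℝ} (hb : b < R) (hδ : δ < R') :
    ∃ b' ∈ Ico b R, ∀ z : ℂ, z.re = b' → δ ≤ (F z).re := by
  obtain ⟨d, hd, hdF⟩ := ((hasBasis_rightEnd R).tendsto_iff (hasBasis_rightEnd R')).1 h.right δ hδ
  refine ⟨max b ((d + R) / 2), ⟨le_max_left _ _, max_lt hb (by linarith)⟩, fun z hz => ?_⟩
  refine (hdF z ⟨?_, ?_⟩).1.le <;> rw [hz]
  exacts [lt_max_of_lt_right (by linarith), max_lt hb (by linarith)]

theorem exists_antitone_iUnion_Ioo_eq {R : ℝ} (hR : 0 < R) :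
    ∃ a : ℕ → ℝ, Antitone a ∧ (∀ n, a n ∈ Ioo 0 (R / 2)) ∧ ⋃ n, Ioo (a n) (R - a n) = Ioo 0 R := by
  obtain ⟨a, hanti, ha, hlim⟩ := exists_seq_strictAnti_tendsto' (half_pos hR)
  refine ⟨a, hanti.antitone, ha, subset_antisymm (iUnion_subset fun n =>
    Ioo_subset_Ioo (ha n).1.le (sub_le_self R (ha n).1.le)) fun x hx => ?_⟩
  obtain ⟨n, hleft, hright⟩ := ((hlim.eventually_lt_const hx.1).and
    (hlim.eventually_lt_const (sub_pos.2 hx.2))).exists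
  exact mem_iUnion.2 ⟨n, hleft, lt_sub_comm.1 hright⟩

theorem setLIntegral_le_of_forall_periodRect {R c : ℝ} (hR : 0 < R) {k : ℂ → ℝ≥0∞} {B : ℝ≥0∞}
    (h : ∀ a b, 0 < a → a ≤ b → b < R → ∫⁻ z in periodRect a b c, k z ≤ B) :
    ∫⁻ z in periodRect 0 R c, k z ≤ B := by
  obtain ⟨a, hanti, ha, hunion⟩ := exists_antitone_iUnion_Ioo_eq hR
  have hmono : Monotone fun n => periodRect (a n) (R - a n) c := fun i j hij =>
    periodRect_mono (hanti hij) (sub_le_sub_left (hanti hij) R) c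
  have hrect : periodRect 0 R c = ⋃ n, periodRect (a n) (R - a n) c := by
    ext z
    simp only [periodRect, Complex.mem_reProdIm, ← hunion, mem_iUnion, exists_and_right]
  rw [hrect, setLIntegral_iUnion_of_directed _ hmono.directed_le]
  exact iSup_le fun n => h _ _ (ha n).1 (by linarith [(ha n).2]) (sub_lt_self R (ha n).1)

theorem intervalIntegral_mul_le_of_abs_le_one {φ : ℝ → ℝ} (hφ : ∀ x, |φ x| ≤ 1) {α β L : ℝ}
    (hL : |β - α| ≤ L) {m : ℤ} (hm : m = 1 ∨ m = -1) : (∫ x in α..β, φ x) * m ≤ L := by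
  have hle := intervalIntegral.norm_integral_le_of_norm_le_const (f := φ) (a := α) (b := β) (C := 1)
    fun x _ => hφ x
  rw [one_mul, Real.norm_eq_abs] at hle
  obtain ⟨h₁, h₂⟩ := abs_le.1 (hle.trans hL)
  rcases hm with rfl | rfl <;> push_cast <;> linarith

theorem IsStripHomeo.setLIntegral_enorm_sq_le {R R' K : ℝ} {Φ : OpenPartialHomeomorph ℂ ℂ}
    {D : ℂ → ℂ →L[ℝ] ℂ} {m : ℤ} (hΦ : IsStripHomeo R R' Φ m) (hends : PreservesEnds R R' Φ)
    (hsob : IsStripSobolev R Φ D m) (hD : AEStronglyMeasurable D (volume.restrict (vertStrip 0 R)))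
    (hK : 0 < K) (hdet : ∀ᵐ z ∂volume.restrict (vertStrip 0 R), ‖D z‖ ^ 2 ≤ K * (D z).det)
    {a b : ℝ} (ha : 0 < a) (hab : a ≤ b) (hb : b < R) (c : ℝ) :
    ∫⁻ z in periodRect a b c, ‖D z‖ₑ ^ 2 ≤ ENNReal.ofReal (K * (R' * (2 * π))) := by
  obtain ⟨s, t, hs, ht, hst⟩ := hΦ.exists_re_map_mem_Icc ha hb
  have hle_st : s ≤ t := (hst a ⟨le_rfl, hab⟩).1.trans (hst a ⟨le_rfl, hab⟩).2
  obtain ⟨ε, hε, hεst⟩ := exists_between (lt_min (half_pos hs) (half_pos (sub_pos.2 ht)))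
  obtain ⟨hεs, hεt⟩ := lt_min_iff.1 hεst
  obtain ⟨φ, hφ, hφ0, hφ1, hφst, hφα, hφβ⟩ :=
    exists_cutoff (sub_lt_self s hε) (lt_add_of_pos_right t hε)
  obtain ⟨a', ha', hΦa⟩ := hends.exists_re_map_le ha (δ := s - ε - ε) (by linarith)
  obtain ⟨b', hb', hΦb⟩ := hends.exists_le_re_map hb (δ := t + ε + ε) (by linarith)
  obtain ⟨hinteg, heq⟩ := hsob.integral_comp_re_mul_det hΦ.continuousOn hD (c := c) ha'.1
    (ha'.2.trans (hab.trans hb'.1)) hb'.2 hφ hφ1 hφα hφβ hε hΦa hΦb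
  have hdet' : ∀ᵐ z ∂volume.restrict (periodRect a' b' c), ‖D z‖ ^ 2 ≤ K * (D z).det :=
    ae_restrict_of_ae_restrict_of_subset ((periodRect_subset_vertStrip a' b' c).trans
      (preimage_mono (Ioo_subset_Ioo ha'.1.le hb'.2.le))) hdet
  have hnonneg : ∀ᵐ z ∂volume.restrict (periodRect a' b' c), 0 ≤ φ (Φ z).re * (D z).det :=
    hdet'.mono fun z hz => mul_nonneg (hφ0 _)
      (nonneg_of_mul_nonneg_right ((sq_nonneg _).trans hz) hK)
  have hmean := intervalIntegral_mul_le_of_abs_le_one hφ1 (α := s - ε) (β := t + ε)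
    (abs_le.2 ⟨by linarith, by linarith⟩ : _ ≤ R') hΦ.degree_eq
  calc ∫⁻ z in periodRect a b c, ‖D z‖ₑ ^ 2
      ≤ ∫⁻ z in periodRect a b c, ENNReal.ofReal (K * (φ (Φ z).re * (D z).det)) := by
        refine lintegral_mono_ae ?_
        filter_upwards [ae_restrict_of_ae_restrict_of_subset (periodRect_mono ha'.2 hb'.1 c) hdet',
          ae_restrict_mem (isOpen_periodRect a b c).measurableSet] with z hz hzQ
        rw [hφst _ (hst z (Ioo_subset_Icc_self hzQ.1)), one_mul, ← ofReal_norm,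
          ← ENNReal.ofReal_pow (norm_nonneg _)]
        exact ENNReal.ofReal_le_ofReal hz
    _ ≤ ∫⁻ z in periodRect a' b' c, ENNReal.ofReal (K * (φ (Φ z).re * (D z).det)) :=
        lintegral_mono_set (periodRect_mono ha'.2 hb'.1 c)
    _ = ENNReal.ofReal (K * ((∫ x in (s - ε)..(t + ε), φ x) * (m * (2 * π)))) := by
        rw [← ofReal_integral_eq_lintegral_ofReal (hinteg.const_mul K)
          (hnonneg.mono fun z hz => mul_nonneg hK.le hz), integral_const_mul, heq]
    _ ≤ ENNReal.ofReal (K * (R' * (2 * π))) := by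
        rw [← mul_assoc _ (m : ℝ)]
        gcongr

theorem measurable_complex_mk : Measurable fun p : ℝ × ℝ => (⟨p.1, p.2⟩ : ℂ) :=
  Complex.measurableEquivRealProd.symm.measurable

theorem setLIntegral_reProdIm {s t : Set ℝ} {k : ℂ → ℝ≥0∞} (hk : Measurable k) :
    ∫⁻ z in s ×ℂ t, k z = ∫⁻ x in s, ∫⁻ y in t, k ⟨x, y⟩ := by
  rw [← Complex.volume_preserving_equiv_real_prod.symm.setLIntegral_comp_preimage_emb
    Complex.measurableEquivRealProd.symm.measurableEmbedding]
  have hset : Complex.measurableEquivRealProd.symm ⁻¹' (s ×ℂ t) = s ×ˢ t := rfl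
  rw [hset, Measure.volume_eq_prod, ← Measure.prod_restrict]
  exact lintegral_prod _ (hk.comp measurable_complex_mk).aemeasurable

theorem setLIntegral_reProdIm_symm {s t : Set ℝ} {k : ℂ → ℝ≥0∞} (hk : Measurable k) :
    ∫⁻ z in s ×ℂ t, k z = ∫⁻ y in t, ∫⁻ x in s, k ⟨x, y⟩ :=
  (setLIntegral_reProdIm hk).trans
    (lintegral_lintegral_swap (hk.comp measurable_complex_mk).aemeasurable)

theorem hasDerivAt_mk_re (x y : ℝ) : HasDerivAt (fun t : ℝ => (⟨t, y⟩ : ℂ)) 1 x := by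
  simp_rw [Complex.mk_eq_add_mul_I]
  exact (hasDerivAt_id x).ofReal_comp.add_const _

theorem hasDerivAt_mk_im (x y : ℝ) : HasDerivAt (fun t : ℝ => (⟨x, t⟩ : ℂ)) I y := by
  simp_rw [Complex.mk_eq_add_mul_I]
  simpa using ((hasDerivAt_id y).ofReal_comp.mul_const I).const_add (x : ℂ)

theorem ae_liminf_lintegral_eq_zero {α : Type*} [MeasurableSpace α] {μ : Measure α}
    {k : ℕ → α → ℝ≥0∞} (hk : ∀ n, Measurable (k n))
    (h : Tendsto (fun n => ∫⁻ y, k n y ∂μ) atTop (𝓝 0)) :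
    ∀ᵐ y ∂μ, liminf (fun n => k n y) atTop = 0 := by
  refine (lintegral_eq_zero_iff (Measurable.liminf hk)).1 (le_antisymm ?_ zero_le)
  exact (lintegral_liminf_le hk).trans_eq h.liminf_eq

/-- `g` is an upper gradient of the curve `w` on the parameter set `S`. -/
def IsUpperGradientAlong {E : Type*} [NormedAddCommGroup E] (S : Set ℝ) (w : ℝ → E)
    (g : ℝ → ℝ≥0∞) : Prop :=
  ∀ a ∈ S, ∀ b ∈ S, a ≤ b → ‖w b - w a‖ₑ ≤ ∫⁻ t in Icc a b, g t

theorem isUpperGradientAlong_of_liminf_eq_zero {E : Type*} [NormedAddCommGroup E]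
    [NormedSpace ℝ E] [CompleteSpace E] {u u' : ℕ → ℝ → E} {w : ℝ → E} {g : ℝ → ℝ≥0∞}
    {k : ℕ → ℝ → ℝ≥0∞} {S : Set ℝ} [S.OrdConnected] (hg : Measurable g)
    (hd : ∀ n, ∀ t ∈ S, HasDerivAt (u n) (u' n t) t) (hc : ∀ n, ContinuousOn (u' n) S)
    (hle : ∀ n t, ‖u' n t‖ₑ ≤ g t + k n t)
    (hlim : ∀ t ∈ S, Tendsto (fun n => u n t) atTop (𝓝 (w t)))
    (hk : liminf (fun n => ∫⁻ t in S, k n t) atTop = 0) : IsUpperGradientAlong S w g := by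
  intro a ha b hb hab
  have hS : Icc a b ⊆ S := Set.Icc_subset S ha hb
  have hn : ∀ n, ‖u n b - u n a‖ₑ ≤ (∫⁻ t in Icc a b, g t) + ∫⁻ t in S, k n t := fun n => by
    rw [← uIcc_of_le hab] at hS
    rw [← intervalIntegral.integral_eq_sub_of_hasDerivAt (fun t ht => hd n t (hS ht))
      ((hc n).mono hS).intervalIntegrable, intervalIntegral.integral_of_le hab]
    rw [uIcc_of_le hab] at hS
    calc ‖∫ t in Ioc a b, u' n t‖ₑ ≤ ∫⁻ t in Ioc a b, ‖u' n t‖ₑ :=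
          enorm_integral_le_lintegral_enorm _
      _ ≤ ∫⁻ t in Icc a b, ‖u' n t‖ₑ := lintegral_mono_set Ioc_subset_Icc_self
      _ ≤ ∫⁻ t in Icc a b, (g t + k n t) := lintegral_mono (hle n)
      _ = (∫⁻ t in Icc a b, g t) + ∫⁻ t in Icc a b, k n t := lintegral_add_left hg _
      _ ≤ (∫⁻ t in Icc a b, g t) + ∫⁻ t in S, k n t := by gcongr
  refine le_of_forall_pos_le_add fun ε hε => ?_
  have hfreq : ∃ᶠ n in atTop, ∫⁻ t in S, k n t < ε :=
    frequently_lt_of_liminf_lt (by isBoundedDefault) (by rwa [hk])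
  exact le_of_tendsto_of_frequently
    ((hlim b (hS (right_mem_Icc.2 hab))).sub (hlim a (hS (left_mem_Icc.2 hab)))).enorm
    (hfreq.mono fun n hlt => (hn n).trans (by gcongr))

theorem ae_isUpperGradientAlong_of_tendsto {S T : Set ℝ} [S.OrdConnected] (hT : MeasurableSet T)
    {U : Set ℂ} (hU : IsOpen U) {γ : ℝ → ℝ → ℂ} (hγ : Measurable (Function.uncurry γ)) {v : ℂ}
    (hv : ‖v‖ ≤ 1) (hγv : ∀ s t, HasDerivAt (γ s) v t) (hmem : ∀ s ∈ T, ∀ t ∈ S, γ s t ∈ U)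
    {f : ℕ → ℂ → ℂ} (hf : ∀ n, ContDiffOn ℝ ∞ (f n) U) {F : ℂ → ℂ}
    (hfF : ∀ z ∈ U, Tendsto (fun n => f n z) atTop (𝓝 (F z))) {D : ℂ → ℂ →L[ℝ] ℂ}
    (hD : Measurable D) (hlim : Tendsto (fun n => ∫⁻ s in T, ∫⁻ t in S,
      ‖fderiv ℝ (f n) (γ s t) - D (γ s t)‖ₑ) atTop (𝓝 0)) :
    ∀ᵐ s, s ∈ T → IsUpperGradientAlong S (fun t => F (γ s t)) fun t => ‖D (γ s t)‖ₑ := by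
  have hmeas : ∀ n, Measurable fun z => ‖fderiv ℝ (f n) z - D z‖ₑ := fun n =>
    ((measurable_fderiv ℝ (f n)).sub hD).enorm
  rw [← ae_restrict_iff' hT]
  filter_upwards [ae_restrict_mem hT, ae_liminf_lintegral_eq_zero (fun n =>
    ((hmeas n).comp hγ).lintegral_prod_right') hlim] with s hs (hliminf :
      liminf (fun n => ∫⁻ t in S, ‖fderiv ℝ (f n) (γ s t) - D (γ s t)‖ₑ) atTop = 0)
  refine isUpperGradientAlong_of_liminf_eq_zero (S := S) (u := fun n t => f n (γ s t))
    (u' := fun n t => fderiv ℝ (f n) (γ s t) v)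
    (g := fun t => ‖D (γ s t)‖ₑ) (hD.comp (hγ.comp measurable_prodMk_left)).enorm
    (fun n t ht => ?_) (fun n => ?_) (fun n t => ?_) (fun t ht => hfF _ (hmem s hs t ht)) hliminf
  · exact ((((hf n).contDiffAt (hU.mem_nhds (hmem s hs t ht))).differentiableAt
      (by simp)).hasFDerivAt).comp_hasDerivAt t (hγv s t)
  · exact (((hf n).continuousOn_fderiv_of_isOpen hU (by simp)).clm_apply continuousOn_const).comp
      (fun t _ => (hγv s t).continuousAt.continuousWithinAt) (hmem s hs)
  · calc ‖fderiv ℝ (f n) (γ s t) v‖ₑ ≤ ‖fderiv ℝ (f n) (γ s t)‖ₑ :=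
          enorm_le_iff_norm_le.2 (ContinuousLinearMap.unit_le_opNorm _ _ hv)
      _ = ‖D (γ s t) + (fderiv ℝ (f n) (γ s t) - D (γ s t))‖ₑ := by rw [add_sub_cancel]
      _ ≤ _ := enorm_add_le (D (γ s t)) _

/-- `ρ` is an upper gradient of `F` along almost every horizontal and almost every vertical segment
of the rectangle `S ×ℂ T`. -/
def IsUpperGradientOnLines (S T : Set ℝ) (F : ℂ → ℂ) (ρ : ℂ → ℝ≥0∞) : Prop :=
  (∀ᵐ y : ℝ, y ∈ T → IsUpperGradientAlong S (fun x => F ⟨x, y⟩) fun x => ρ ⟨x, y⟩) ∧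
  ∀ᵐ x : ℝ, x ∈ S → IsUpperGradientAlong T (fun y => F ⟨x, y⟩) fun y => ρ ⟨x, y⟩

theorem IsUpperGradientOnLines.iUnion {S : ℕ → Set ℝ} {T : Set ℝ} {F : ℂ → ℂ} {ρ : ℂ → ℝ≥0∞}
    (hS : Monotone S) (h : ∀ n, IsUpperGradientOnLines (S n) T F ρ) :
    IsUpperGradientOnLines (⋃ n, S n) T F ρ := by
  constructor
  · filter_upwards [ae_all_iff.2 fun n => (h n).1] with y hy hyT x₁ hx₁ x₂ hx₂
    obtain ⟨i, hi⟩ := mem_iUnion.1 hx₁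
    obtain ⟨j, hj⟩ := mem_iUnion.1 hx₂
    exact hy (max i j) hyT x₁ (hS (le_max_left i j) hi) x₂ (hS (le_max_right i j) hj)
  · filter_upwards [ae_all_iff.2 fun n => (h n).2] with x hx hxS
    obtain ⟨i, hi⟩ := mem_iUnion.1 hxS
    exact hx i hi

theorem tendsto_lintegral_of_tendsto_lintegral_sq {α : Type*} [MeasurableSpace α] {μ : Measure α}
    [IsFiniteMeasure μ] {k : ℕ → α → ℝ≥0∞} (hk : ∀ n, AEMeasurable (k n) μ)
    (h : Tendsto (fun n => ∫⁻ x, k n x ^ 2 ∂μ) atTop (𝓝 0)) :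
    Tendsto (fun n => ∫⁻ x, k n x ∂μ) atTop (𝓝 0) := by
  have hsq := ENNReal.Tendsto.const_mul h (Or.inr (measure_ne_top μ univ))
  rw [mul_zero] at hsq
  exact tendsto_zero_of_tendsto_sq <| tendsto_of_tendsto_of_tendsto_of_le_of_le
    tendsto_const_nhds hsq (fun _ => zero_le) fun n => sq_lintegral_le μ (hk n)

theorem IsStripSobolev.isUpperGradientOnLines {R : ℝ} (hR : 0 < R) {F : ℂ → ℂ}
    {D : ℂ → ℂ →L[ℝ] ℂ} {m : ℤ} (h : IsStripSobolev R F D m) (hD : Measurable D) (c : ℝ) :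
    IsUpperGradientOnLines (Ioo 0 R) (Ioo c (c + 2 * π)) F fun z => ‖D z‖ₑ := by
  obtain ⟨a, hanti, ha, hunion⟩ := exists_antitone_iUnion_Ioo_eq hR
  rw [← hunion]
  refine IsUpperGradientOnLines.iUnion (fun i j hij => Ioo_subset_Ioo (hanti hij)
    (sub_le_sub_left (hanti hij) R)) fun n => ?_
  obtain ⟨f, hf, -, hfF, hlim⟩ := h (a n) (R - a n) (ha n).1 (sub_lt_self R (ha n).1)
  have hmeas : ∀ i, Measurable fun z => ‖fderiv ℝ (f i) z - D z‖ₑ := fun i =>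
    ((measurable_fderiv ℝ (f i)).sub hD).enorm
  have : IsFiniteMeasure (volume.restrict (periodRect (a n) (R - a n) c)) :=
    isFiniteMeasure_restrict.2 ((Metric.isBounded_Ioo _ _).reProdIm
      (Metric.isBounded_Ioo _ _)).measure_lt_top.ne
  have hlim₁ := tendsto_lintegral_of_tendsto_lintegral_sq (fun i => (hmeas i).aemeasurable) (hlim c)
  have hU := isOpen_vertStrip (a n) (R - a n)
  constructor
  · exact ae_isUpperGradientAlong_of_tendsto (S := Ioo (a n) (R - a n))
      (γ := fun y x => ⟨x, y⟩) measurableSet_Ioo hU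
      (measurable_complex_mk.comp measurable_swap) (by simp) (fun y x => hasDerivAt_mk_re x y)
      (fun _ _ _ hx => hx) hf (fun z hz => hfF.tendsto_at hz) hD
      (hlim₁.congr fun i => setLIntegral_reProdIm_symm (hmeas i))
  · exact ae_isUpperGradientAlong_of_tendsto (S := Ioo c (c + 2 * π))
      (γ := fun x y => ⟨x, y⟩) measurableSet_Ioo hU
      measurable_complex_mk (by simp) hasDerivAt_mk_im (fun _ hx _ _ => hx) hf
      (fun z hz => hfF.tendsto_at hz) hD (hlim₁.congr fun i => setLIntegral_reProdIm (hmeas i))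

theorem setLIntegral_comp_affine_le {k : ℝ → ℝ≥0∞} {s t : Set ℝ} (hs : MeasurableSet s) {a b : ℝ}
    (ha : a ≠ 0) (hst : MapsTo (fun x => a * x + b) s t) {E : ℝ}
    (hE : ∫⁻ y in t, k y ≤ ENNReal.ofReal E) :
    ∫⁻ x in s, k (a * x + b) ≤ ENNReal.ofReal (|a|⁻¹ * E) := by
  have hd : ∀ x ∈ s, HasDerivWithinAt (fun x : ℝ => a * x + b) a s x := fun x _ => by
    simpa using (((hasDerivAt_id x).const_mul a).add_const b).hasDerivWithinAt
  have hinj : InjOn (fun x : ℝ => a * x + b) s := fun x _ y _ h =>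
    mul_left_cancel₀ ha (add_right_cancel h)
  have hle : ENNReal.ofReal |a| * ∫⁻ x in s, k (a * x + b) ≤ ENNReal.ofReal E := by
    rw [← lintegral_const_mul' _ _ ENNReal.ofReal_ne_top,
      ← lintegral_image_eq_lintegral_abs_deriv_mul hs hd hinj k]
    exact (lintegral_mono_set hst.image_subset).trans hE
  calc ∫⁻ x in s, k (a * x + b)
      = ENNReal.ofReal |a|⁻¹ * (ENNReal.ofReal |a| * ∫⁻ x in s, k (a * x + b)) := by
        rw [← mul_assoc, ← ENNReal.ofReal_mul (by positivity),
          inv_mul_cancel₀ (abs_ne_zero.2 ha), ENNReal.ofReal_one, one_mul]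
    _ ≤ ENNReal.ofReal |a|⁻¹ * ENNReal.ofReal E := by gcongr
    _ = ENNReal.ofReal (|a|⁻¹ * E) := (ENNReal.ofReal_mul (by positivity)).symm

theorem ae_comp_affine {p : ℝ → Prop} (h : ∀ᵐ y, p y) {a : ℝ} (ha : a ≠ 0) (b : ℝ) :
    ∀ᵐ x, p (a * x + b) := by
  have hadd : ∀ᵐ x : ℝ, p (x + b) := by
    rw [ae_iff] at *
    exact (measure_preimage_add_right volume b _).trans h
  rw [ae_iff] at *
  simpa [hadd] using Real.volume_preimage_mul_left ha {x | ¬p (x + b)}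

theorem setLIntegral_ofReal_const_mul_inv {σ : ℝ} (hσ : 0 < σ) (hσ1 : σ ≤ 1) {q : ℝ} (hq : 0 ≤ q) :
    ∫⁻ s in Ioo σ 1, ENNReal.ofReal (q * s⁻¹) = ENNReal.ofReal (q * Real.log (1 / σ)) := by
  have hinteg : IntervalIntegrable (fun s : ℝ => q * s⁻¹) volume σ 1 :=
    (continuousOn_const.mul (continuousOn_inv₀.mono fun x hx =>
      (hσ.trans_le (uIcc_of_le hσ1 ▸ hx).1).ne')).intervalIntegrable
  have hpos : ∀ᵐ s ∂volume.restrict (Ioo σ 1), 0 ≤ q * s⁻¹ := by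
    filter_upwards [ae_restrict_mem measurableSet_Ioo] with s hs
    exact mul_nonneg hq (inv_nonneg.2 (hσ.trans hs.1).le)
  rw [← ofReal_integral_eq_lintegral_ofReal (hinteg.1.mono_set Ioo_subset_Ioc_self) hpos,
    Measure.restrict_congr_set Ioo_ae_eq_Ioc, ← intervalIntegral.integral_of_le hσ1,
    intervalIntegral.integral_const_mul, integral_inv_of_pos hσ one_pos]

/-- The length–area (Courant–Lebesgue) argument: a family of curves indexed by the scale `s`, whose
lengths `L s` are controlled by energies `w s`, contains a short curve. -/
theorem exists_mem_Ioo_le_of_sq_le_mul {σ ε A : ℝ} (hσ : 0 < σ) (hσ1 : σ ≤ 1) (hε : 0 ≤ ε)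
    {P : ℝ → Prop} {L w : ℝ → ℝ≥0∞} (hP : ∀ᵐ s, s ∈ Ioo σ 1 → P s)
    (hL : ∀ s ∈ Ioo σ 1, L s ^ 2 ≤ ENNReal.ofReal s * w s)
    (hw : ∫⁻ s in Ioo σ 1, w s ≤ ENNReal.ofReal A) (hA : 0 ≤ A)
    (hlog : A < ε ^ 2 * Real.log (1 / σ)) : ∃ s ∈ Ioo σ 1, P s ∧ L s ≤ ENNReal.ofReal ε := by
  by_contra! hlong
  have hle : ∀ᵐ s ∂volume.restrict (Ioo σ 1), ENNReal.ofReal (ε ^ 2 * s⁻¹) ≤ w s := by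
    rw [ae_restrict_iff' measurableSet_Ioo]
    filter_upwards [hP] with s hPs hs
    have hs0 : 0 < s := hσ.trans hs.1
    rw [← div_eq_mul_inv, ENNReal.ofReal_div_of_pos hs0, ENNReal.ofReal_pow hε]
    refine ENNReal.div_le_of_le_mul' (le_trans ?_ (hL s hs))
    gcongr
    exact (hlong s hs (hPs hs)).le
  have := (lintegral_mono_ae hle).trans hw
  rw [setLIntegral_ofReal_const_mul_inv hσ hσ1 (sq_nonneg ε),
    ENNReal.ofReal_le_ofReal_iff hA] at this
  exact hlog.not_ge this

theorem sq_setLIntegral_le_of_subset {α : Type*} [MeasurableSpace α] {μ : Measure α} {s t : Set α}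
    (hst : s ⊆ t) {k : α → ℝ≥0∞} (hk : Measurable k) :
    (∫⁻ x in s, k x ∂μ) ^ 2 ≤ μ s * ∫⁻ x in t, k x ^ 2 ∂μ := by
  calc (∫⁻ x in s, k x ∂μ) ^ 2 ≤ μ s * ∫⁻ x in s, k x ^ 2 ∂μ := by
        simpa using sq_lintegral_le (μ.restrict s) hk.aemeasurable
    _ ≤ μ s * ∫⁻ x in t, k x ^ 2 ∂μ := by gcongr

/-- The box `{re z < R s, |im z - y₀| < π s}`, unbounded to the left. The part of its frontier
inside the strip `{0 < re z < R}` is the crosscut of scale `s` around the height `y₀`. -/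
def crosscutBox (R y₀ s : ℝ) : Set ℂ := Iio (R * s) ×ℂ Ioo (-π * s + y₀) (π * s + y₀)

/-- The `ρ`-length of the crosscut of scale `s`: two horizontal sides and a vertical one. -/
noncomputable def crosscutLength (R y₀ : ℝ) (ρ : ℂ → ℝ≥0∞) (s : ℝ) : ℝ≥0∞ :=
  (∫⁻ x in Ioc 0 (R * s), ρ ⟨x, -π * s + y₀⟩) + ((∫⁻ x in Ioc 0 (R * s), ρ ⟨x, π * s + y₀⟩) +
    ∫⁻ y in Icc (-π * s + y₀) (π * s + y₀), ρ ⟨R * s, y⟩)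

/-- The `ρ`-energy on the three lines which carry the crosscut of scale `s`, weighted by the lengths
of the sides. -/
noncomputable def crosscutEnergy (R y₀ : ℝ) (ρ : ℂ → ℝ≥0∞) (s : ℝ) : ℝ≥0∞ :=
  ENNReal.ofReal R * ((∫⁻ x in Ioo 0 R, ρ ⟨x, -π * s + y₀⟩ ^ 2) +
    ∫⁻ x in Ioo 0 R, ρ ⟨x, π * s + y₀⟩ ^ 2) +
    ENNReal.ofReal (2 * π) * ∫⁻ y in Ioo (y₀ - π) (y₀ + π), ρ ⟨R * s, y⟩ ^ 2

theorem sq_crosscutLength_le {R y₀ : ℝ} (hR : 0 < R) {ρ : ℂ → ℝ≥0∞} (hρ : Measurable ρ) {s : ℝ}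
    (hs : s ∈ Ioo 0 1) :
    crosscutLength R y₀ ρ s ^ 2 ≤ ENNReal.ofReal s * (4 * crosscutEnergy R y₀ ρ s) := by
  have hρx : ∀ y : ℝ, Measurable fun x : ℝ => ρ ⟨x, y⟩ := fun y =>
    hρ.comp (measurable_complex_mk.comp measurable_prodMk_right)
  have hρy : ∀ x : ℝ, Measurable fun y : ℝ => ρ ⟨x, y⟩ := fun x =>
    hρ.comp (measurable_complex_mk.comp measurable_prodMk_left)
  have hhor : ∀ y, (∫⁻ x in Ioc 0 (R * s), ρ ⟨x, y⟩) ^ 2 ≤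
      ENNReal.ofReal s * (ENNReal.ofReal R * ∫⁻ x in Ioo 0 R, ρ ⟨x, y⟩ ^ 2) := fun y => by
    have hsub : Ioc 0 (R * s) ⊆ Ioo 0 R := fun x hx =>
      ⟨hx.1, hx.2.trans_lt (mul_lt_of_lt_one_right hR hs.2)⟩
    refine (sq_setLIntegral_le_of_subset hsub (hρx y)).trans_eq ?_
    rw [Real.volume_Ioc, sub_zero, mul_comm R, ENNReal.ofReal_mul hs.1.le, mul_assoc]
  have hvert : (∫⁻ y in Icc (-π * s + y₀) (π * s + y₀), ρ ⟨R * s, y⟩) ^ 2 ≤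
      ENNReal.ofReal s * (ENNReal.ofReal (2 * π) *
        ∫⁻ y in Ioo (y₀ - π) (y₀ + π), ρ ⟨R * s, y⟩ ^ 2) := by
    have hπs := mul_lt_of_lt_one_right Real.pi_pos hs.2
    have hsub : Icc (-π * s + y₀) (π * s + y₀) ⊆ Ioo (y₀ - π) (y₀ + π) := fun y hy =>
      ⟨by linarith [hy.1], by linarith [hy.2]⟩
    refine (sq_setLIntegral_le_of_subset hsub (hρy _)).trans_eq ?_
    rw [Real.volume_Icc, show π * s + y₀ - (-π * s + y₀) = s * (2 * π) by ring,
      ENNReal.ofReal_mul hs.1.le, mul_assoc]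
  have hsq : ∀ a b c : ℝ≥0∞, (a + (b + c)) ^ 2 ≤ 4 * (a ^ 2 + b ^ 2 + c ^ 2) := fun a b c =>
    calc (a + (b + c)) ^ 2 ≤ 2 * (a ^ 2 + (b + c) ^ 2) := ennreal_add_sq_le a (b + c)
      _ ≤ 2 * (2 * a ^ 2 + 2 * (b ^ 2 + c ^ 2)) := by
        gcongr
        exacts [le_mul_of_one_le_left' one_le_two, ennreal_add_sq_le b c]
      _ = 4 * (a ^ 2 + b ^ 2 + c ^ 2) := by ring
  refine (hsq _ _ _).trans ((mul_le_mul_right (add_le_add (add_le_add (hhor _) (hhor _)) hvert)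
    4).trans_eq ?_)
  rw [crosscutEnergy]
  ring

theorem setLIntegral_crosscutEnergy_le {R E σ y₀ : ℝ} (hR : 0 < R) (hE : 0 ≤ E) (hσ : 0 < σ)
    {ρ : ℂ → ℝ≥0∞} (hρ : Measurable ρ)
    (henergy : ∫⁻ z in Ioo 0 R ×ℂ Ioo (y₀ - π) (y₀ + π), ρ z ^ 2 ≤ ENNReal.ofReal E) :
    ∫⁻ s in Ioo σ 1, 4 * crosscutEnergy R y₀ ρ s ≤ ENNReal.ofReal (8 * (R / π + π / R) * E) := by
  have hπ := Real.pi_pos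
  have hρ2 : Measurable fun z => ρ z ^ 2 := hρ.pow_const 2
  set e : ℝ → ℝ≥0∞ := fun y => ∫⁻ x in Ioo 0 R, ρ ⟨x, y⟩ ^ 2
  set k : ℝ → ℝ≥0∞ := fun x => ∫⁻ y in Ioo (y₀ - π) (y₀ + π), ρ ⟨x, y⟩ ^ 2
  have hem : Measurable e := (hρ2.comp measurable_complex_mk).lintegral_prod_left'
  have he : ∀ a : ℝ, |a| = π → ∫⁻ s in Ioo σ 1, e (a * s + y₀) ≤ ENNReal.ofReal (π⁻¹ * E) := by
    intro a ha
    have hmaps : MapsTo (fun s => a * s + y₀) (Ioo σ 1) (Ioo (y₀ - π) (y₀ + π)) := fun s hs => by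
      have habs : |a * s| < π := by
        rw [abs_mul, ha, abs_of_pos (hσ.trans hs.1)]
        exact mul_lt_of_lt_one_right hπ hs.2
      constructor <;> linarith [abs_lt.1 habs]
    exact ha ▸ setLIntegral_comp_affine_le measurableSet_Ioo (abs_pos.1 (ha ▸ hπ)) hmaps
      ((setLIntegral_reProdIm_symm hρ2).ge.trans henergy)
  have hk : ∫⁻ s in Ioo σ 1, k (R * s) ≤ ENNReal.ofReal (R⁻¹ * E) := by
    have hmaps : MapsTo (fun s => R * s + 0) (Ioo σ 1) (Ioo 0 R) := fun s hs => by
      simp only [add_zero]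
      exact ⟨mul_pos hR (hσ.trans hs.1), mul_lt_of_lt_one_right hR hs.2⟩
    simpa only [add_zero, abs_of_pos hR] using setLIntegral_comp_affine_le (k := k)
      measurableSet_Ioo hR.ne' hmaps ((setLIntegral_reProdIm hρ2).ge.trans henergy)
  have hm : ∀ a : ℝ, Measurable fun s => e (a * s + y₀) := fun a => hem.comp (by fun_prop)
  have hm' : Measurable fun s => ENNReal.ofReal R * (e (-π * s + y₀) + e (π * s + y₀)) :=
    ((hm _).add (hm _)).const_mul _
  change ∫⁻ s in Ioo σ 1, 4 * (ENNReal.ofReal R * (e (-π * s + y₀) + e (π * s + y₀)) +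
    ENNReal.ofReal (2 * π) * k (R * s)) ≤ _
  rw [lintegral_const_mul' _ _ (by simp), lintegral_add_left hm',
    lintegral_const_mul' _ _ ENNReal.ofReal_ne_top, lintegral_add_left (hm _),
    lintegral_const_mul' _ _ ENNReal.ofReal_ne_top]
  refine (mul_le_mul_right (add_le_add (mul_le_mul_right (add_le_add (he _ (by simp [hπ.le]))
    (he _ (abs_of_pos hπ))) _) (mul_le_mul_right hk _)) 4).trans_eq ?_
  rw [← ENNReal.ofReal_add (by positivity) (by positivity), ← ENNReal.ofReal_mul hR.le,
    ← ENNReal.ofReal_mul (by positivity), ← ENNReal.ofReal_add (by positivity) (by positivity),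
    ← ENNReal.ofReal_ofNat 4, ← ENNReal.ofReal_mul (by norm_num)]
  congr 1
  ring

theorem inter_frontier_nonempty_of_isPreconnected {X : Type*} [TopologicalSpace X] {s U : Set X}
    (hs : IsPreconnected s) (hU : IsOpen U) (hsU : (s ∩ U).Nonempty) (hsU' : ¬s ⊆ U) :
    (s ∩ frontier U).Nonempty := by
  by_contra! hempty
  refine hsU' (hs.subset_left_of_subset_union hU isClosed_closure.isOpen_compl
    (disjoint_compl_right.mono_left subset_closure) (fun x hx => ?_) hsU)
  by_contra! hx'
  rw [mem_union, not_or, mem_compl_iff, not_not] at hx'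
  exact hempty.subset ⟨hx, hx'.2, fun hinteg => hx'.1 (interior_subset hinteg)⟩

/-- Otherwise the preimage of the part `{im w ∈ J}` of the image strip, which is connected and
reaches the right end, would join `z` to points outside `U` without meeting the frontier of `U`. -/
theorem IsStripHomeo.im_map_notMem_of_frontier {R R' : ℝ} {Φ : OpenPartialHomeomorph ℂ ℂ} {m : ℤ}
    (h : IsStripHomeo R R' Φ m) (hR : 0 < R) (hR' : 0 < R') (hends : PreservesEnds R R' Φ)
    {U : Set ℂ} (hU : IsOpen U) {b : ℝ} (hb : b < R) (hUb : ∀ z ∈ U, z.re ≤ b) {J : Set ℝ}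
    (hJ : Convex ℝ J) (hfr : ∀ z ∈ vertStrip 0 R, z ∈ frontier U → (Φ z).im ∉ J) {z : ℂ}
    (hz : z ∈ vertStrip 0 R) (hzU : z ∈ U) : (Φ z).im ∉ J := by
  intro hzJ
  set H : Set ℂ := vertStrip 0 R' ∩ Complex.imLm ⁻¹' J
  have hH : IsPreconnected (Φ.symm '' H) :=
    ((convex_vertStrip 0 R').inter (hJ.linear_preimage Complex.imLm)).isPreconnected.image _
      (h.symm.continuousOn.mono inter_subset_left)
  obtain ⟨d, hd, hdb⟩ := ((hasBasis_rightEnd R').tendsto_iff (hasBasis_rightEnd R)).1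
    (h.preservesEnds_symm hR hR' hends).right b hb
  obtain ⟨t, ht, htR'⟩ := exists_between (max_lt hd hR')
  have hfar : Φ.symm ⟨t, (Φ z).im⟩ ∉ U := fun hmem =>
    (hUb _ hmem).not_gt (hdb _ ⟨(le_max_left d 0).trans_lt ht, htR'⟩).1
  obtain ⟨_, ⟨w, hw, rfl⟩, hwU⟩ := inter_frontier_nonempty_of_isPreconnected hH hU
    ⟨z, ⟨Φ z, ⟨h.mapsTo hz, hzJ⟩, h.leftInvOn hz⟩, hzU⟩
    fun hsub => hfar (hsub (mem_image_of_mem _ ⟨⟨(le_max_right d 0).trans_lt ht, htR'⟩, hzJ⟩))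
  refine hfr _ (h.symm.mapsTo hw.1) hwU ?_
  rw [h.rightInvOn hw.1]
  exact hw.2

/-- A homeomorphism of strips which respects their ends and has an upper gradient whose
square has integral at most `E` over every period. -/
structure IsFiniteEnergyStripMap (R R' E : ℝ) (Φ : OpenPartialHomeomorph ℂ ℂ) (ρ : ℂ → ℝ≥0∞) :
    Prop where
  homeo : ∃ m, IsStripHomeo R R' Φ m
  ends : PreservesEnds R R' Φ
  measurable : Measurable ρ
  upperGradient : ∀ c, IsUpperGradientOnLines (Ioo 0 R) (Ioo c (c + 2 * π)) Φ ρ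
  energy : ∀ c, ∫⁻ z in periodRect 0 R c, ρ z ^ 2 ≤ ENNReal.ofReal E

theorem frontier_crosscutBox {R y₀ s : ℝ} (hs : 0 < s) : frontier (crosscutBox R y₀ s) =
    Iic (R * s) ×ℂ {-π * s + y₀, π * s + y₀} ∪ {R * s} ×ℂ Icc (-π * s + y₀) (π * s + y₀) := by
  have hlt : -π * s + y₀ < π * s + y₀ := by nlinarith [mul_pos Real.pi_pos hs]
  rw [crosscutBox, Complex.frontier_reProdIm, frontier_Iio, frontier_Ioo hlt, closure_Iio,
    closure_Ioo hlt.ne]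

theorem enorm_sub_le_crosscutLength {R y₀ s : ℝ} (hR : 0 < R) (hs : s ∈ Ioo 0 1) {F : ℂ → ℂ}
    {ρ : ℂ → ℝ≥0∞}
    (hbot : IsUpperGradientAlong (Ioo 0 R) (fun x => F ⟨x, -π * s + y₀⟩)
      fun x => ρ ⟨x, -π * s + y₀⟩)
    (htop : IsUpperGradientAlong (Ioo 0 R) (fun x => F ⟨x, π * s + y₀⟩) fun x => ρ ⟨x, π * s + y₀⟩)
    (hvert : IsUpperGradientAlong (Ioo (y₀ - π) (y₀ + π)) (fun y => F ⟨R * s, y⟩)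
      fun y => ρ ⟨R * s, y⟩) {z : ℂ} (hz : z ∈ vertStrip 0 R)
    (hzs : z ∈ frontier (crosscutBox R y₀ s)) :
    ‖F z - F ⟨R * s, -π * s + y₀⟩‖ₑ ≤ crosscutLength R y₀ ρ s := by
  have hRs : R * s ∈ Ioo 0 R := ⟨mul_pos hR hs.1, mul_lt_of_lt_one_right hR hs.2⟩
  have hπs : 0 < π * s := mul_pos Real.pi_pos hs.1
  have hπs1 : π * s < π := mul_lt_of_lt_one_right Real.pi_pos hs.2
  have hside : ∀ y, IsUpperGradientAlong (Ioo 0 R) (fun x => F ⟨x, y⟩) (fun x => ρ ⟨x, y⟩) →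
      ∀ x ∈ Ioc 0 (R * s), ‖F ⟨x, y⟩ - F ⟨R * s, y⟩‖ₑ ≤ ∫⁻ t in Ioc 0 (R * s), ρ ⟨t, y⟩ :=
    fun y hy x hx => by
      rw [← enorm_neg, neg_sub]
      exact (hy x ⟨hx.1, hx.2.trans_lt hRs.2⟩ _ hRs hx.2).trans
        (lintegral_mono_set fun t ht => ⟨hx.1.trans_le ht.1, ht.2⟩)
  have hright : ∀ y ∈ Icc (-π * s + y₀) (π * s + y₀), ‖F ⟨R * s, y⟩ - F ⟨R * s, -π * s + y₀⟩‖ₑ ≤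
      ∫⁻ t in Icc (-π * s + y₀) (π * s + y₀), ρ ⟨R * s, t⟩ := fun y hy =>
    (hvert _ ⟨by linarith, by linarith⟩ _ ⟨by linarith [hy.1], by linarith [hy.2]⟩ hy.1).trans
      (lintegral_mono_set (Icc_subset_Icc le_rfl hy.2))
  rw [frontier_crosscutBox hs.1] at hzs
  obtain ⟨x, y⟩ := z
  rcases hzs with ⟨hx, rfl | rfl⟩ | ⟨rfl, hy⟩
  · exact (hside _ hbot x ⟨hz.1, hx⟩).trans le_self_add
  · calc ‖F ⟨x, π * s + y₀⟩ - F ⟨R * s, -π * s + y₀⟩‖ₑ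
        ≤ ‖F ⟨x, π * s + y₀⟩ - F ⟨R * s, π * s + y₀⟩‖ₑ +
          ‖F ⟨R * s, π * s + y₀⟩ - F ⟨R * s, -π * s + y₀⟩‖ₑ := by
          simpa only [edist_eq_enorm_sub] using edist_triangle (F ⟨x, π * s + y₀⟩) _ _
      _ ≤ _ := add_le_add (hside _ htop x ⟨hz.1, hx⟩) (hright _ ⟨by linarith, le_rfl⟩)
      _ ≤ crosscutLength R y₀ ρ s := le_add_self
  · exact (hright y hy).trans (le_add_self.trans le_add_self)

namespace IsFiniteEnergyStripMap

variable {R R' E : ℝ} {Φ : OpenPartialHomeomorph ℂ ℂ} {ρ : ℂ → ℝ≥0∞}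

theorem exists_small_crosscut (h : IsFiniteEnergyStripMap R R' E Φ ρ) (hR : 0 < R) (hE : 0 ≤ E)
    {σ ε : ℝ} (hσ : 0 < σ) (hσ1 : σ ≤ 1) (hε : 0 ≤ ε)
    (hlog : 8 * (R / π + π / R) * E < ε ^ 2 * Real.log (1 / σ)) (y₀ : ℝ) :
    ∃ s ∈ Ioo σ 1, ∃ p, ∀ z ∈ vertStrip 0 R, z ∈ frontier (crosscutBox R y₀ s) →
      ‖Φ z - p‖ ≤ ε := by
  have hπ := Real.pi_pos
  have hperiod : y₀ - π + 2 * π = y₀ + π := by ring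
  have hF := h.upperGradient (y₀ - π)
  have henergy := h.energy (y₀ - π)
  rw [periodRect] at henergy
  rw [hperiod] at hF henergy
  have hgood : ∀ᵐ s : ℝ, s ∈ Ioo σ 1 →
      IsUpperGradientAlong (Ioo 0 R) (fun x => Φ ⟨x, -π * s + y₀⟩) (fun x => ρ ⟨x, -π * s + y₀⟩) ∧
      IsUpperGradientAlong (Ioo 0 R) (fun x => Φ ⟨x, π * s + y₀⟩) (fun x => ρ ⟨x, π * s + y₀⟩) ∧
      IsUpperGradientAlong (Ioo (y₀ - π) (y₀ + π)) (fun y => Φ ⟨R * s, y⟩)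
        (fun y => ρ ⟨R * s, y⟩) := by
    filter_upwards [ae_comp_affine hF.1 (neg_ne_zero.2 hπ.ne') y₀, ae_comp_affine hF.1 hπ.ne' y₀,
      ae_comp_affine hF.2 hR.ne' 0] with s hbot htop hvert hs
    have hs0 : 0 < s := hσ.trans hs.1
    have hπs : 0 < π * s := mul_pos hπ hs0
    have hπs1 : π * s < π := mul_lt_of_lt_one_right hπ hs.2
    rw [add_zero] at hvert
    exact ⟨hbot ⟨by linarith, by linarith⟩, htop ⟨by linarith, by linarith⟩,
      hvert ⟨mul_pos hR hs0, mul_lt_of_lt_one_right hR hs.2⟩⟩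
  obtain ⟨s, hs, ⟨hbot, htop, hvert⟩, hle⟩ := exists_mem_Ioo_le_of_sq_le_mul hσ hσ1 hε hgood
    (fun s hs => sq_crosscutLength_le hR h.measurable ⟨hσ.trans hs.1, hs.2⟩)
    (setLIntegral_crosscutEnergy_le hR hE hσ h.measurable henergy) (by positivity) hlog
  refine ⟨s, hs, Φ ⟨R * s, -π * s + y₀⟩, fun z hz hzs => ?_⟩
  have := (enorm_sub_le_crosscutLength hR ⟨hσ.trans hs.1, hs.2⟩ hbot htop hvert hz hzs).trans hle
  rwa [← ofReal_norm, ENNReal.ofReal_le_ofReal_iff hε] at this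

theorem exists_abs_im_sub_le (h : IsFiniteEnergyStripMap R R' E Φ ρ) (hR : 0 < R) (hR' : 0 < R')
    (hE : 0 ≤ E) {σ ε : ℝ} (hσ : 0 < σ) (hσ1 : σ ≤ 1) (hε : 0 ≤ ε)
    (hlog : 8 * (R / π + π / R) * E < ε ^ 2 * Real.log (1 / σ)) (y₀ : ℝ) :
    ∃ v, ∀ z ∈ vertStrip 0 R, z ∈ crosscutBox R y₀ σ → |(Φ z).im - v| ≤ ε := by
  obtain ⟨s, hs, p, hp⟩ := h.exists_small_crosscut hR hE hσ hσ1 hε hlog y₀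
  obtain ⟨m, hm⟩ := h.homeo
  have hpim : ∀ z ∈ vertStrip 0 R, z ∈ frontier (crosscutBox R y₀ s) → |(Φ z).im - p.im| ≤ ε :=
    fun z hz hzs => (Complex.abs_im_le_norm (Φ z - p)).trans (hp z hz hzs)
  have hmem : ∀ J : Set ℝ, Convex ℝ J → (∀ y, |y - p.im| ≤ ε → y ∉ J) →
      ∀ z ∈ vertStrip 0 R, z ∈ crosscutBox R y₀ s → (Φ z).im ∉ J := fun J hJ hyJ z hz hzs =>
    hm.im_map_notMem_of_frontier hR hR' h.ends (isOpen_Iio.reProdIm isOpen_Ioo)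
      (mul_lt_of_lt_one_right hR hs.2) (fun w hw => hw.1.le) hJ
      (fun w hw hws => hyJ _ (hpim w hw hws)) hz hzs
  have hsub : crosscutBox R y₀ σ ⊆ crosscutBox R y₀ s := by
    have hRσ := mul_lt_mul_of_pos_left hs.1 hR
    have hπσ := mul_lt_mul_of_pos_left hs.1 Real.pi_pos
    exact fun z hz => ⟨hz.1.trans hRσ, by linarith [hz.2.1], by linarith [hz.2.2]⟩
  refine ⟨p.im, fun z hz hzσ => abs_le.2 ⟨?_, ?_⟩⟩
  · have := hmem (Iio (p.im - ε)) (convex_Iio _)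
      (fun y hy => notMem_Iio.2 (by linarith [(abs_le.1 hy).1])) z hz (hsub hzσ)
    linarith [notMem_Iio.1 this]
  · have := hmem (Ioi (p.im + ε)) (convex_Ioi _)
      (fun y hy => notMem_Ioi.2 (by linarith [(abs_le.1 hy).2])) z hz (hsub hzσ)
    linarith [notMem_Ioi.1 this]

end IsFiniteEnergyStripMap

theorem exists_tendsto_of_forall_eventually_dist_le {α X : Type*} [PseudoMetricSpace X]
    [CompleteSpace X] {l : Filter α} [l.NeBot] {u : α → X}
    (h : ∀ ε > 0, ∃ v, ∀ᶠ x in l, dist (u x) v ≤ ε) : ∃ v, Tendsto u l (𝓝 v) := by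
  refine cauchy_map_iff_exists_tendsto.1 (Metric.cauchy_iff.2 ⟨inferInstance, fun ε hε => ?_⟩)
  obtain ⟨v, hv⟩ := h (ε / 3) (by positivity)
  refine ⟨_, image_mem_map hv, ?_⟩
  rintro _ ⟨x, (hx : dist (u x) v ≤ ε / 3), rfl⟩ _ ⟨y, (hy : dist (u y) v ≤ ε / 3), rfl⟩
  linarith [dist_triangle_right (u x) (u y) v]

theorem nhdsWithin_vertStrip_neBot {R : ℝ} (hR : 0 < R) {z₀ : ℂ} (hz₀ : z₀.re ∈ Icc 0 R) :
    (𝓝[vertStrip 0 R] z₀).NeBot := by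
  rwa [← mem_closure_iff_nhdsWithin_neBot, vertStrip, Complex.closure_preimage_re,
    closure_Ioo hR.ne]

theorem nhdsWithin_vertStrip_le_leftEnd {R : ℝ} {z₀ : ℂ} (hz₀ : z₀.re = 0) :
    𝓝[vertStrip 0 R] z₀ ≤ leftEnd := by
  refine tendsto_iff_comap.1 (tendsto_nhdsWithin_iff.2 ⟨?_, ?_⟩)
  · exact hz₀ ▸ Complex.continuous_re.continuousAt.mono_left nhdsWithin_le_nhds
  · filter_upwards [self_mem_nhdsWithin] with z hz using hz.1

theorem crosscutBox_mem_nhds {R s : ℝ} (hs : 0 < s) {z₀ : ℂ} (hz₀ : z₀.re < R * s) :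
    crosscutBox R z₀.im s ∈ 𝓝 z₀ := by
  have hπs := mul_pos Real.pi_pos hs
  exact (isOpen_Iio.reProdIm isOpen_Ioo).mem_nhds ⟨hz₀, by linarith, by linarith⟩

theorem tendsto_const_sub_nhdsWithin_vertStrip (R : ℝ) (z₀ : ℂ) :
    Tendsto (fun z => (R : ℂ) - z) (𝓝[vertStrip 0 R] z₀) (𝓝[vertStrip 0 R] (R - z₀)) :=
  tendsto_nhdsWithin_iff.2 ⟨((continuous_const.sub continuous_id).tendsto z₀).mono_left
    nhdsWithin_le_nhds, by
      filter_upwards [self_mem_nhdsWithin] with z hz using sub_mem_vertStrip.2 hz⟩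

theorem IsUpperGradientAlong.const_sub_comp_const_sub {E : Type*} [NormedAddCommGroup E]
    {S : Set ℝ} {w : ℝ → E} {g : ℝ → ℝ≥0∞} (h : IsUpperGradientAlong S w g) (p : E) (c : ℝ) :
    IsUpperGradientAlong ((c - ·) ⁻¹' S) (fun t => p - w (c - t)) fun t => g (c - t) := by
  intro a ha b hb hab
  have hinteg : ∫⁻ t in Icc a b, g (c - t) = ∫⁻ t in Icc (c - b) (c - a), g t := by
    rw [← (Measure.measurePreserving_sub_left volume c).setLIntegral_comp_preimage_emb
      (measurableEmbedding_subLeft c), preimage_const_sub_Icc]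
    simp only [sub_sub_cancel]
  simp only [hinteg, sub_sub_sub_cancel_left]
  exact h _ hb _ ha (sub_le_sub_left hab c)

theorem IsUpperGradientOnLines.const_sub_comp_const_sub {S T : Set ℝ} {F : ℂ → ℂ} {ρ : ℂ → ℝ≥0∞}
    (h : IsUpperGradientOnLines S T F ρ) (p : ℂ) (c : ℝ) :
    IsUpperGradientOnLines ((c - ·) ⁻¹' S) ((0 - ·) ⁻¹' T) (fun z => p - F (c - z))
      fun z => ρ (c - z) := by
  have hmk : ∀ x y : ℝ, (c : ℂ) - ⟨x, y⟩ = ⟨c - x, 0 - y⟩ := fun x y =>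
    Complex.ext (by simp) (by simp)
  simp only [IsUpperGradientOnLines, hmk]
  constructor
  · filter_upwards [ae_comp_affine h.1 (neg_ne_zero.2 one_ne_zero) 0] with y hy hyT
    rw [neg_one_mul, neg_add_eq_sub] at hy
    exact (hy hyT).const_sub_comp_const_sub p c
  · filter_upwards [ae_comp_affine h.2 (neg_ne_zero.2 one_ne_zero) c] with x hx hxS
    rw [neg_one_mul, neg_add_eq_sub] at hx
    exact (hx hxS).const_sub_comp_const_sub p 0

namespace IsFiniteEnergyStripMap

variable {R R' E : ℝ} {Φ : OpenPartialHomeomorph ℂ ℂ} {ρ : ℂ → ℝ≥0∞}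

theorem mono (h : IsFiniteEnergyStripMap R R' E Φ ρ) {E' : ℝ} (hE : E ≤ E') :
    IsFiniteEnergyStripMap R R' E' Φ ρ :=
  { h with energy := fun c => (h.energy c).trans (ENNReal.ofReal_le_ofReal hE) }

theorem const_sub_comp_const_sub (h : IsFiniteEnergyStripMap R R' E Φ ρ) :
    IsFiniteEnergyStripMap R R' E (((Homeomorph.subLeft (R : ℂ)).transOpenPartialHomeomorph
      Φ).transHomeomorph (Homeomorph.subLeft (R' : ℂ))) fun z => ρ (R - z) where
  homeo := h.homeo.imp' _ fun _ hm => hm.comp_const_sub.const_sub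
  ends := h.ends.const_sub_comp_const_sub
  measurable := h.measurable.comp (by fun_prop)
  upperGradient c := by
    have := (h.upperGradient (-c - 2 * π)).const_sub_comp_const_sub R' R
    rw [preimage_const_sub_Ioo, preimage_const_sub_Ioo] at this
    have hbot : 0 - (-c - 2 * π + 2 * π) = c := by ring
    have htop : 0 - (-c - 2 * π) = c + 2 * π := by ring
    rwa [sub_self, sub_zero, hbot, htop] at this
  energy c := by
    have hpre : periodRect 0 R c = (fun z => (R : ℂ) - z) ⁻¹' periodRect 0 R (-c - 2 * π) := by
      ext z
      simp only [periodRect, Complex.mem_reProdIm, mem_preimage, mem_Ioo, Complex.sub_re,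
        Complex.sub_im, Complex.ofReal_re, Complex.ofReal_im]
      constructor <;> rintro ⟨⟨_, _⟩, _, _⟩ <;> refine ⟨⟨?_, ?_⟩, ?_, ?_⟩ <;> linarith
    rw [hpre, (Measure.measurePreserving_sub_left volume (R : ℂ)).setLIntegral_comp_preimage_emb
      (measurableEmbedding_subLeft _) fun z => ρ z ^ 2]
    exact h.energy _

theorem ofReal_le_lintegral (h : IsFiniteEnergyStripMap R R' E Φ ρ) (hR : 0 < R) {y : ℝ}
    (hy : IsUpperGradientAlong (Ioo 0 R) (fun x => Φ ⟨x, y⟩) fun x => ρ ⟨x, y⟩) :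
    ENNReal.ofReal R' ≤ ∫⁻ x in Ioo 0 R, ρ ⟨x, y⟩ := by
  refine ENNReal.le_of_forall_pos_le_add fun ε hε _ => ?_
  have hε2 : (0 : ℝ) < ε / 2 := by positivity
  obtain ⟨a, ha, hFa⟩ := h.ends.exists_re_map_le (half_pos hR) hε2
  obtain ⟨b, hb, hFb⟩ := h.ends.exists_le_re_map (half_lt_self hR) (sub_lt_self R' hε2)
  have hab : a ≤ b := ha.2.trans hb.1
  have hlen : R' - ε ≤ ‖Φ ⟨b, y⟩ - Φ ⟨a, y⟩‖ := by
    refine le_trans ?_ (Complex.re_le_norm _)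
    rw [Complex.sub_re]
    linarith [hFa ⟨a, y⟩ rfl, hFb ⟨b, y⟩ rfl]
  calc ENNReal.ofReal R' ≤ ENNReal.ofReal (‖Φ ⟨b, y⟩ - Φ ⟨a, y⟩‖ + ε) :=
        ENNReal.ofReal_le_ofReal (sub_le_iff_le_add.1 hlen)
    _ = ‖Φ ⟨b, y⟩ - Φ ⟨a, y⟩‖ₑ + ε := by
        rw [ENNReal.ofReal_add (norm_nonneg _) ε.coe_nonneg, ofReal_norm,
          ENNReal.ofReal_coe_nnreal]
    _ ≤ (∫⁻ x in Ioo 0 R, ρ ⟨x, y⟩) + ε := by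
        gcongr
        exact (hy a ⟨ha.1, hab.trans_lt hb.2⟩ b ⟨ha.1.trans_le hab, hb.2⟩ hab).trans
          (lintegral_mono_set fun x hx => ⟨ha.1.trans_le hx.1, hx.2.trans_lt hb.2⟩)

theorem two_pi_mul_sq_le (h : IsFiniteEnergyStripMap R R' E Φ ρ) (hR : 0 < R) (hR' : 0 ≤ R')
    (hE : 0 ≤ E) : 2 * π * R' ^ 2 ≤ R * E := by
  have hline : ∀ᵐ y ∂volume.restrict (Ioo 0 (0 + 2 * π)),
      ENNReal.ofReal (R' ^ 2) ≤ ENNReal.ofReal R * ∫⁻ x in Ioo 0 R, ρ ⟨x, y⟩ ^ 2 := by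
    rw [ae_restrict_iff' measurableSet_Ioo]
    filter_upwards [(h.upperGradient 0).1] with y hy hyT
    calc ENNReal.ofReal (R' ^ 2) = ENNReal.ofReal R' ^ 2 := ENNReal.ofReal_pow hR' 2
      _ ≤ (∫⁻ x in Ioo 0 R, ρ ⟨x, y⟩) ^ 2 := by
        gcongr
        exact h.ofReal_le_lintegral hR (hy hyT)
      _ ≤ volume (Ioo 0 R) * ∫⁻ x in Ioo 0 R, ρ ⟨x, y⟩ ^ 2 :=
        sq_setLIntegral_le_of_subset subset_rfl
          (h.measurable.comp (measurable_complex_mk.comp measurable_prodMk_right))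
      _ = _ := by rw [Real.volume_Ioo, sub_zero]
  rw [← ENNReal.ofReal_le_ofReal_iff (mul_nonneg hR.le hE)]
  calc ENNReal.ofReal (2 * π * R' ^ 2)
      = ∫⁻ _ in Ioo 0 (0 + 2 * π), ENNReal.ofReal (R' ^ 2) := by
        rw [setLIntegral_const, Real.volume_Ioo, mul_comm (2 * π), zero_add, sub_zero,
          ENNReal.ofReal_mul (sq_nonneg _)]
    _ ≤ ∫⁻ y in Ioo 0 (0 + 2 * π), ENNReal.ofReal R * ∫⁻ x in Ioo 0 R, ρ ⟨x, y⟩ ^ 2 :=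
        lintegral_mono_ae hline
    _ = ENNReal.ofReal R * ∫⁻ z in periodRect 0 R 0, ρ z ^ 2 := by
        rw [lintegral_const_mul' _ _ ENNReal.ofReal_ne_top, periodRect,
          setLIntegral_reProdIm_symm (h.measurable.pow_const 2)]
    _ ≤ ENNReal.ofReal R * ENNReal.ofReal E := by
        gcongr
        exact h.energy 0
    _ = ENNReal.ofReal (R * E) := (ENNReal.ofReal_mul hR.le).symm

theorem exists_tendsto_of_re_eq_zero (h : IsFiniteEnergyStripMap R R' E Φ ρ) (hR : 0 < R)
    (hR' : 0 < R') (hE : 0 ≤ E) {z₀ : ℂ} (hz₀ : z₀.re = 0) :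
    ∃ L, Tendsto Φ (𝓝[vertStrip 0 R] z₀) (𝓝 L) := by
  have := nhdsWithin_vertStrip_neBot hR (z₀ := z₀) ⟨hz₀.ge, hz₀.trans_le hR.le⟩
  have hre : Tendsto (fun z => (Φ z).re) (𝓝[vertStrip 0 R] z₀) (𝓝 0) :=
    ((tendsto_comap.comp h.ends.left).mono_left (nhdsWithin_vertStrip_le_leftEnd hz₀)).mono_right
      nhdsWithin_le_nhds
  obtain ⟨v, hv⟩ : ∃ v, Tendsto (fun z => (Φ z).im) (𝓝[vertStrip 0 R] z₀) (𝓝 v) := by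
    refine exists_tendsto_of_forall_eventually_dist_le fun ε hε => ?_
    set B := 8 * (R / π + π / R) * E
    have hB : 0 ≤ B := by positivity
    set T := B / ε ^ 2 + 1
    have hlog : B < ε ^ 2 * Real.log (1 / Real.exp (-T)) := by
      rw [one_div, ← Real.exp_neg, neg_neg, Real.log_exp]
      calc B < B + ε ^ 2 := lt_add_of_pos_right _ (by positivity)
        _ = ε ^ 2 * T := by simp only [T]; field_simp
    have hT : Real.exp (-T) ≤ 1 := Real.exp_le_one_iff.2 (neg_nonpos.2 (by positivity))
    obtain ⟨v, hv⟩ := h.exists_abs_im_sub_le hR hR' hE (Real.exp_pos _) hT hε.le hlog z₀.im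
    have hbox := crosscutBox_mem_nhds (Real.exp_pos (-T)) (R := R) (z₀ := z₀)
      (by rw [hz₀]; positivity)
    refine ⟨v, ?_⟩
    filter_upwards [self_mem_nhdsWithin, nhdsWithin_le_nhds hbox] with z hz hzbox
      using hv z hz hzbox
  exact ⟨_, ((Complex.continuous_ofReal.tendsto 0).comp hre).add
    (((Complex.continuous_ofReal.tendsto v).comp hv).mul_const I) |>.congr fun z =>
      Complex.re_add_im (Φ z)⟩

theorem exists_tendsto (h : IsFiniteEnergyStripMap R R' E Φ ρ) (hR : 0 < R) (hR' : 0 < R')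
    (hE : 0 ≤ E) {z₀ : ℂ} (hz₀ : z₀.re ∈ Icc 0 R) :
    ∃ L, Tendsto Φ (𝓝[vertStrip 0 R] z₀) (𝓝 L) := by
  obtain h₀ | h₀ := hz₀.1.eq_or_lt
  · exact h.exists_tendsto_of_re_eq_zero hR hR' hE h₀.symm
  obtain h₁ | h₁ := hz₀.2.eq_or_lt
  · obtain ⟨L, hL⟩ := h.const_sub_comp_const_sub.exists_tendsto_of_re_eq_zero hR hR' hE
      (z₀ := R - z₀) (by simp [h₁])
    refine ⟨R' - L, ((tendsto_const_nhds (x := (R' : ℂ))).sub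
      (hL.comp (tendsto_const_sub_nhdsWithin_vertStrip R z₀))).congr fun z => ?_⟩
    simp
  · obtain ⟨m, hm⟩ := h.homeo
    exact ⟨Φ z₀, hm.continuousOn z₀ ⟨h₀, h₁⟩⟩

theorem abs_im_sub_im_half_le (h : IsFiniteEnergyStripMap R R' E Φ ρ) (hR : 0 < R) (hR' : 0 < R')
    (hE : 0 ≤ E) {ε : ℝ} (hε : 0 ≤ ε) (hεE : 16 * (R / π + π / R) * E < ε ^ 2) {L : ℂ}
    (hL : Tendsto Φ (𝓝[vertStrip 0 R] 0) (𝓝 L)) : |L.im - (Φ (R / 2 : ℝ)).im| ≤ 2 * ε := by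
  -- The scale `σ = exp (-1/2)` exceeds `1/2`, so that its box contains the midpoint `R / 2`.
  set σ := Real.exp (-(1 / 2))
  have hσ : 1 / 2 < σ := by linarith [Real.add_one_lt_exp (x := -(1 / 2)) (by norm_num)]
  have hσ1 : σ ≤ 1 := Real.exp_le_one_iff.2 (by norm_num)
  have hlog : 8 * (R / π + π / R) * E < ε ^ 2 * Real.log (1 / σ) := by
    rw [one_div σ, Real.log_inv, Real.log_exp]
    linarith
  have hσ0 : 0 < σ := Real.exp_pos _
  obtain ⟨v, hv⟩ := h.exists_abs_im_sub_le hR hR' hE hσ0 hσ1 hε hlog 0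
  have hmid : |(Φ (R / 2 : ℝ)).im - v| ≤ ε := by
    have hπσ := mul_pos Real.pi_pos hσ0
    have hRσ : R / 2 < R * σ := by nlinarith
    refine hv _ ⟨?_, ?_⟩ ⟨?_, ?_, ?_⟩
    · exact half_pos hR
    · exact half_lt_self hR
    · exact hRσ
    · rw [Complex.ofReal_im]; linarith
    · rw [Complex.ofReal_im]; linarith
  have := nhdsWithin_vertStrip_neBot hR (z₀ := 0) ⟨le_rfl, hR.le⟩
  have hlim : |L.im - v| ≤ ε := by
    refine le_of_tendsto (((Complex.continuous_im.tendsto L).comp hL).sub_const v).abs ?_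
    have hbox := crosscutBox_mem_nhds hσ0 (R := R) (z₀ := 0) (mul_pos hR hσ0)
    filter_upwards [self_mem_nhdsWithin, nhdsWithin_le_nhds hbox] with z hz hzbox
      using hv z hz hzbox
  rw [abs_sub_comm] at hmid
  linarith [abs_sub_le L.im v (Φ (R / 2 : ℝ)).im]

theorem abs_im_sub_im_le (h : IsFiniteEnergyStripMap R R' E Φ ρ) (hR : 0 < R) (hR' : 0 < R')
    (hE : 0 ≤ E) {ε : ℝ} (hε : 0 ≤ ε) (hεE : 16 * (R / π + π / R) * E < ε ^ 2) {L₀ L₁ : ℂ}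
    (h₀ : Tendsto Φ (𝓝[vertStrip 0 R] 0) (𝓝 L₀))
    (h₁ : Tendsto Φ (𝓝[vertStrip 0 R] (R : ℂ)) (𝓝 L₁)) : |L₁.im - L₀.im| ≤ 4 * ε := by
  have hrefl : Tendsto (fun z => R' - Φ (R - z)) (𝓝[vertStrip 0 R] 0) (𝓝 (R' - L₁)) := by
    have := tendsto_const_sub_nhdsWithin_vertStrip R 0
    rw [sub_zero] at this
    exact tendsto_const_nhds.sub (h₁.comp this)
  have hleft := h.abs_im_sub_im_half_le hR hR' hE hε hεE h₀
  have hright := h.const_sub_comp_const_sub.abs_im_sub_im_half_le hR hR' hE hε hεE hrefl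
  have hhalf : (R : ℂ) - (R / 2 : ℝ) = (R / 2 : ℝ) := by push_cast; ring
  have hval : (((Homeomorph.subLeft (R : ℂ)).transOpenPartialHomeomorph Φ).transHomeomorph
      (Homeomorph.subLeft (R' : ℂ))) (R / 2 : ℝ) = R' - Φ (R - (R / 2 : ℝ)) := rfl
  rw [hval, hhalf, ← Complex.sub_im, sub_sub_sub_cancel_left, Complex.sub_im] at hright
  rw [abs_sub_comm] at hleft
  rw [abs_sub_comm] at hright
  linarith [abs_sub_le L₁.im (Φ (R / 2 : ℝ)).im L₀.im]

end IsFiniteEnergyStripMap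

theorem IsL2Loc.aestronglyMeasurable {U : Set ℂ} (hU : IsOpen U) {g : ℂ → ℂ} (hg : IsL2Loc U g) :
    AEStronglyMeasurable g (volume.restrict U) := by
  refine LocallyIntegrableOn.aestronglyMeasurable
    ((locallyIntegrableOn_iff hU.isLocallyClosed).2 fun C hCU hC => ?_)
  have : IsFiniteMeasure (volume.restrict C) := ⟨by simpa using hC.measure_lt_top⟩
  exact (hg C hC hCU).integrable one_le_two

theorem aestronglyMeasurable_logDerivExp {R : ℝ} {C : Set ℂ} {ψ : ℂ → ℂ} {D : ℂ → ℂ →L[ℝ] ℂ}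
    (hC : MapsTo Complex.exp (vertStrip 0 R) C) (hψ : AEStronglyMeasurable ψ (volume.restrict C))
    (hD : AEStronglyMeasurable D (volume.restrict C)) :
    AEStronglyMeasurable (logDerivExp ψ D) (volume.restrict (vertStrip 0 R)) := by
  have hexp := quasiMeasurePreserving_exp hC
  have hinv : AEStronglyMeasurable (fun z => (ψ (Complex.exp z))⁻¹)
      (volume.restrict (vertStrip 0 R)) :=
    (hψ.comp_quasiMeasurePreserving hexp).aemeasurable.inv.aestronglyMeasurable
  have hmul : Continuous fun z => ContinuousLinearMap.mul ℝ ℂ (Complex.exp z) := by fun_prop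
  exact hinv.smul ((ContinuousLinearMap.compL ℝ ℂ ℂ ℂ).aestronglyMeasurable_comp₂
    (hD.comp_quasiMeasurePreserving hexp) hmul.aestronglyMeasurable)

namespace IsStripSobolev

variable {R : ℝ} {F : ℂ → ℂ} {D : ℂ → ℂ →L[ℝ] ℂ} {m : ℤ}

theorem congr_ae (h : IsStripSobolev R F D m) {D' : ℂ → ℂ →L[ℝ] ℂ}
    (hD : D =ᵐ[volume.restrict (vertStrip 0 R)] D') : IsStripSobolev R F D' m := by
  intro a b ha hb
  obtain ⟨f, hf, hdeg, hfF, hlim⟩ := h a b ha hb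
  refine ⟨f, hf, hdeg, hfF, fun c => (hlim c).congr fun n => lintegral_congr_ae ?_⟩
  have hsub : periodRect a b c ⊆ vertStrip 0 R := (periodRect_subset_vertStrip a b c).trans
    (preimage_mono (Ioo_subset_Ioo ha.le hb.le))
  filter_upwards [ae_restrict_of_ae_restrict_of_subset hsub hD] with z hz
  rw [hz]

theorem const_sub (h : IsStripSobolev R F D m) (p : ℂ) :
    IsStripSobolev R (fun z => p - F z) (fun z => -D z) (-m) := by
  intro a b ha hb
  obtain ⟨f, hf, hdeg, hfF, hlim⟩ := h a b ha hb
  refine ⟨fun n z => p - f n z, fun n => contDiffOn_const.sub (hf n),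
    fun n => (hdeg n).const_sub p, ?_, fun c => (hlim c).congr fun n => ?_⟩
  · simpa only [Metric.tendstoUniformlyOn_iff, dist_sub_left] using hfF
  · simp only [fderiv_const_sub, ← neg_sub_neg (D _), enorm_sub_rev]

end IsStripSobolev

theorem IsStripHomeo.exists_isFiniteEnergyStripMap {R R' K : ℝ} {Φ : OpenPartialHomeomorph ℂ ℂ}
    {D : ℂ → ℂ →L[ℝ] ℂ} {m : ℤ} (hR : 0 < R) (hR' : 0 < R') (hK : 0 < K)
    (hΦ : IsStripHomeo R R' Φ m) (hends : PreservesEnds R R' Φ) (hsob : IsStripSobolev R Φ D m)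
    (hD : AEStronglyMeasurable D (volume.restrict (vertStrip 0 R)))
    (hdet : ∀ᵐ z ∂volume.restrict (vertStrip 0 R), ‖D z‖ ^ 2 ≤ K * (D z).det) :
    ∃ ρ, IsFiniteEnergyStripMap R R' (2 * π * K ^ 2 * R) Φ ρ := by
  have hmk := hD.stronglyMeasurable_mk
  have hsob' := hsob.congr_ae hD.ae_eq_mk
  have hdet' : ∀ᵐ z ∂volume.restrict (vertStrip 0 R),
      ‖hD.mk D z‖ ^ 2 ≤ K * (hD.mk D z).det := by
    filter_upwards [hdet, hD.ae_eq_mk] with z hz heq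
    rwa [← heq]
  have hfinite : IsFiniteEnergyStripMap R R' (K * (R' * (2 * π))) Φ fun z => ‖hD.mk D z‖ₑ :=
    { homeo := ⟨m, hΦ⟩
      ends := hends
      measurable := hmk.measurable.enorm
      upperGradient := hsob'.isUpperGradientOnLines hR hmk.measurable
      energy c := setLIntegral_le_of_forall_periodRect hR fun a b ha hab hb =>
        hΦ.setLIntegral_enorm_sq_le hends hsob' hmk.aestronglyMeasurable hK hdet' ha hab hb c }
  refine ⟨_, hfinite.mono ?_⟩
  have hRR' : R' ≤ K * R := by
    have h := hfinite.two_pi_mul_sq_le hR hR'.le (by positivity)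
    refine le_of_mul_le_mul_left ?_ (mul_pos Real.two_pi_pos hR')
    linarith
  calc K * (R' * (2 * π)) ≤ K * (K * R * (2 * π)) := by gcongr
    _ = 2 * π * K ^ 2 * R := by ring

theorem ae_norm_sq_logDerivExp_le {R K : ℝ} (hK : 1 ≤ K) {C : Set ℂ}
    (hC : MapsTo Complex.exp (vertStrip 0 R) C) {fx fy : ℂ → ℂ}
    (h : ∀ᵐ w ∂volume.restrict C,
      ‖(fx w + I * fy w) / 2‖ ≤ (K - 1) / (K + 1) * ‖(fx w - I * fy w) / 2‖) (ψ : ℂ → ℂ) :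
    ∀ᵐ z ∂volume.restrict (vertStrip 0 R),
      ‖logDerivExp ψ (fun w => clmOfPartials (fx w) (fy w)) z‖ ^ 2 ≤
        K * (logDerivExp ψ (fun w => clmOfPartials (fx w) (fy w)) z).det := by
  filter_upwards [(quasiMeasurePreserving_exp hC).ae h] with z hz
  exact norm_sq_le_mul_det_smul_comp_mul (norm_sq_clmOfPartials_le_of_beltrami hK hz) _ _

theorem det_neg_clm (L : ℂ →L[ℝ] ℂ) : (-L).det = L.det := by
  simp [det_eq_re_mul_im_sub]

theorem IsQuasiconformal.exists_isFiniteEnergyStripMap {K r r' : ℝ} (hr : 1 < r) (hr' : 1 < r')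
    {ψ : OpenPartialHomeomorph ℂ ℂ} (hs : ψ.source = roundAnnulus r)
    (ht : ψ.target = roundAnnulus r') (hq : IsQuasiconformal K ψ) :
    ∃ (A : ℂ → ℂ) (Φ : OpenPartialHomeomorph ℂ ℂ) (ρ : ℂ → ℝ≥0∞),
      (∀ z ∈ vertStrip 0 (Real.log r), Complex.exp (A z) = ψ (Complex.exp z)) ∧
      (A = Φ ∨ A = fun z => Real.log r' - Φ z) ∧
      IsFiniteEnergyStripMap (Real.log r) (Real.log r') (2 * π * K ^ 2 * Real.log r) Φ ρ := by
  obtain ⟨hK, fx, fy, hfx, hfy, wx, wy, hbel⟩ := hq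
  rw [hs] at hfx hfy wx wy hbel
  have hψ : ContinuousOn ψ (roundAnnulus r) := hs ▸ ψ.continuousOn
  have hψ1 : ∀ w ∈ roundAnnulus r, 1 ≤ ‖ψ w‖ := fun w hw => (ht ▸ ψ.map_source (hs ▸ hw) :).1.le
  have hexp : MapsTo Complex.exp (vertStrip 0 (Real.log r)) (roundAnnulus r) := fun z =>
    (exp_mem_roundAnnulus (zero_lt_one.trans hr)).2
  have hU := isOpen_roundAnnulus r
  obtain ⟨F, m, hF, hFe⟩ := exists_isStripHomeo_lift hr hr' ψ hs ht
  have hsob := isStripSobolev_of_lift (zero_lt_one.trans hr) hψ hψ1 hfx hfy wx wy hF.continuousOn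
    hFe hF.hasDegreeOn
  have hD := aestronglyMeasurable_logDerivExp hexp (hψ.aestronglyMeasurable hU.measurableSet)
    (aestronglyMeasurable_clmOfPartials (hfx.aestronglyMeasurable hU)
      (hfy.aestronglyMeasurable hU))
  have hdet := ae_norm_sq_logDerivExp_le hK hexp hbel ψ
  have hK0 := zero_lt_one.trans_le hK
  have hR := Real.log_pos hr
  have hR' := Real.log_pos hr'
  rcases hF.preservesEnds_or hR hR' with hends | hends
  · obtain ⟨ρ, hρ⟩ := hF.exists_isFiniteEnergyStripMap hR hR' hK0 hends hsob hD hdet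
    exact ⟨F, F, ρ, hFe, .inl rfl, hρ⟩
  · obtain ⟨ρ, hρ⟩ := hF.const_sub.exists_isFiniteEnergyStripMap hR hR' hK0 hends
      (hsob.const_sub _) hD.neg (by simpa only [norm_neg, det_neg_clm] using hdet)
    exact ⟨F, _, ρ, hFe, .inr (funext fun z => (sub_sub_self _ (F z)).symm), hρ⟩

theorem IsFiniteEnergyStripMap.exists_continuousOn_extension {R R' E ε : ℝ}
    {Φ : OpenPartialHomeomorph ℂ ℂ} {ρ : ℂ → ℝ≥0∞} (h : IsFiniteEnergyStripMap R R' E Φ ρ)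
    (hR : 0 < R) (hR' : 0 < R') (hE : 0 ≤ E) (hε : 0 ≤ ε) (hεE : 16 * (R / π + π / R) * E < ε ^ 2) :
    ∃ B : ℂ → ℂ, ContinuousOn B (Complex.re ⁻¹' Icc 0 R) ∧ EqOn B Φ (vertStrip 0 R) ∧
      |(B R).im - (B 0).im| ≤ 4 * ε := by
  obtain ⟨m, hm⟩ := h.homeo
  have hclosure : Complex.re ⁻¹' Icc 0 R ⊆ closure (vertStrip 0 R) := by
    rw [vertStrip, Complex.closure_preimage_re, closure_Ioo hR.ne]
  have hlim : ∀ z ∈ Complex.re ⁻¹' Icc 0 R, ∃ L, Tendsto Φ (𝓝[vertStrip 0 R] z) (𝓝 L) :=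
    fun z hz => h.exists_tendsto hR hR' hE hz
  exact ⟨extendFrom (vertStrip 0 R) Φ, continuousOn_extendFrom hclosure hlim,
    extendFrom_extends hm.continuousOn, h.abs_im_sub_im_le hR hR' hE hε hεE
      (tendsto_extendFrom (hlim 0 ⟨le_rfl, hR.le⟩)) (tendsto_extendFrom (hlim R ⟨hR.le, le_rfl⟩))⟩

theorem exists_log_extension (K : ℝ) {r : ℝ} (hr : 1 < r) :
    ∃ N : ℝ, ∀ r', 1 < r' → ∀ ψ : OpenPartialHomeomorph ℂ ℂ, ψ.source = roundAnnulus r →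
      ψ.target = roundAnnulus r' → IsQuasiconformal K ψ → ∃ B : ℂ → ℂ,
        ContinuousOn B (Complex.re ⁻¹' Icc 0 (Real.log r)) ∧
        (∀ z ∈ vertStrip 0 (Real.log r), Complex.exp (B z) = ψ (Complex.exp z)) ∧
        |(B (Real.log r)).im - (B 0).im| ≤ N := by
  have hR := Real.log_pos hr
  set E := 2 * π * K ^ 2 * Real.log r
  have hE : 0 ≤ E := by positivity
  set c := 16 * (Real.log r / π + π / Real.log r) * E
  have hc : 0 ≤ c := by positivity
  refine ⟨4 * (c + 1), fun r' hr' ψ hs ht hq => ?_⟩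
  obtain ⟨A, Φ, ρ, hA, hAΦ, hΦ⟩ := hq.exists_isFiniteEnergyStripMap hr hr' hs ht
  obtain ⟨B, hB, hBΦ, hBN⟩ := hΦ.exists_continuousOn_extension (ε := c + 1) hR (Real.log_pos hr')
    hE (by positivity) (show c < (c + 1) ^ 2 by nlinarith)
  rcases hAΦ with rfl | rfl
  · exact ⟨B, hB, fun z hz => by rw [hBΦ hz, hA z hz], hBN⟩
  · refine ⟨fun z => Real.log r' - B z, continuousOn_const.sub hB,
      fun z hz => by simpa only [hBΦ hz] using hA z hz, ?_⟩
    rw [abs_sub_comm]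
    simpa [neg_add_eq_sub] using hBN

theorem image_exp_preimage_re_Icc {r : ℝ} (hr : 0 < r) :
    Complex.exp '' (Complex.re ⁻¹' Icc 0 (Real.log r)) = closedRoundAnnulus r := by
  ext w
  constructor
  · rintro ⟨z, ⟨h0, h1⟩, rfl⟩
    simpa [closedRoundAnnulus, Complex.norm_exp, ← Real.le_log_iff_exp_le hr] using And.intro h0 h1
  · intro hw
    have hw0 : 0 < ‖w‖ := zero_lt_one.trans_le hw.1
    refine ⟨Complex.log w, ?_, Complex.exp_log (norm_pos_iff.1 hw0)⟩
    rw [mem_preimage, Complex.log_re]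
    exact ⟨Real.log_nonneg hw.1, Real.log_le_log hw0 hw.2⟩

theorem closedRoundAnnulus_subset_closure {r : ℝ} (hr : 1 < r) :
    closedRoundAnnulus r ⊆ closure (roundAnnulus r) := by
  have hr0 := zero_lt_one.trans hr
  rw [← image_exp_preimage_re_Icc hr0, ← closure_Ioo (Real.log_pos hr).ne,
    ← Complex.closure_preimage_re, image_subset_iff]
  exact Complex.continuous_exp.closure_preimage_subset _ |>.trans' <|
    closure_mono fun z hz => (exp_mem_roundAnnulus hr0).2 hz

theorem tendsto_nhdsWithin_roundAnnulus_of_exp_eq {r : ℝ} (hr : 0 < r) {ψ B : ℂ → ℂ}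
    (hB : ContinuousOn B (Complex.re ⁻¹' Icc 0 (Real.log r)))
    (hBψ : ∀ z ∈ vertStrip 0 (Real.log r), Complex.exp (B z) = ψ (Complex.exp z)) {z : ℂ}
    (hz : z.re ∈ Icc 0 (Real.log r)) :
    Tendsto ψ (𝓝[roundAnnulus r] Complex.exp z) (𝓝 (Complex.exp (B z))) := by
  -- the branch of `log` near `exp z` whose value at `exp z` is `z`
  set ℓ : ℂ → ℂ := fun w => z + Complex.log (w / Complex.exp z) with hℓ
  have hz0 := Complex.exp_ne_zero z
  have hexp : ∀ w ∈ roundAnnulus r, Complex.exp (ℓ w) = w := fun w hw => by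
    have hw0 : w ≠ 0 := norm_pos_iff.1 (zero_lt_one.trans hw.1)
    rw [Complex.exp_add, Complex.exp_log (div_ne_zero hw0 hz0), mul_div_cancel₀ _ hz0]
  have hmem : ∀ w ∈ roundAnnulus r, ℓ w ∈ vertStrip 0 (Real.log r) := fun w hw => by
    rwa [← exp_mem_roundAnnulus hr, hexp w hw]
  have hcont : ContinuousAt ℓ (Complex.exp z) := by
    refine continuousAt_const.add (ContinuousAt.clog (by fun_prop) ?_)
    rw [div_self hz0]
    exact Complex.one_mem_slitPlane
  have hlim : Tendsto ℓ (𝓝[roundAnnulus r] Complex.exp z)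
      (𝓝[Complex.re ⁻¹' Icc 0 (Real.log r)] z) := by
    refine tendsto_nhdsWithin_iff.2 ⟨?_, ?_⟩
    · simpa [hℓ, hz0] using hcont.tendsto.mono_left nhdsWithin_le_nhds
    · filter_upwards [self_mem_nhdsWithin] with w hw using Ioo_subset_Icc_self (hmem w hw)
  refine ((Complex.continuous_exp.tendsto _).comp ((hB z hz).tendsto.comp hlim)).congr' ?_
  filter_upwards [self_mem_nhdsWithin] with w hw
  rw [Function.comp_apply, Function.comp_apply, hBψ _ (hmem w hw), hexp w hw]

theorem exists_continuousOn_extension_of_exp_eq {r : ℝ} (hr : 1 < r) {ψ B : ℂ → ℂ}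
    (hψ : ContinuousOn ψ (roundAnnulus r))
    (hB : ContinuousOn B (Complex.re ⁻¹' Icc 0 (Real.log r)))
    (hBψ : ∀ z ∈ vertStrip 0 (Real.log r), Complex.exp (B z) = ψ (Complex.exp z)) :
    ∃ Ψ : ℂ → ℂ, ContinuousOn Ψ (closedRoundAnnulus r) ∧ EqOn Ψ ψ (roundAnnulus r) ∧
      ∀ z : ℂ, z.re ∈ Icc 0 (Real.log r) → Ψ (Complex.exp z) = Complex.exp (B z) := by
  have hr0 := zero_lt_one.trans hr
  have hlim {z : ℂ} (hz : z.re ∈ Icc 0 (Real.log r)) :=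
    tendsto_nhdsWithin_roundAnnulus_of_exp_eq hr0 hB hBψ hz
  have hclosure := closedRoundAnnulus_subset_closure hr
  rw [← image_exp_preimage_re_Icc hr0] at hclosure ⊢
  refine ⟨extendFrom (roundAnnulus r) ψ, continuousOn_extendFrom hclosure ?_,
    extendFrom_extends hψ, fun z hz => extendFrom_eq (hclosure (mem_image_of_mem _ hz)) (hlim hz)⟩
  rintro _ ⟨z, hz, rfl⟩
  exact ⟨_, hlim hz⟩

theorem hasWrappingNumber_of_exp_eq {r : ℝ} {Ψ B : ℂ → ℂ}
    (hB : ContinuousOn B (Complex.re ⁻¹' Icc 0 (Real.log r)))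
    (hΨ : ∀ z : ℂ, z.re ∈ Icc 0 (Real.log r) → Ψ (Complex.exp z) = Complex.exp (B z)) :
    HasWrappingNumber (fun t : ℝ => Ψ t) 1 r ((B (Real.log r)).im - (B 0).im) := by
  have hlog : MapsTo (fun t : ℝ => (Real.log t : ℂ)) (Icc 1 r)
      (Complex.re ⁻¹' Icc 0 (Real.log r)) := fun t ht =>
    ⟨Real.log_nonneg ht.1, Real.log_le_log (zero_lt_one.trans_le ht.1) ht.2⟩
  have hBlog : ContinuousOn (fun t : ℝ => B (Real.log t)) (Icc 1 r) :=
    hB.comp (Complex.continuous_ofReal.comp_continuousOn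
      (Real.continuousOn_log.mono fun t ht => (zero_lt_one.trans_le ht.1).ne')) hlog
  refine ⟨fun t => Real.exp (B (Real.log t)).re, fun t => (B (Real.log t)).im,
    Real.continuous_exp.comp_continuousOn (Complex.continuous_re.comp_continuousOn hBlog),
    Complex.continuous_im.comp_continuousOn hBlog, fun t ht => ⟨Real.exp_pos _, ?_⟩, by simp⟩
  have h := hΨ _ (hlog ht)
  rwa [← Complex.ofReal_exp, Real.exp_log (zero_lt_one.trans_le ht.1),
    ← Complex.re_add_im (B _), Complex.exp_add, ← Complex.ofReal_exp] at h

theorem mainTheorem9 (K r : ℝ) (hK : 1 ≤ K) (hr : 1 < r) :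
    ∃ N : ℝ, ∀ r' : ℝ, 1 < r' → ∀ ψ : OpenPartialHomeomorph ℂ ℂ,
      ψ.source = roundAnnulus r → ψ.target = roundAnnulus r' → IsQuasiconformal K ψ →
        ∃ Ψ : ℂ → ℂ, ContinuousOn Ψ (closedRoundAnnulus r) ∧ EqOn Ψ ψ (roundAnnulus r) ∧
          ∃ w ∈ Icc (-N) N, HasWrappingNumber (fun t : ℝ => Ψ (t : ℂ)) 1 r w := by
  obtain ⟨N, hN⟩ := exists_log_extension K hr
  refine ⟨N, fun r' hr' ψ hs ht hq => ?_⟩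
  obtain ⟨B, hB, hBψ, hBN⟩ := hN r' hr' ψ hs ht hq
  obtain ⟨Ψ, hΨ, hΨψ, hexp⟩ := exists_continuousOn_extension_of_exp_eq hr
    (hs ▸ ψ.continuousOn) hB hBψ
  exact ⟨Ψ, hΨ, hΨψ, _, abs_le.1 hBN, hasWrappingNumber_of_exp_eq hB hexp⟩
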